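/- **Conventions.** Let $\Omega\subset\mathbb{C}^n$ be a bounded domain (open and connected) with boundary $b\Omega$. It is pseudoconvex if it admits a $C^\infty$ strictly plurisubharmonic exhaustion function. Let $\tilde\delta$ be the signed distance function to $b\Omega$: $\tilde\delta(z)=-\mathrm{dist}(z,b\Omega)$ for $z\in\Omega$ and $\tilde\delta(z)=\mathrm{dist}(z,b\Omega)$ for $z\notin\Omega$. For a vector $\tau=\sum_j\tau_j\frac{\partial}{\partial z_j}$ of type $(1,0)$ at $z$, and for functions $f$ ($f$ real-valued in the second formula), write $$\partial f(\tau)=\sum_j\frac{\partial f}{\partial z_j}(z)\,\tau_j,\qquad i\partial\bar\partial f(\tau,\bar\tau)=\sum_{j,k}\frac{\partial^2 f}{\partial z_j\partial\bar z_k}(z)\,\tau_j\bar\tau_k,$$ $$\alpha(\tau)=2\sum_j\frac{\partial\tilde\delta}{\partial z_j}\,\partial\Big(\frac{\partial\tilde\delta}{\partial\bar z_j}\Big)(\tau),\qquad \beta(\tau,\bar\tau)=\sum_j\left(\Big|\partial\Big(\frac{\partial\tilde\delta}{\partial z_j}\Big)(\tau)\Big|^2+\Big|\partial\Big(\frac{\partial\tilde\delta}{\partial\bar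 z_j}\Big)(\tau)\Big|^2\right)-2|\alpha(\tau)|^2 .$$ (These are the values on $\tau$ of the real forms $\alpha=4\sum_j\mathrm{Re}\big(\frac{\partial\tilde\delta}{\partial\bar z_j}\bar\partial\frac{\partial\tilde\delta}{\partial z_j}\big)$ and $\beta=\sum_j i\big(\partial\frac{\partial\tilde\delta}{\partial z_j}\wedge\bar\partial\frac{\partial\tilde\delta}{\partial\bar z_j}+\partial\frac{\partial\tilde\delta}{\partial\bar z_j}\wedge\bar\partial\frac{\partial\tilde\delta}{\partial z_j}\big)-2i\,\alpha^{1,0}\wedge\alpha^{0,1}$, where a real $(1,1)$-form $\Theta$ acts by $\Theta(X,\bar Y)=\Theta(-iX\wedge\bar Y)$.) For $z\in b\Omega$, let $T^{1,0}_z(b\Omega)$ be the space of vectors $\tau$ of type $(1,0)$ at $z$ with $\partial\tilde\delta(\tau)=0$. A $C^k$ defining function for $\Omega$ is a real-valued $C^k$ function $\rho$ on an open neighborhood $V$ of $b\Omega$ such that $\{z\in V:\rho(z)<0\}=V\cap\Omega$, $\{z\in V:\rho(z)=0\}=b\Omega$, and $d\rho\neq0$ on $b\Omega$. Neighborhoods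 are open. **Proposition.** Let $\Omega\subset\mathbb{C}^n$ be a bounded pseudoconvex domain with $C^k$ boundary, $3\le k\le\infty$. 1. Suppose that for some $0<\eta<1$ there is a $C^2$ defining function $\rho_\eta$ for $\Omega$, and a neighborhood $U_\eta$ of $b\Omega$ on which $\rho_\eta$ is defined, such that $-(-\rho_\eta)^\eta$ is plurisubharmonic on $U_\eta\cap\Omega$. Then for every $0<s<\eta$ there exist a neighborhood $U_s\subset U_\eta$ of $b\Omega$ and a real-valued function $\varphi_s\in C^\infty(U_s)$ such that, for every $z\in b\Omega$ and every nonzero $\tau\in T^{1,0}_z(b\Omega)$, $$\frac{s}{1-s}\,\big|\partial\varphi_s(\tau)-2\alpha(\tau)\big|^2<i\partial\bar\partial\varphi_s(\tau,\bar\tau)+2\beta(\tau,\bar\tau).$$ 2. Suppose that for some $0<s<1$ there are a neighborhood $U_s$ of $b\Omega$ and a real-valued function $\varphi_s\in C^k(U_s)$ such that, for every $z\in b\Omega$ and every $\tau\in T^{1,0}_z(b\Omega)$, $$\frac{s}{1-s}\,\big|\partial\varphi_s(\tau)-2\alpha(\tau)\big|^2\le i\partial\bar\partial\varphi_s(\tau,\bar\tau)+2\beta(\tau,\bar\tau).$$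 Then for every $0<\eta<s$ there are a $C^k$ defining function $\rho_\eta$ for $\Omega$ and a neighborhood $U_\eta$ of $b\Omega$ on which $\rho_\eta$ is defined, such that $-(-\rho_\eta)^\eta$ is strictly plurisubharmonic on $U_\eta\cap\Omega$. -/

import Mathlib

open scoped ContDiff ComplexConjugate

namespace DFIndex

/-- The space `ℂⁿ` with its Euclidean norm. -/
abbrev Cn (n : ℕ) : Type := EuclideanSpace ℂ (Fin n)

noncomputable section

variable {n : ℕ}

/-! ### Complex derivatives -/

/-- `∂f/∂z_j = (∂f/∂x_j - i ∂f/∂y_j) / 2`. -/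
def dz (j : Fin n) (f : Cn n → ℂ) (z : Cn n) : ℂ :=
  (fderiv ℝ f z (EuclideanSpace.single j 1)
    - Complex.I * fderiv ℝ f z (EuclideanSpace.single j Complex.I)) / 2

/-- `∂f/∂z̄_j = (∂f/∂x_j + i ∂f/∂y_j) / 2`. -/
def dzbar (j : Fin n) (f : Cn n → ℂ) (z : Cn n) : ℂ :=
  (fderiv ℝ f z (EuclideanSpace.single j 1)
    + Complex.I * fderiv ℝ f z (EuclideanSpace.single j Complex.I)) / 2

/-- `(∂f)(τ) = ∑ j, (∂f/∂z_j) τ_j`, for the vector `τ = ∑ j, τ_j ∂/∂z_j` of type `(1,0)` at `z`. -/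
def del (f : Cn n → ℂ) (z τ : Cn n) : ℂ :=
  ∑ j, dz j f z * τ j

/-- `i∂∂̄f(τ, τ̄) = ∑ j k, (∂²f/∂z_j∂z̄_k) τ_j τ̄_k`, for a real-valued function `f` (of class `C²`
near `z`, so that this sum is real) and a vector `τ` of type `(1,0)` at `z`.  A real `(1,1)`-form
`Θ` acts on such vectors by `Θ(X, Ȳ) = Θ(-i X ∧ Ȳ)`. -/
def leviForm (f : Cn n → ℝ) (z τ : Cn n) : ℝ :=
  (∑ j, ∑ k, dz j (dzbar k (fun w => (f w : ℂ))) z * τ j * conj (τ k)).re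

/-! ### Plurisubharmonic functions and pseudoconvexity -/

/-- A function of class `C²` is plurisubharmonic on the open set `S` if its complex Hessian is
positive semi-definite at every point of `S`. -/
def IsC2PshOn (f : Cn n → ℝ) (S : Set (Cn n)) : Prop :=
  ContDiffOn ℝ 2 f S ∧ ∀ z ∈ S, ∀ τ : Cn n, 0 ≤ leviForm f z τ

/-- A function of class `C²` is strictly plurisubharmonic on the open set `S` if its complex Hessian
is positive definite at every point of `S`. -/
def IsC2StrictlyPshOn (f : Cn n → ℝ) (S : Set (Cn n)) : Prop :=
  ContDiffOn ℝ 2 f S ∧ ∀ z ∈ S, ∀ τ : Cn n, τ ≠ 0 → 0 < leviForm f z τ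

/-- `Ω` admits a smooth strictly plurisubharmonic exhaustion function. -/
def IsPseudoconvex (Ω : Set (Cn n)) : Prop :=
  ∃ u : Cn n → ℝ, ContDiffOn ℝ ∞ u Ω ∧ IsC2StrictlyPshOn u Ω ∧
    ∀ c : ℝ, IsCompact {z ∈ Ω | u z ≤ c}

/-! ### Boundaries and defining functions -/

/-- The open set `Ω` has `C^k` boundary: near each of its boundary points it is the set where some
`C^k` function with non-vanishing differential is negative. -/
def HasCkBoundary (k : ℕ∞) (Ω : Set (Cn n)) : Prop :=
  ∀ p ∈ frontier Ω, ∃ (V : Set (Cn n)) (r : Cn n → ℝ), IsOpen V ∧ p ∈ V ∧ ContDiffOn ℝ k r V ∧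
    (∀ z ∈ V, z ∈ Ω ↔ r z < 0) ∧ fderiv ℝ r p ≠ 0

/-- `V` is an open neighbourhood of the boundary of `Ω`. -/
def IsBoundaryNhd (Ω V : Set (Cn n)) : Prop :=
  IsOpen V ∧ frontier Ω ⊆ V

/-- `ρ` is a `C^k` defining function for `Ω` on the open neighbourhood `V` of the boundary
(only the values of `ρ` on `V` matter). -/
structure IsDefiningFunctionOn (k : ℕ∞) (Ω V : Set (Cn n)) (ρ : Cn n → ℝ) : Prop where
  isBoundaryNhd : IsBoundaryNhd Ω V
  contDiffOn : ContDiffOn ℝ k ρ V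
  neg_iff : ∀ z ∈ V, ρ z < 0 ↔ z ∈ Ω
  zero_iff : ∀ z ∈ V, ρ z = 0 ↔ z ∈ frontier Ω
  fderiv_ne_zero : ∀ z ∈ frontier Ω, fderiv ℝ ρ z ≠ 0

/-! ### The signed distance function and the forms `α` and `β` -/

open Classical in
/-- The signed distance to the boundary of `Ω`: negative on `Ω`, non-negative outside. -/
def signedDist (Ω : Set (Cn n)) (z : Cn n) : ℝ :=
  if z ∈ Ω then -Metric.infDist z (frontier Ω) else Metric.infDist z (frontier Ω)

/-- The signed distance as a complex-valued function. -/
def sd (Ω : Set (Cn n)) (z : Cn n) : ℂ := (signedDist Ω z : ℂ)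

/-- The vector `τ` of type `(1,0)` at the boundary point `z` is tangent to the boundary of `Ω`:
`∂δ̃(τ) = 0` for the signed distance `δ̃`. -/
def IsComplexTangent (Ω : Set (Cn n)) (z τ : Cn n) : Prop :=
  del (sd Ω) z τ = 0

/-- `α(τ)` for the real one-form `α = 4 ∑ j, Re ((∂δ̃/∂z̄_j) ∂̄(∂δ̃/∂z_j))` and `τ` of type `(1,0)`.
As `Re θ = (θ + θ̄) / 2`, the `(1,0)`-component of `α` is `2 ∑ j, (∂δ̃/∂z_j) ∂(∂δ̃/∂z̄_j)`. -/
def alpha (Ω : Set (Cn n)) (z τ : Cn n) : ℂ :=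
  2 * ∑ j, dz j (sd Ω) z * del (dzbar j (sd Ω)) z τ

/-- `β(τ, τ̄)` for the real `(1,1)`-form
`β = ∑ j, i (∂(∂δ̃/∂z_j) ∧ ∂̄(∂δ̃/∂z̄_j) + ∂(∂δ̃/∂z̄_j) ∧ ∂̄(∂δ̃/∂z_j)) - 2i α^{1,0} ∧ α^{0,1}`;
here `∂̄(∂δ̃/∂z̄_j)(τ̄)` is the conjugate of `∂(∂δ̃/∂z_j)(τ)`, and similarly for the other terms. -/
def beta (Ω : Set (Cn n)) (z τ : Cn n) : ℝ :=
  ∑ j, (‖del (dz j (sd Ω)) z τ‖ ^ 2 + ‖del (dzbar j (sd Ω)) z τ‖ ^ 2) - 2 * ‖alpha Ω z τ‖ ^ 2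

/-- The left-hand side `(s / (1 - s)) |∂φ(τ) - 2α(τ)|²`. -/
def gradientSide (Ω : Set (Cn n)) (s : ℝ) (φ : Cn n → ℝ) (z τ : Cn n) : ℝ :=
  s / (1 - s) * ‖del (fun w => (φ w : ℂ)) z τ - 2 * alpha Ω z τ‖ ^ 2

/-- The right-hand side `i∂∂̄φ(τ, τ̄) + 2β(τ, τ̄)`. -/
def hessianSide (Ω : Set (Cn n)) (φ : Cn n → ℝ) (z τ : Cn n) : ℝ :=
  leviForm φ z τ + 2 * beta Ω z τ

end

end DFIndex

/-! Put N = ∇δ̃ and S = DN, and let B_f(τ) = D²f(τ,τ) + D²f(iτ,iτ), four times the Levi form of f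
(`leviForm_eq`). With ψ = -log(-ρ), plurisubharmonicity of -(-ρ)^η says B_ψ(X) ≥ η(Dψ(X)² + Dψ(iX)²)
for all X (`leviForm_neg_rpow`). With 4α(τ) = a₁ - i a₂, x₁ = Dφ(τ) and x₂ = Dφ(iτ), the boundary
inequality says s/(1-s) · ((x₁-a₁)² + (x₂-a₂)²) ≤ B_φ(τ) + |Sτ|² + |S(iτ)|² - a₁² - a₂².

The two are linked by adding to a complex tangent vector τ a normal part δ(d₁N - d₂iN), where δ is
the distance to the boundary. As Dψ grows like 1/δ in the normal direction, this adds terms of order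
one, namely 2da + d² - η(x+d)² for each of the two components. The minimum over d is -a² -
η/(1-η)(x-a)² (`complete_square`); hence the constant η/(1-η) and the form α.

From φ to ρ: take ρ = δ̃ exp(-φ - ε|z|²). The Levi form of δ̃ at z is the one at the foot point plus
δ times a bounded form that tends to |Sτ|² + |S(iτ)|² (`IsCollar.shape_eq_shape_foot`).
Pseudoconvexity makes the first term non-negative (`IsCollar.realLevi_nonneg`), so the only part
that is singular after division by δ can be dropped. What is left is continuous up to the boundary
and positive there, hence positive nearby by compactness (`IsCollar.eventually_barrier`).

From ρ to φ: ψ is infinite on the boundary, so it is pulled back by the inward translation y ↦ y -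
tN(y). Plurisubharmonicity tested on τ + tw, with w the optimal normal vector, bounds B_ψ(τ) from
below (`InwardFamily.exists_lower_bound`). The translation itself costs |Sτ|² + |S(iτ)|² in the
limit (`InwardFamily.lim_hess_comp_sub`), which is exactly what the right-hand side supplies. For a
small t the function ψ(y - tN(y)) + ε|y|² satisfies the strict inequality on the compact set of unit
complex tangent vectors, and a smooth C² approximation keeps it.

In both directions the gap between s and η pays for the term ε|z|², which makes the inequality
strict (`exists_perturbation`). -/

open scoped ContDiff ComplexConjugate
open Filter Topology Set

namespace DFIndex

/-! ### Regularity of the signed distance near the boundary. -/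

section SignedDistance

variable {E : Type*} [NormedAddCommGroup E] [InnerProductSpace ℝ E]

/-- A point of an open set where a local defining function vanishes with non-zero differential lies
on the boundary, and conversely. -/
theorem mem_frontier_iff_of_local {Ω V : Set E} {r : E → ℝ} (hΩ : IsOpen Ω) (hV : IsOpen V)
    (hr : ∀ z ∈ V, z ∈ Ω ↔ r z < 0) {y : E} (hy : y ∈ V) {r' : E →L[ℝ] ℝ}
    (hd : HasFDerivAt r r' y) (hr' : r' ≠ 0) : y ∈ frontier Ω ↔ r y = 0 := by
  rw [hΩ.frontier_eq, Set.mem_sdiff, hr y hy, not_lt]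
  constructor
  · rintro ⟨hcl, h0⟩
    refine le_antisymm ?_ h0
    have hfr : ∃ᶠ z in 𝓝 y, r z ≤ 0 := by
      refine ((mem_closure_iff_frequently.1 hcl).and_eventually (hV.mem_nhds hy)).mono ?_
      rintro z ⟨hz, hzV⟩
      exact ((hr z hzV).1 hz).le
    by_contra hpos
    have hev : ∀ᶠ z in 𝓝 y, 0 < r z := hd.continuousAt.eventually_const_lt (not_le.1 hpos)
    obtain ⟨z, hz, hz'⟩ := (hfr.and_eventually hev).exists
    exact absurd hz (not_le.2 hz')
  · intro h0
    refine ⟨?_, h0.ge⟩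
    by_contra hcl
    have hmin : IsLocalMin r y := by
      have hev : ∀ᶠ z in 𝓝 y, z ∉ closure Ω :=
        isClosed_closure.isOpen_compl.mem_nhds hcl
      filter_upwards [hev, hV.mem_nhds hy] with z hz hzV
      rw [h0]
      by_contra hlt
      exact hz (subset_closure ((hr z hzV).2 (not_le.1 hlt)))
    exact hr' (hmin.hasFDerivAt_eq_zero hd)

variable [FiniteDimensional ℝ E]

/-- Local structure of the signed distance `d` at a boundary point. -/
theorem signedDistance_local {Ω : Set E} (hΩ : IsOpen Ω) (hc : IsCompact (frontier Ω)) {d : E → ℝ}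
    (hdin : ∀ z ∈ Ω, d z = -Metric.infDist z (frontier Ω))
    (hdout : ∀ z ∉ Ω, d z = Metric.infDist z (frontier Ω))
    {m : ℕ∞} (hm : 1 ≤ m) {p : E} (hp : p ∈ frontier Ω) {V : Set E} {r : E → ℝ}
    (hV : IsOpen V) (hpV : p ∈ V) (hrV : ContDiffOn ℝ ((m + 1 : ℕ∞) : WithTop ℕ∞) r V)
    (hr : ∀ z ∈ V, z ∈ Ω ↔ r z < 0) (hr' : fderiv ℝ r p ≠ 0) :
    ∃ U : Set E, IsOpen U ∧ p ∈ U ∧ ContDiffOn ℝ ((m + 1 : ℕ∞) : WithTop ℕ∞) d U ∧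
      ∀ x ∈ U, ‖gradient d x‖ = 1 ∧ x - d x • gradient d x ∈ frontier Ω ∧
        gradient d (x - d x • gradient d x) = gradient d x := by
  have hm1 : (1 : WithTop ℕ∞) ≤ (m : WithTop ℕ∞) := by exact_mod_cast hm
  have hm0 : (m : WithTop ℕ∞) ≠ 0 := by
    intro h; rw [h] at hm1; exact absurd hm1 (by simp)
  have hmtop : (m : WithTop ℕ∞) ≠ ⊤ := by
    intro h; exact absurd h (by simp)
  rw [show ((m + 1 : ℕ∞) : WithTop ℕ∞) = (m : WithTop ℕ∞) + 1 by push_cast; rfl] at *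
  obtain ⟨hrdiff, -, hrC⟩ := (contDiffOn_succ_iff_fderiv_of_isOpen hV).1 hrV
  set γ : E → E := gradient r with hγ
  have hγC : ContDiffOn ℝ m γ V :=
    (InnerProductSpace.toDual ℝ E).symm.toContinuousLinearEquiv.contDiff.comp_contDiffOn hrC
  have hγfd : ∀ x, fderiv ℝ r x = innerSL ℝ (γ x) := by
    intro x; ext v; simp [hγ, gradient]
  have hrd : ∀ x ∈ V, HasFDerivAt r (innerSL ℝ (γ x)) x := fun x hx => by
    rw [← hγfd]; exact (hrdiff.differentiableAt (hV.mem_nhds hx)).hasFDerivAt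
  have hγp : γ p ≠ 0 := by
    intro h; apply hr'; rw [hγfd, h]; simp
  -- the normal
  obtain ⟨V', hV'V, hV', hpV', hγ0⟩ : ∃ V' ⊆ V, IsOpen V' ∧ p ∈ V' ∧ ∀ x ∈ V', γ x ≠ 0 := by
    refine ⟨V ∩ γ ⁻¹' {0}ᶜ, inter_subset_left, hγC.continuousOn.isOpen_inter_preimage hV
      isOpen_compl_singleton, ⟨hpV, hγp⟩, fun x hx => hx.2⟩
  set ν : E → E := fun x => ‖γ x‖⁻¹ • γ x with hν
  have hνC : ContDiffOn ℝ m ν V' := by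
    refine ContDiffOn.smul ?_ (hγC.mono hV'V)
    exact ((hγC.mono hV'V).norm ℝ hγ0).inv fun x hx => norm_ne_zero_iff.2 (hγ0 x hx)
  have hν1 : ∀ x ∈ V', ‖ν x‖ = 1 := fun x hx => by
    simp [hν, norm_smul, inv_mul_cancel₀ (norm_ne_zero_iff.2 (hγ0 x hx))]
  have hγν : ∀ x ∈ V', γ x = ‖γ x‖ • ν x := fun x hx => by
    simp [hν, smul_smul, mul_inv_cancel₀ (norm_ne_zero_iff.2 (hγ0 x hx))]
  have hνd : ∀ x ∈ V', HasFDerivAt ν (fderiv ℝ ν x) x := fun x hx =>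
    ((hνC.contDiffAt (hV'.mem_nhds hx)).differentiableAt hm0).hasFDerivAt
  have hνν : ∀ x ∈ V', ∀ w, inner ℝ (ν x) (fderiv ℝ ν x w) = 0 := by
    intro x hx w
    have h1 := (hνd x hx).inner ℝ (hνd x hx)
    have h2 : HasFDerivAt (fun y => inner ℝ (ν y) (ν y)) (0 : E →L[ℝ] ℝ) x := by
      refine (hasFDerivAt_const (1 : ℝ) x).congr_of_eventuallyEq ?_
      filter_upwards [hV'.mem_nhds hx] with y hy
      rw [real_inner_self_eq_norm_sq, hν1 y hy]; norm_num
    have h3 := congrArg (fun L : E →L[ℝ] ℝ => L w) (h1.unique h2)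
    simp [fderivInnerCLM_apply, real_inner_comm] at h3
    exact h3
  have hfr : ∀ y ∈ V', y ∈ frontier Ω ↔ r y = 0 := fun y hy =>
    mem_frontier_iff_of_local hΩ hV hr (hV'V hy) (hrd y (hV'V hy)) (by
      intro h
      have := congrArg (fun L : E →L[ℝ] ℝ => L (γ y)) h
      simp [hγ0 y hy] at this)
  -- the local diffeomorphism
  set G : E × ℝ → E × ℝ := fun q => (q.1 + q.2 • ν q.1, r q.1) with hG
  have hGC : ContDiffOn ℝ m G (V' ×ˢ univ) := by
    have hfst : ContDiffOn ℝ m (Prod.fst : E × ℝ → E) (V' ×ˢ univ) := contDiffOn_fst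
    have hmaps : MapsTo (Prod.fst : E × ℝ → E) (V' ×ˢ univ) V' := fun q hq => hq.1
    refine ContDiffOn.prodMk (hfst.add (contDiffOn_snd.smul (hνC.comp hfst hmaps))) ?_
    exact (((hrV.of_le le_self_add).mono hV'V).comp hfst hmaps)
  have hGopen : IsOpen (V' ×ˢ (univ : Set ℝ)) := hV'.prod isOpen_univ
  have hGat : ∀ q ∈ V' ×ˢ (univ : Set ℝ), ContDiffAt ℝ m G q := fun q hq =>
    hGC.contDiffAt (hGopen.mem_nhds hq)
  have hp0 : (p, (0 : ℝ)) ∈ V' ×ˢ (univ : Set ℝ) := ⟨hpV', mem_univ _⟩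
  have hGp : HasFDerivAt G (((ContinuousLinearMap.fst ℝ E ℝ) +
      (ContinuousLinearMap.snd ℝ E ℝ).smulRight (ν p)).prod
        ((innerSL ℝ (γ p)).comp (ContinuousLinearMap.fst ℝ E ℝ))) (p, 0) := by
    refine HasFDerivAt.prodMk ?_ ?_
    · have h0 : HasFDerivAt (fun q : E × ℝ => ν q.1)
          ((fderiv ℝ ν p).comp (ContinuousLinearMap.fst ℝ E ℝ)) (p, 0) :=
        HasFDerivAt.comp (g := ν) (f := Prod.fst) (p, (0 : ℝ)) (hνd p hpV') hasFDerivAt_fst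
      have h1 := (hasFDerivAt_snd (𝕜 := ℝ) (E := E) (F := ℝ)).smul h0
      have h2 := (hasFDerivAt_fst (𝕜 := ℝ) (E := E) (F := ℝ) (p := (p, (0 : ℝ)))).add h1
      refine h2.congr_fderiv ?_
      ext v <;> simp
    · exact (hrd p hpV).comp (p, (0 : ℝ)) (hasFDerivAt_fst (𝕜 := ℝ) (E := E) (F := ℝ))
  obtain ⟨e0, he0⟩ : ∃ e0 : (E × ℝ) ≃L[ℝ] (E × ℝ), (e0 : (E × ℝ) →L[ℝ] (E × ℝ)) = fderiv ℝ G (p, 0) := by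
    rw [hGp.fderiv]
    set A := (((ContinuousLinearMap.fst ℝ E ℝ) +
      (ContinuousLinearMap.snd ℝ E ℝ).smulRight (ν p)).prod
        ((innerSL ℝ (γ p)).comp (ContinuousLinearMap.fst ℝ E ℝ))) with hA
    have hinj : Function.Injective A.toLinearMap := by
      rw [← LinearMap.ker_eq_bot, LinearMap.ker_eq_bot']
      rintro ⟨v, s⟩ h
      have h1 : v + s • ν p = 0 := congrArg Prod.fst h
      have h2 : inner ℝ (γ p) v = 0 := congrArg Prod.snd h
      rw [eq_neg_of_add_eq_zero_left h1, inner_neg_right, inner_smul_right, hγν p hpV',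
        real_inner_smul_left, real_inner_self_eq_norm_sq, hν1 p hpV'] at h2
      have hs : s = 0 := by
        have : ‖γ p‖ ≠ 0 := norm_ne_zero_iff.2 hγp
        simpa [this] using h2
      subst hs
      simpa using h1
    refine ⟨(LinearEquiv.ofInjectiveEndo A.toLinearMap hinj).toContinuousLinearEquiv, ?_⟩
    ext v <;> rfl
  have hstrict : HasStrictFDerivAt G (e0 : (E × ℝ) →L[ℝ] (E × ℝ)) (p, 0) := by
    rw [he0]; exact (hGat _ hp0).hasStrictFDerivAt hm0
  set e := hstrict.toOpenPartialHomeomorph G with he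
  have heG : ∀ q, e q = G q := fun q => rfl
  -- a box on which everything is under control
  have hinv : ∀ᶠ q in 𝓝 (p, (0 : ℝ)), ∃ A : (E × ℝ) ≃L[ℝ] (E × ℝ),
      (A : (E × ℝ) →L[ℝ] (E × ℝ)) = fderiv ℝ G q := by
    have hcont : ContinuousAt (fderiv ℝ G) (p, 0) :=
      ((hGat _ hp0).fderiv_right (m := 0) (by simpa using hm1)).continuousAt
    have hn := ContinuousLinearEquiv.nhds e0
    rw [he0] at hn
    exact hcont.eventually hn
  have hpos : ∀ᶠ q in 𝓝 ((p, p) : E × E), 0 < inner ℝ (γ q.1) (ν q.2) := by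
    have h1 : ContinuousAt (fun q : E × E => inner ℝ (γ q.1) (ν q.2)) (p, p) := by
      refine ContinuousAt.inner ?_ ?_
      · exact ContinuousAt.comp (f := Prod.fst) (hγC.continuousOn.continuousAt (hV.mem_nhds hpV)) continuousAt_fst
      · exact ContinuousAt.comp (f := Prod.snd) (hνC.continuousOn.continuousAt (hV'.mem_nhds hpV')) continuousAt_snd
    refine h1.eventually_const_lt ?_
    simp only
    rw [hγν p hpV', real_inner_smul_left, real_inner_self_eq_norm_sq, hν1 p hpV']
    have := norm_pos_iff.2 hγp
    positivity
  have hes : e.source ∈ 𝓝 (p, (0 : ℝ)) := e.open_source.mem_nhds hstrict.mem_toOpenPartialHomeomorph_source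
  obtain ⟨ε₁, hε₁, hb1⟩ := Metric.eventually_nhds_iff_ball.1
    ((hinv.and hes).and (hGopen.mem_nhds hp0))
  obtain ⟨ε₂, hε₂, hb2⟩ := Metric.eventually_nhds_iff_ball.1 hpos
  set ε := min ε₁ ε₂ with hε
  have hεpos : 0 < ε := lt_min hε₁ hε₂
  set S : Set (E × ℝ) := Metric.ball (p, (0 : ℝ)) ε₁ with hS
  have hSo : IsOpen S := Metric.isOpen_ball
  set U0 : Set E := (fun x : E => (x, (0 : ℝ))) ⁻¹' (e '' S) with hU0
  have himg : IsOpen (e '' S) := e.isOpen_image_of_subset_source hSo fun q hq => (hb1 q hq).1.2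
  have hU0o : IsOpen U0 := himg.preimage (by fun_prop)
  have hGp0 : G (p, 0) = (p, 0) := by
    simp [hG, (hfr p hpV').1 hp]
  have hpU0 : p ∈ U0 := ⟨(p, 0), Metric.mem_ball_self hε₁, by rw [heG, hGp0]⟩
  set Y : E → E := fun x => (e.symm (x, 0)).1 with hY
  set T : E → ℝ := fun x => (e.symm (x, 0)).2 with hT
  have hinvS : ∀ q ∈ S, ∀ x, G q = (x, 0) → x ∈ U0 ∧ Y x = q.1 ∧ T x = q.2 := by
    intro q hq x hx
    have h1 : e.symm (x, 0) = q := by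
      rw [← hx, ← heG]; exact e.left_inv (hb1 q hq).1.2
    exact ⟨⟨q, hq, by rw [heG, hx]⟩, by simp [hY, h1], by simp [hT, h1]⟩
  have hU0S : ∀ x ∈ U0, (Y x, T x) ∈ S ∧ G (Y x, T x) = (x, 0) := by
    rintro x ⟨q, hq, hqx⟩
    obtain ⟨-, h1, h2⟩ := hinvS q hq x hqx
    rw [h1, h2]
    exact ⟨hq, hqx⟩
  have hYV : ∀ x ∈ U0, Y x ∈ V' := fun x hx => (hb1 _ (hU0S x hx).1).2.1
  have hYr : ∀ x ∈ U0, r (Y x) = 0 := fun x hx => congrArg Prod.snd (hU0S x hx).2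
  have hYT : ∀ x ∈ U0, Y x + T x • ν (Y x) = x := fun x hx => congrArg Prod.fst (hU0S x hx).2
  have hsymm : ∀ x ∈ U0, ContDiffAt ℝ m (fun x : E => e.symm (x, (0 : ℝ))) x := by
    intro x hx
    obtain ⟨q, hq, hqx⟩ := hx
    replace hqx : e q = (x, 0) := hqx
    have hsrc := (hb1 q hq).1.2
    have hs : e.symm (x, 0) = q := by rw [← hqx]; exact e.left_inv hsrc
    obtain ⟨A, hA⟩ := (hb1 q hq).1.1
    have ht : (x, (0 : ℝ)) ∈ e.target := by rw [← hqx]; exact e.map_source hsrc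
    have h1 : ContDiffAt ℝ m e.symm (x, 0) := by
      refine e.contDiffAt_symm (f₀' := A) ht ?_ ?_
      · rw [hs, hA]; exact ((hGat q (hb1 q hq).2).differentiableAt hm0).hasFDerivAt
      · rw [hs]; exact hGat q (hb1 q hq).2
    exact h1.comp x (contDiffAt_id.prodMk contDiffAt_const)
  have hYC : ∀ x ∈ U0, ContDiffAt ℝ m Y x := fun x hx => contDiffAt_fst.comp x (hsymm x hx)
  have hTC : ∀ x ∈ U0, ContDiffAt ℝ m T x := fun x hx => contDiffAt_snd.comp x (hsymm x hx)
  -- Differentiate x = Y + Tν(Y) and pair with ν(Y): the images of DY and Dν are orthogonal to ν, so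
  -- DT = ⟨ν(Y), ·⟩. The gradient ν∘Y is as smooth as ν, which recovers the derivative lost in the
  -- inverse function theorem.
  have hTd : ∀ x ∈ U0, HasFDerivAt T (innerSL ℝ (ν (Y x))) x := by
    intro x hx
    have hY' := ((hYC x hx).differentiableAt hm0).hasFDerivAt
    have hT' := ((hTC x hx).differentiableAt hm0).hasFDerivAt
    have h1 := hY'.add (hT'.smul ((hνd _ (hYV x hx)).comp x hY'))
    have h2 : HasFDerivAt (Y + T • ν ∘ Y) (ContinuousLinearMap.id ℝ E) x := by
      refine (hasFDerivAt_id x).congr_of_eventuallyEq ?_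
      filter_upwards [hU0o.mem_nhds hx] with y hy
      exact hYT y hy
    have h3 := (hrd _ (hV'V (hYV x hx))).comp x hY'
    have h4 : HasFDerivAt (r ∘ Y) (0 : E →L[ℝ] ℝ) x := by
      refine (hasFDerivAt_const (0 : ℝ) x).congr_of_eventuallyEq ?_
      filter_upwards [hU0o.mem_nhds hx] with y hy
      exact hYr y hy
    refine hT'.congr_fderiv ?_
    ext v
    have h5 := congrArg (fun L : E →L[ℝ] ℝ => L v) (h3.unique h4)
    have h6 := congrArg (fun L : E →L[ℝ] E => inner ℝ (ν (Y x)) (L v)) (h1.unique h2)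
    simp only [ContinuousLinearMap.comp_apply, innerSL_apply_apply, zero_apply] at h5
    rw [hγν _ (hYV x hx), real_inner_smul_left, mul_eq_zero] at h5
    have h7 : inner ℝ (ν (Y x)) (fderiv ℝ Y x v) = 0 :=
      h5.resolve_left (norm_ne_zero_iff.2 (hγ0 _ (hYV x hx)))
    simp [inner_add_right, inner_smul_right, h7, hνν _ (hYV x hx), hν1 _ (hYV x hx)] at h6
    simpa using h6
  have hdT : ∀ x ∈ Metric.ball p (ε / 2), x ∈ U0 ∧ d x = T x := by
    intro x hx
    rw [Metric.mem_ball] at hx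
    obtain ⟨q, hqf, hq⟩ := hc.exists_infDist_eq_dist ⟨p, hp⟩ x
    have hxq : dist x q < ε / 2 := by
      rw [← hq]; exact (Metric.infDist_le_dist_of_mem hp).trans_lt hx
    have hqp : dist q p < ε := by
      have := dist_triangle_left q p x
      linarith
    have hq0 : (q, (0 : ℝ)) ∈ Metric.ball (p, (0 : ℝ)) ε₁ := by
      rw [Metric.mem_ball, Prod.dist_eq]
      simpa [hε₁] using hqp.trans_le (min_le_left _ _)
    have hqV : q ∈ V' := (hb1 _ hq0).2.1
    have hrq : r q = 0 := (hfr q hqV).1 hqf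
    -- A nearest boundary point q minimises |y - x|² on {r = 0}, and the Lagrange multiplier rule
    -- makes x - q a multiple of ∇r(q).
    obtain ⟨t, ht⟩ : ∃ t : ℝ, x = q + t • ν q := by
      have hext : IsLocalExtrOn (fun y => ‖y - x‖ ^ 2) {y | r y = r q} q := by
        left
        have : ∀ᶠ y in 𝓝[{y | r y = r q}] q, y ∈ V' := mem_nhdsWithin_of_mem_nhds (hV'.mem_nhds hqV)
        filter_upwards [this, self_mem_nhdsWithin] with y hy hyr
        have hyf : y ∈ frontier Ω := (hfr y hy).2 (hyr.trans hrq)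
        have h1 : dist x q ≤ dist x y := by rw [← hq]; exact Metric.infDist_le_dist_of_mem hyf
        rw [dist_comm x q, dist_comm x y, dist_eq_norm, dist_eq_norm] at h1
        gcongr
      have hst : HasStrictFDerivAt r (innerSL ℝ (γ q)) q := by
        rw [← hγfd]
        exact (hrV.contDiffAt (hV.mem_nhds (hV'V hqV))).hasStrictFDerivAt (by simp)
      have hsq : HasStrictFDerivAt (fun y => ‖y - x‖ ^ 2) (2 • innerSL ℝ (q - x)) q := by
        have := (hasStrictFDerivAt_norm_sq (q - x)).comp q ((hasStrictFDerivAt_id q).sub_const x)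
        exact this
      obtain ⟨a, b, hab, h⟩ := hext.exists_multipliers_of_hasStrictFDerivAt_1d hst hsq
      have hvec : a • γ q + (2 * b) • (q - x) = 0 := by
        apply ext_inner_right ℝ
        intro v
        have h1 := congrArg (fun L : E →L[ℝ] ℝ => L v) h
        simp only [add_apply, smul_apply, innerSL_apply_apply,
          zero_apply, smul_eq_mul, nsmul_eq_mul] at h1
        rw [inner_add_left, real_inner_smul_left, real_inner_smul_left, inner_zero_left]
        push_cast at h1
        linarith
      have hb : b ≠ 0 := by
        rintro rfl
        have : a = 0 := by simpa [hγ0 q hqV] using hvec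
        exact hab (by rw [this]; rfl)
      refine ⟨(2 * b)⁻¹ * a * ‖γ q‖, ?_⟩
      have h2 : x = q + ((2 * b)⁻¹ * a) • γ q := by
        have hb2 : (2 * b) ≠ 0 := by simpa using hb
        have := congrArg (fun w => (2 * b)⁻¹ • w) hvec
        simp only [smul_add, smul_smul, inv_mul_cancel₀ hb2, one_smul, smul_zero] at this
        rw [← sub_eq_zero, ← neg_eq_zero, ← this]; abel
      rw [mul_smul, ← hγν q hqV]; exact h2
    have htn : dist x q = |t| := by
      rw [ht, dist_eq_norm, add_sub_cancel_left, norm_smul, hν1 q hqV, mul_one, Real.norm_eq_abs]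
    have hqt : (q, t) ∈ S := by
      rw [hS, Metric.mem_ball, Prod.dist_eq, max_lt_iff]
      refine ⟨hqp.trans_le (min_le_left _ _), ?_⟩
      rw [Real.dist_eq, sub_zero, ← htn]
      have : ε ≤ ε₁ := min_le_left _ _
      linarith
    obtain ⟨hx0, -, hTx⟩ := hinvS (q, t) hqt x (by simp [hG, hrq, ← ht])
    refine ⟨hx0, ?_⟩
    have hball : Metric.ball p ε ⊆ V := by
      intro y hy
      have : (y, (0 : ℝ)) ∈ Metric.ball (p, (0 : ℝ)) ε₁ := by
        rw [Metric.mem_ball, Prod.dist_eq]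
        simpa [hε₁] using (Metric.mem_ball.1 hy).trans_le (min_le_left _ _)
      exact hV'V (hb1 _ this).2.1
    have hxp : x ∈ Metric.ball p ε := by rw [Metric.mem_ball]; linarith
    -- The mean value theorem gives r(x) = t⟨∇r(ξ), ν(q)⟩ with a positive inner product, so t has
    -- the sign of r(x), which decides whether x lies in Ω.
    obtain ⟨ξ, hξ, hξr⟩ := domain_mvt (s := Metric.ball p ε) (f := r)
      (f' := fun y => innerSL ℝ (γ y)) (fun y hy => (hrd y (hball hy)).hasFDerivWithinAt)
      (convex_ball p ε) (Metric.mem_ball.2 hqp) hxp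
    have hξp : ξ ∈ Metric.ball p ε :=
      (convex_ball p ε).segment_subset (Metric.mem_ball.2 hqp) hxp hξ
    have hip : 0 < inner ℝ (γ ξ) (ν q) := by
      refine hb2 (ξ, q) ?_
      rw [Metric.mem_ball, Prod.dist_eq, max_lt_iff]
      exact ⟨(Metric.mem_ball.1 hξp).trans_le (min_le_right _ _), hqp.trans_le (min_le_right _ _)⟩
    have hrx : r x = t * inner ℝ (γ ξ) (ν q) := by
      rw [hrq, sub_zero] at hξr
      rw [hξr]
      simp only [innerSL_apply_apply]
      rw [ht, add_sub_cancel_left, inner_smul_right]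
    have hxV := hball hxp
    rw [hTx]
    by_cases hxΩ : x ∈ Ω
    · rw [hdin x hxΩ, hq, htn]
      have h1 := (hr x hxV).1 hxΩ
      rw [hrx] at h1
      have : t < 0 := by
        by_contra h; push Not at h
        have := mul_nonneg h hip.le
        linarith
      rw [abs_of_neg this, neg_neg]
    · rw [hdout x hxΩ, hq, htn]
      have h1 := mt (hr x hxV).2 hxΩ
      rw [hrx] at h1
      have : 0 ≤ t := by
        by_contra h; push Not at h
        exact h1 (mul_neg_of_neg_of_pos h hip)
      rw [abs_of_nonneg this]
  have hgrad : ∀ x ∈ Metric.ball p (ε / 2), HasGradientAt d (ν (Y x)) x := by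
    intro x hx
    have h1 := (hTd x (hdT x hx).1).congr_of_eventuallyEq (f := T) (f₁ := d) (by
      filter_upwards [Metric.isOpen_ball.mem_nhds hx] with y hy using (hdT y hy).2)
    exact h1
  have hYcont : ContinuousOn Y (Metric.ball p (ε / 2)) := fun x hx =>
    (hYC x (hdT x hx).1).continuousAt.continuousWithinAt
  have hYp : Y p = p := (hinvS (p, 0) (Metric.mem_ball_self hε₁) p hGp0).2.1
  refine ⟨Metric.ball p (ε / 2) ∩ Y ⁻¹' Metric.ball p (ε / 2),
    hYcont.isOpen_inter_preimage Metric.isOpen_ball Metric.isOpen_ball,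
    ⟨Metric.mem_ball_self (half_pos hεpos), by rw [mem_preimage, hYp]; exact Metric.mem_ball_self (half_pos hεpos)⟩,
    ?_, ?_⟩
  · refine ContDiffOn.mono ?_ inter_subset_left
    rw [contDiffOn_succ_iff_fderiv_of_isOpen Metric.isOpen_ball]
    refine ⟨fun x hx => (hgrad x hx).hasFDerivAt.differentiableAt.differentiableWithinAt,
      fun h => absurd h hmtop, ?_⟩
    have h1 : ContDiffOn ℝ m (fun x => innerSL ℝ (ν (Y x))) (Metric.ball p (ε / 2)) := by
      refine (innerSL ℝ (E := E)).contDiff.comp_contDiffOn (hνC.comp (fun x hx => ?_) fun x hx => ?_)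
      · exact (hYC x (hdT x hx).1).contDiffWithinAt
      · exact hYV x (hdT x hx).1
    exact h1.congr fun x hx => (hgrad x hx).hasFDerivAt.fderiv
  · rintro x ⟨hx, hYx⟩
    have hxU := (hdT x hx).1
    have hg := (hgrad x hx).gradient
    have hfoot : x - d x • gradient d x = Y x := by
      rw [hg, (hdT x hx).2]
      nth_rewrite 1 [← hYT x hxU]
      exact add_sub_cancel_right _ _
    have hYY : Y (Y x) = Y x := by
      refine (hinvS (Y x, 0) ?_ (Y x) (by simp [hG, hYr x hxU])).2.1
      have := (hU0S x hxU).1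
      rw [hS, Metric.mem_ball, Prod.dist_eq, max_lt_iff] at this ⊢
      exact ⟨this.1, by simpa using hε₁⟩
    refine ⟨by rw [hg]; exact hν1 _ (hYV x hxU), ?_, ?_⟩
    · rw [hfoot]; exact (hfr _ (hYV x hxU)).2 (hYr x hxU)
    · rw [hfoot, hg, (hgrad _ hYx).gradient, hYY]

end SignedDistance

end DFIndex

/-! ### Levi forms as real Hessians, and the geometry of a collar of the boundary. -/

namespace DFIndex

noncomputable section

variable {n : ℕ}

/-! ### Real second derivatives and complex derivatives -/

/-- The real Hessian `D²f(z)(u, v)`. -/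
def hess (f : Cn n → ℝ) (z u v : Cn n) : ℝ := fderiv ℝ (fderiv ℝ f) z u v

/-- Four times the complex Hessian: `D²f(τ, τ) + D²f(iτ, iτ)`. -/
def realLevi (f : Cn n → ℝ) (z τ : Cn n) : ℝ :=
  hess f z τ τ + hess f z (Complex.I • τ) (Complex.I • τ)

theorem single_I (j : Fin n) :
    (EuclideanSpace.single j Complex.I : Cn n) = Complex.I • EuclideanSpace.single j 1 := by
  ext i; simp

theorem eq_sum_single (τ : Cn n) :
    τ = ∑ j, ((τ j).re • (EuclideanSpace.single j (1 : ℂ) : Cn n)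
      + (τ j).im • (Complex.I • (EuclideanSpace.single j (1 : ℂ) : Cn n))) := by
  ext i
  simp [Finset.sum_apply, Pi.single_apply, Finset.sum_add_distrib]

theorem I_smul_eq_sum_single (τ : Cn n) :
    Complex.I • τ = ∑ j, ((τ j).re • (Complex.I • (EuclideanSpace.single j (1 : ℂ) : Cn n))
      - (τ j).im • ((EuclideanSpace.single j (1 : ℂ) : Cn n))) := by
  ext i
  simp [Finset.sum_apply, Pi.single_apply, Finset.sum_sub_distrib]
  apply Complex.ext <;> simp

theorem del_eq (f : Cn n → ℂ) (z τ : Cn n) :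
    del f z τ = (fderiv ℝ f z τ - Complex.I * fderiv ℝ f z (Complex.I • τ)) / 2 := by
  set L := fderiv ℝ f z
  rw [I_smul_eq_sum_single τ]
  nth_rewrite 2 [eq_sum_single τ]
  rw [map_sum, map_sum, del, Finset.mul_sum, ← Finset.sum_sub_distrib, Finset.sum_div]
  refine Finset.sum_congr rfl fun j _ => ?_
  simp only [dz, single_I, map_add, map_sub, map_smul, Complex.real_smul]
  have h := Complex.re_add_im (τ j)
  linear_combination (-(L (EuclideanSpace.single j 1)
    - Complex.I * L (Complex.I • EuclideanSpace.single j 1)) / 2) * h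
    - L (Complex.I • EuclideanSpace.single j 1) * ((τ j).im : ℂ) / 2 * Complex.I_mul_I

theorem sum_conj_mul (L : Cn n →L[ℝ] ℝ) (τ : Cn n) :
    ∑ k, ((L (EuclideanSpace.single k 1) : ℂ)
      + Complex.I * (L (Complex.I • EuclideanSpace.single k 1) : ℂ)) * conj (τ k)
      = (L τ : ℂ) + Complex.I * (L (Complex.I • τ) : ℂ) := by
  rw [I_smul_eq_sum_single τ]
  nth_rewrite 2 [eq_sum_single τ]
  rw [map_sum, map_sum]
  push_cast
  rw [Finset.mul_sum, ← Finset.sum_add_distrib]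
  refine Finset.sum_congr rfl fun j _ => ?_
  apply Complex.ext <;> simp <;> ring

theorem fderiv_ofReal_comp {f : Cn n → ℝ} {z : Cn n} (hf : DifferentiableAt ℝ f z) (u : Cn n) :
    fderiv ℝ (fun w => (f w : ℂ)) z u = (fderiv ℝ f z u : ℂ) := by
  have := (Complex.ofRealCLM.hasFDerivAt (x := f z)).comp z hf.hasFDerivAt
  rw [show (fun w => (f w : ℂ)) = Complex.ofRealCLM ∘ f from rfl, this.fderiv]
  simp

theorem del_ofReal {f : Cn n → ℝ} {z : Cn n} (hf : DifferentiableAt ℝ f z) (τ : Cn n) :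
    del (fun w => (f w : ℂ)) z τ
      = ((fderiv ℝ f z τ : ℂ) - Complex.I * (fderiv ℝ f z (Complex.I • τ) : ℂ)) / 2 := by
  rw [del_eq, fderiv_ofReal_comp hf, fderiv_ofReal_comp hf]

theorem _root_.ContDiffAt.hasFDerivAt_fderiv {f : Cn n → ℝ} {z : Cn n} (hf : ContDiffAt ℝ 2 f z) :
    HasFDerivAt (fderiv ℝ f) (fderiv ℝ (fderiv ℝ f) z) z :=
  ((hf.fderiv_right (m := 1) (by norm_num)).differentiableAt (by norm_num)).hasFDerivAt

theorem _root_.ContDiffAt.eventually_differentiableAt {f : Cn n → ℝ} {z : Cn n}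
    (hf : ContDiffAt ℝ 2 f z) : ∀ᶠ w in 𝓝 z, DifferentiableAt ℝ f w :=
  (hf.eventually (by simp)).mono fun _ h => h.differentiableAt (by norm_num)

/-- Expanding ∂ and ∂̄ into real derivatives, the mixed terms D²f(τ,iτ) and D²f(iτ,τ) come with a
factor i, so the real part keeps only the two diagonal ones. -/
theorem leviForm_eq {f : Cn n → ℝ} {z : Cn n} (hf : ContDiffAt ℝ 2 f z) (τ : Cn n) :
    leviForm f z τ = realLevi f z τ / 4 := by
  have hD := hf.hasFDerivAt_fderiv
  have hk : ∀ k u, fderiv ℝ (dzbar k (fun w => (f w : ℂ))) z u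
      = ((hess f z u (EuclideanSpace.single k 1) : ℂ)
        + Complex.I * (hess f z u (Complex.I • EuclideanSpace.single k 1) : ℂ)) / 2 := by
    intro k u
    have hev : dzbar k (fun w => (f w : ℂ)) =ᶠ[𝓝 z] fun w =>
        ((fderiv ℝ f w (EuclideanSpace.single k 1) : ℂ)
          + Complex.I * (fderiv ℝ f w (Complex.I • EuclideanSpace.single k 1) : ℂ)) / 2 := by
      filter_upwards [hf.eventually_differentiableAt] with w hw
      simp only [dzbar, single_I, fderiv_ofReal_comp hw]
    have h1 : ∀ v : Cn n, HasFDerivAt (fun w => (fderiv ℝ f w v : ℂ))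
        (Complex.ofRealCLM.comp ((fderiv ℝ (fderiv ℝ f) z).flip v)) z := by
      intro v
      have h2 : HasFDerivAt (fun w => fderiv ℝ f w v) ((fderiv ℝ (fderiv ℝ f) z).flip v) z := by
        refine (hD.clm_apply (hasFDerivAt_const v z)).congr_fderiv ?_
        ext; simp
      exact Complex.ofRealCLM.hasFDerivAt.comp z h2
    have h3 := ((h1 (EuclideanSpace.single k 1)).add
      ((h1 (Complex.I • EuclideanSpace.single k 1)).const_mul Complex.I)).mul_const (2 : ℂ)⁻¹
    rw [hev.fderiv_eq]
    simp only [div_eq_mul_inv]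
    have h4 := congrArg (fun L : Cn n →L[ℝ] ℂ => L u) h3.fderiv
    simp only [Pi.add_apply] at h4
    refine h4.trans ?_
    simp [hess]
    ring
  rw [leviForm]
  have hdel : ∀ k, ∑ j, dz j (dzbar k (fun w => (f w : ℂ))) z * τ j * conj (τ k)
      = del (dzbar k (fun w => (f w : ℂ))) z τ * conj (τ k) := by
    intro k; rw [del, Finset.sum_mul]
  rw [Finset.sum_comm]
  simp only [hdel, del_eq, hk]
  have hA := sum_conj_mul (fderiv ℝ (fderiv ℝ f) z τ) τ
  have hB := sum_conj_mul (fderiv ℝ (fderiv ℝ f) z (Complex.I • τ)) τ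
  have : ∑ k, (((hess f z τ (EuclideanSpace.single k 1) : ℂ)
        + Complex.I * (hess f z τ (Complex.I • EuclideanSpace.single k 1) : ℂ)) / 2
      - Complex.I * (((hess f z (Complex.I • τ) (EuclideanSpace.single k 1) : ℂ)
        + Complex.I * (hess f z (Complex.I • τ) (Complex.I • EuclideanSpace.single k 1) : ℂ)) / 2)) / 2
        * conj (τ k)
      = (((hess f z τ τ : ℂ) + Complex.I * hess f z τ (Complex.I • τ))
        - Complex.I * ((hess f z (Complex.I • τ) τ : ℂ)
          + Complex.I * hess f z (Complex.I • τ) (Complex.I • τ))) / 4 := by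
    unfold hess
    rw [← hA, ← hB, Finset.mul_sum, ← Finset.sum_sub_distrib, Finset.sum_div]
    refine Finset.sum_congr rfl fun k _ => ?_
    ring
  rw [this, realLevi]
  simp

theorem hess_symm {f : Cn n → ℝ} {z : Cn n} (hf : ContDiffAt ℝ 2 f z) (u v : Cn n) :
    hess f z u v = hess f z v u :=
  (hf.isSymmSndFDerivAt (by simp)) u v

/-! ### The real inner product -/

theorem real_inner_eq_re (u v : Cn n) : inner ℝ u v = (inner ℂ u v : ℂ).re := by
  simp only [PiLp.inner_apply, Complex.re_sum]
  rfl

theorem inner_eq_real_inner (u v : Cn n) :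
    (inner ℂ u v : ℂ) = (inner ℝ u v : ℂ) + Complex.I * (inner ℝ (Complex.I • u) v : ℂ) := by
  rw [real_inner_eq_re, real_inner_eq_re, inner_smul_left]
  apply Complex.ext <;> simp

theorem real_inner_I_smul_left (u v : Cn n) :
    inner ℝ (Complex.I • u) v = -inner ℝ u (Complex.I • v) := by
  rw [real_inner_eq_re, real_inner_eq_re, inner_smul_left, inner_smul_right]
  simp

theorem real_inner_I_smul_self (u : Cn n) : inner ℝ (Complex.I • u) u = 0 := by
  have h := real_inner_I_smul_left u u
  rw [real_inner_comm (Complex.I • u) u] at h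
  linarith

theorem I_smul_I_smul (u : Cn n) : Complex.I • Complex.I • u = -u := by
  rw [smul_smul, Complex.I_mul_I, neg_one_smul]

theorem norm_I_smul (u : Cn n) : ‖Complex.I • u‖ = ‖u‖ := by
  rw [norm_smul, Complex.norm_I, one_mul]

/-! ### The signed distance near the boundary -/

/-- The gradient of the signed distance. -/
def nrm (Ω : Set (Cn n)) (z : Cn n) : Cn n := gradient (signedDist Ω) z

/-- The derivative of the gradient of the signed distance. -/
def shape (Ω : Set (Cn n)) (z : Cn n) : Cn n →L[ℝ] Cn n := fderiv ℝ (nrm Ω) z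

/-- A neighbourhood of the boundary on which the signed distance is `C^k`, has gradient of norm one,
and on which the foot point map is given by following the gradient. -/
structure IsCollar (k : ℕ∞) (Ω W : Set (Cn n)) : Prop where
  isOpen : IsOpen W
  subset : frontier Ω ⊆ W
  contDiffOn : ContDiffOn ℝ k (signedDist Ω) W
  norm_nrm : ∀ z ∈ W, ‖nrm Ω z‖ = 1
  foot_mem : ∀ z ∈ W, z - signedDist Ω z • nrm Ω z ∈ frontier Ω
  nrm_foot : ∀ z ∈ W, nrm Ω (z - signedDist Ω z • nrm Ω z) = nrm Ω z

theorem exists_isCollar {Ω : Set (Cn n)} (hΩ : IsOpen Ω) (hb : Bornology.IsBounded Ω) {k : ℕ∞}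
    (hk : 3 ≤ k) (h : HasCkBoundary k Ω) : ∃ W, IsCollar k Ω W := by
  have hc : IsCompact (frontier Ω) :=
    Metric.isCompact_of_isClosed_isBounded isClosed_frontier (hb.closure.subset frontier_subset_closure)
  obtain ⟨m, rfl, hm⟩ : ∃ m : ℕ∞, k = m + 1 ∧ 1 ≤ m := by
    cases k with
    | top => exact ⟨⊤, by simp, le_top⟩
    | coe k =>
      have h3 : 3 ≤ k := by exact_mod_cast hk
      obtain ⟨m, rfl⟩ := Nat.exists_eq_add_of_le' h3
      exact ⟨((m + 2 : ℕ) : ℕ∞), by push_cast; ring, by exact_mod_cast (by omega : 1 ≤ m + 2)⟩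
  have hloc : ∀ p ∈ frontier Ω, ∃ U : Set (Cn n), IsOpen U ∧ p ∈ U ∧
      ContDiffOn ℝ ((m + 1 : ℕ∞) : WithTop ℕ∞) (signedDist Ω) U ∧
      ∀ x ∈ U, ‖nrm Ω x‖ = 1 ∧ x - signedDist Ω x • nrm Ω x ∈ frontier Ω ∧
        nrm Ω (x - signedDist Ω x • nrm Ω x) = nrm Ω x := by
    intro p hp
    obtain ⟨V, r, hV, hpV, hr, hrΩ, hr'⟩ := h p hp
    exact signedDistance_local hΩ hc (fun z hz => by simp [signedDist, hz])
      (fun z hz => by simp [signedDist, hz]) hm hp hV hpV hr hrΩ hr'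
  choose! U hUo hpU hUC hU using hloc
  refine ⟨⋃ p ∈ frontier Ω, U p, isOpen_biUnion hUo, fun p hp => mem_biUnion hp (hpU p hp),
    ?_, ?_, ?_, ?_⟩
  · intro x hx
    obtain ⟨p, hp, hxp⟩ := mem_iUnion₂.1 hx
    exact ((hUC p hp).contDiffAt ((hUo p hp).mem_nhds hxp)).contDiffWithinAt
  all_goals
    intro x hx
    obtain ⟨p, hp, hxp⟩ := mem_iUnion₂.1 hx
  · exact (hU p hp x hxp).1
  · exact (hU p hp x hxp).2.1
  · exact (hU p hp x hxp).2.2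

theorem signedDist_frontier {Ω : Set (Cn n)} {z : Cn n} (hz : z ∈ frontier Ω) :
    signedDist Ω z = 0 := by
  simp [signedDist, Metric.infDist_zero_of_mem hz]

theorem mem_of_signedDist_neg {Ω : Set (Cn n)} {z : Cn n} (hz : signedDist Ω z < 0) : z ∈ Ω := by
  by_contra h
  rw [signedDist, if_neg h] at hz
  exact absurd hz (not_lt.2 Metric.infDist_nonneg)

theorem signedDist_neg {Ω : Set (Cn n)} (hΩ : IsOpen Ω) (hne : (frontier Ω).Nonempty) {z : Cn n}
    (hz : z ∈ Ω) : signedDist Ω z < 0 := by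
  rw [signedDist, if_pos hz, neg_lt_zero]
  refine (isClosed_frontier.notMem_iff_infDist_pos hne).1 fun h => ?_
  rw [hΩ.frontier_eq] at h
  exact h.2 hz

theorem signedDist_eq_zero {Ω : Set (Cn n)} (hΩ : IsOpen Ω) (hne : (frontier Ω).Nonempty) {z : Cn n} :
    signedDist Ω z = 0 ↔ z ∈ frontier Ω := by
  refine ⟨fun h => ?_, signedDist_frontier⟩
  have hz : z ∉ Ω := fun hz => (signedDist_neg hΩ hne hz).ne h
  rw [signedDist, if_neg hz] at h
  exact (isClosed_frontier.mem_iff_infDist_zero hne).2 h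

namespace IsCollar

variable {k : ℕ∞} {Ω W : Set (Cn n)} {z : Cn n}

theorem contDiffAt (h : IsCollar k Ω W) (hz : z ∈ W) : ContDiffAt ℝ k (signedDist Ω) z :=
  h.contDiffOn.contDiffAt (h.isOpen.mem_nhds hz)

theorem contDiffAt_three (h : IsCollar k Ω W) (hk : 3 ≤ k) (hz : z ∈ W) :
    ContDiffAt ℝ 3 (signedDist Ω) z :=
  (h.contDiffAt hz).of_le (by
    have : ((3 : ℕ∞) : WithTop ℕ∞) ≤ k := by exact_mod_cast hk
    exact this)

theorem hasFDerivAt (h : IsCollar k Ω W) (hk : 3 ≤ k) (hz : z ∈ W) :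
    HasFDerivAt (signedDist Ω) (innerSL ℝ (nrm Ω z)) z :=
  ((h.contDiffAt_three hk hz).differentiableAt (by norm_num)).hasGradientAt

theorem fderiv_apply (h : IsCollar k Ω W) (hk : 3 ≤ k) (hz : z ∈ W) (v : Cn n) :
    fderiv ℝ (signedDist Ω) z v = inner ℝ (nrm Ω z) v := by
  rw [(h.hasFDerivAt hk hz).fderiv]; rfl

theorem contDiffAt_nrm (h : IsCollar k Ω W) (hk : 3 ≤ k) (hz : z ∈ W) :
    ContDiffAt ℝ 2 (nrm Ω) z :=
  (InnerProductSpace.toDual ℝ (Cn n)).symm.toContinuousLinearEquiv.contDiff.contDiffAt.comp z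
    ((h.contDiffAt_three hk hz).fderiv_right (m := 2) (by norm_num))

theorem hasFDerivAt_nrm (h : IsCollar k Ω W) (hk : 3 ≤ k) (hz : z ∈ W) :
    HasFDerivAt (nrm Ω) (shape Ω z) z :=
  ((h.contDiffAt_nrm hk hz).differentiableAt (by norm_num)).hasFDerivAt

theorem continuousAt_nrm (h : IsCollar k Ω W) (hk : 3 ≤ k) (hz : z ∈ W) :
    ContinuousAt (nrm Ω) z := (h.contDiffAt_nrm hk hz).continuousAt

theorem contDiffAt_shape (h : IsCollar k Ω W) (hk : 3 ≤ k) (hz : z ∈ W) :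
    ContDiffAt ℝ 1 (shape Ω) z :=
  (h.contDiffAt_nrm hk hz).fderiv_right (m := 1) (by norm_num)

theorem continuousAt_shape (h : IsCollar k Ω W) (hk : 3 ≤ k) (hz : z ∈ W) :
    ContinuousAt (shape Ω) z := (h.contDiffAt_shape hk hz).continuousAt

theorem hess_eq (h : IsCollar k Ω W) (hk : 3 ≤ k) (hz : z ∈ W) (u v : Cn n) :
    hess (signedDist Ω) z u v = inner ℝ (shape Ω z u) v := by
  have hev : fderiv ℝ (signedDist Ω) =ᶠ[𝓝 z] fun w => innerSL ℝ (nrm Ω w) := by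
    filter_upwards [h.isOpen.mem_nhds hz] with w hw
    exact (h.hasFDerivAt hk hw).fderiv
  have hd : HasFDerivAt (fun w => innerSL ℝ (nrm Ω w)) ((innerSL ℝ).comp (shape Ω z)) z :=
    (innerSL ℝ (E := Cn n)).hasFDerivAt.comp z (h.hasFDerivAt_nrm hk hz)
  rw [hess, hev.fderiv_eq, hd.fderiv]
  rfl

theorem shape_symm (h : IsCollar k Ω W) (hk : 3 ≤ k) (hz : z ∈ W) (u v : Cn n) :
    inner ℝ (shape Ω z u) v = inner ℝ u (shape Ω z v) := by
  rw [← h.hess_eq hk hz, hess_symm ((h.contDiffAt_three hk hz).of_le (by norm_num)),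
    h.hess_eq hk hz, real_inner_comm]

theorem inner_nrm_shape (h : IsCollar k Ω W) (hk : 3 ≤ k) (hz : z ∈ W) (v : Cn n) :
    inner ℝ (nrm Ω z) (shape Ω z v) = 0 := by
  have h1 := (h.hasFDerivAt_nrm hk hz).inner ℝ (h.hasFDerivAt_nrm hk hz)
  have h2 : HasFDerivAt (fun y => inner ℝ (nrm Ω y) (nrm Ω y)) (0 : Cn n →L[ℝ] ℝ) z := by
    refine (hasFDerivAt_const (1 : ℝ) z).congr_of_eventuallyEq ?_
    filter_upwards [h.isOpen.mem_nhds hz] with y hy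
    rw [real_inner_self_eq_norm_sq, h.norm_nrm y hy]; norm_num
  have h3 := congrArg (fun L : Cn n →L[ℝ] ℝ => L v) (h1.unique h2)
  simpa [fderivInnerCLM_apply, real_inner_comm] using h3

/-- Since |N| = 1, the image of S is orthogonal to N; S is symmetric, so N lies in its kernel. -/
theorem shape_nrm (h : IsCollar k Ω W) (hk : 3 ≤ k) (hz : z ∈ W) :
    shape Ω z (nrm Ω z) = 0 := by
  apply ext_inner_right ℝ
  intro v
  rw [h.shape_symm hk hz, h.inner_nrm_shape hk hz, inner_zero_left]

theorem inner_nrm_self (h : IsCollar k Ω W) (hz : z ∈ W) : inner ℝ (nrm Ω z) (nrm Ω z) = 1 := by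
  rw [real_inner_self_eq_norm_sq, h.norm_nrm z hz]; norm_num

theorem hasFDerivAt_foot (h : IsCollar k Ω W) (hk : 3 ≤ k) (hz : z ∈ W) :
    HasFDerivAt (fun x => x - signedDist Ω x • nrm Ω x)
      (ContinuousLinearMap.id ℝ (Cn n) - (signedDist Ω z • shape Ω z
        + (innerSL ℝ (nrm Ω z)).smulRight (nrm Ω z))) z :=
  (hasFDerivAt_id z).sub ((h.hasFDerivAt hk hz).smul (h.hasFDerivAt_nrm hk hz))

/-- The shape operator at `z` in terms of the one at the foot point of `z`. -/
theorem shape_eq_shape_foot (h : IsCollar k Ω W) (hk : 3 ≤ k) (hz : z ∈ W) {v : Cn n}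
    (hv : inner ℝ (nrm Ω z) v = 0) :
    shape Ω z v = shape Ω (z - signedDist Ω z • nrm Ω z) v
      - signedDist Ω z • shape Ω (z - signedDist Ω z • nrm Ω z) (shape Ω z v) := by
  -- N is constant along normals: differentiate N∘foot = N, where the foot map sends a tangential v
  -- to v - δ̃ S v.
  have h1 : HasFDerivAt (fun x => nrm Ω (x - signedDist Ω x • nrm Ω x)) _ z :=
    HasFDerivAt.comp (g := nrm Ω) z
      (h.hasFDerivAt_nrm hk (h.subset (h.foot_mem z hz))) (h.hasFDerivAt_foot hk hz)
  have h2 : HasFDerivAt (fun x => nrm Ω (x - signedDist Ω x • nrm Ω x)) (shape Ω z) z := by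
    refine (h.hasFDerivAt_nrm hk hz).congr_of_eventuallyEq ?_
    filter_upwards [h.isOpen.mem_nhds hz] with y hy using h.nrm_foot y hy
  have h3 := congrArg (fun L : Cn n →L[ℝ] Cn n => L v) (h2.unique h1)
  simpa [hv] using h3

/-- The differential of a function vanishing on the boundary kills the tangent vectors. -/
theorem fderiv_eq_zero_of_tangent (h : IsCollar k Ω W) (hk : 3 ≤ k) (hz : z ∈ frontier Ω)
    {f : Cn n → ℝ} {f' : Cn n →L[ℝ] ℝ} (hf : HasFDerivAt f f' z) (hf0 : ∀ x ∈ frontier Ω, f x = 0)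
    {v : Cn n} (hv : inner ℝ (nrm Ω z) v = 0) : f' v = 0 := by
  have hzW := h.subset hz
  have hfoot : z - signedDist Ω z • nrm Ω z = z := by simp [signedDist_frontier hz]
  -- Composed with the foot map, f vanishes on a whole neighbourhood of z, and at z the foot map has
  -- the tangential projection as differential; no curves in the boundary are needed.
  have h1 : HasFDerivAt (fun x => f (x - signedDist Ω x • nrm Ω x)) _ z :=
    HasFDerivAt.comp (g := f) z (by rw [hfoot]; exact hf) (h.hasFDerivAt_foot hk hzW)
  have h2 : HasFDerivAt (fun x => f (x - signedDist Ω x • nrm Ω x)) (0 : Cn n →L[ℝ] ℝ) z := by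
    refine (hasFDerivAt_const (0 : ℝ) z).congr_of_eventuallyEq ?_
    filter_upwards [h.isOpen.mem_nhds hzW] with y hy using hf0 _ (h.foot_mem y hy)
  have h3 := congrArg (fun L : Cn n →L[ℝ] ℝ => L v) (h1.unique h2)
  simpa [hv, signedDist_frontier hz] using h3

end IsCollar

end

end DFIndex

/-! ### The forms α and β and the two sides of the boundary inequality in real terms. -/

namespace DFIndex

noncomputable section

variable {n : ℕ}

/-- The real number `⟨i∇δ̃, H(iτ)⟩`; the real part of `4α(τ)` at the boundary. -/
def twistRe (Ω : Set (Cn n)) (z τ : Cn n) : ℝ :=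
  inner ℝ (Complex.I • nrm Ω z) (shape Ω z (Complex.I • τ))

/-- The real number `-⟨i∇δ̃, Hτ⟩`; minus the imaginary part of `4α(τ)` at the boundary. -/
def twistIm (Ω : Set (Cn n)) (z τ : Cn n) : ℝ :=
  -inner ℝ (Complex.I • nrm Ω z) (shape Ω z τ)

theorem real_inner_single_one (g : Cn n) (j : Fin n) :
    inner ℝ g (EuclideanSpace.single j 1) = (g j).re := by
  rw [real_inner_eq_re, EuclideanSpace.inner_single_right]; simp

theorem real_inner_I_smul_single_one (g : Cn n) (j : Fin n) :
    inner ℝ g (Complex.I • EuclideanSpace.single j 1) = (g j).im := by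
  rw [real_inner_eq_re, inner_smul_right, EuclideanSpace.inner_single_right]; simp

theorem inner_eq_sum_conj (u v : Cn n) : (inner ℂ u v : ℂ) = ∑ j, conj (u j) * v j := by
  rw [PiLp.inner_apply]
  exact Finset.sum_congr rfl fun j _ => by rw [RCLike.inner_apply, mul_comm]

namespace IsCollar

variable {k : ℕ∞} {Ω W : Set (Cn n)} {z : Cn n}

theorem dz_sd (h : IsCollar k Ω W) (hk : 3 ≤ k) (hz : z ∈ W) (j : Fin n) :
    dz j (sd Ω) z = conj (nrm Ω z j) / 2 := by
  have hd := (h.hasFDerivAt hk hz).differentiableAt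
  unfold sd
  rw [dz, single_I, fderiv_ofReal_comp hd, fderiv_ofReal_comp hd, h.fderiv_apply hk hz,
    h.fderiv_apply hk hz, real_inner_single_one, real_inner_I_smul_single_one]
  apply Complex.ext <;> simp

theorem dzbar_sd (h : IsCollar k Ω W) (hk : 3 ≤ k) (hz : z ∈ W) (j : Fin n) :
    dzbar j (sd Ω) z = nrm Ω z j / 2 := by
  have hd := (h.hasFDerivAt hk hz).differentiableAt
  unfold sd
  rw [dzbar, single_I, fderiv_ofReal_comp hd, fderiv_ofReal_comp hd, h.fderiv_apply hk hz,
    h.fderiv_apply hk hz, real_inner_single_one, real_inner_I_smul_single_one]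
  apply Complex.ext <;> simp

theorem hasFDerivAt_nrm_apply (h : IsCollar k Ω W) (hk : 3 ≤ k) (hz : z ∈ W) (j : Fin n) :
    HasFDerivAt (fun w => nrm Ω w j)
      (((EuclideanSpace.proj j : Cn n →L[ℂ] ℂ).restrictScalars ℝ).comp (shape Ω z)) z :=
  ((EuclideanSpace.proj j : Cn n →L[ℂ] ℂ).restrictScalars ℝ).hasFDerivAt.comp z
    (h.hasFDerivAt_nrm hk hz)

theorem del_dzbar_sd (h : IsCollar k Ω W) (hk : 3 ≤ k) (hz : z ∈ W) (j : Fin n) (τ : Cn n) :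
    del (dzbar j (sd Ω)) z τ
      = (shape Ω z τ j - Complex.I * shape Ω z (Complex.I • τ) j) / 4 := by
  have hev : dzbar j (sd Ω) =ᶠ[𝓝 z] fun w => nrm Ω w j * (2 : ℂ)⁻¹ := by
    filter_upwards [h.isOpen.mem_nhds hz] with w hw
    rw [h.dzbar_sd hk hw, div_eq_mul_inv]
  rw [del_eq, hev.fderiv_eq, ((h.hasFDerivAt_nrm_apply hk hz j).mul_const (2 : ℂ)⁻¹).fderiv]
  simp
  ring

theorem del_dz_sd (h : IsCollar k Ω W) (hk : 3 ≤ k) (hz : z ∈ W) (j : Fin n) (τ : Cn n) :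
    del (dz j (sd Ω)) z τ
      = (conj (shape Ω z τ j) - Complex.I * conj (shape Ω z (Complex.I • τ) j)) / 4 := by
  have hev : dz j (sd Ω) =ᶠ[𝓝 z] fun w => conj (nrm Ω w j) * (2 : ℂ)⁻¹ := by
    filter_upwards [h.isOpen.mem_nhds hz] with w hw
    rw [h.dz_sd hk hw, div_eq_mul_inv]
  have h1 : HasFDerivAt (fun w => conj (nrm Ω w j)) _ z :=
    (Complex.conjCLE.toContinuousLinearMap.hasFDerivAt).comp z (h.hasFDerivAt_nrm_apply hk hz j)
  rw [del_eq, hev.fderiv_eq, (h1.mul_const (2 : ℂ)⁻¹).fderiv]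
  simp
  ring

theorem isComplexTangent_iff (h : IsCollar k Ω W) (hk : 3 ≤ k) (hz : z ∈ W) (τ : Cn n) :
    IsComplexTangent Ω z τ ↔
      inner ℝ (nrm Ω z) τ = 0 ∧ inner ℝ (nrm Ω z) (Complex.I • τ) = 0 := by
  have hd := (h.hasFDerivAt hk hz).differentiableAt
  unfold IsComplexTangent sd
  rw [del_ofReal hd, h.fderiv_apply hk hz, h.fderiv_apply hk hz]
  constructor
  · intro h0
    have h1 := congrArg Complex.re h0
    have h2 := congrArg Complex.im h0
    simp at h1 h2
    exact ⟨h1, h2⟩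
  · rintro ⟨h1, h2⟩
    simp [h1, h2]

/-- The sum is a Hermitian product with N. Its components along N vanish because |N| = 1, and only
those along iN survive. -/
theorem alpha_eq (h : IsCollar k Ω W) (hk : 3 ≤ k) (hz : z ∈ W) (τ : Cn n) :
    alpha Ω z τ = ((twistRe Ω z τ : ℂ) - Complex.I * (twistIm Ω z τ : ℂ)) / 4 := by
  have h1 : alpha Ω z τ = ((inner ℂ (nrm Ω z) (shape Ω z τ) : ℂ)
      - Complex.I * (inner ℂ (nrm Ω z) (shape Ω z (Complex.I • τ)) : ℂ)) / 4 := by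
    rw [alpha, inner_eq_sum_conj, inner_eq_sum_conj, Finset.mul_sum, Finset.mul_sum,
      ← Finset.sum_sub_distrib, Finset.sum_div]
    refine Finset.sum_congr rfl fun j _ => ?_
    rw [h.dz_sd hk hz, h.del_dzbar_sd hk hz]
    ring
  rw [h1, inner_eq_real_inner, inner_eq_real_inner, h.inner_nrm_shape hk hz,
    h.inner_nrm_shape hk hz, twistRe, twistIm]
  apply Complex.ext <;> simp

/-- Parallelogram law: the first modulus is that of P + iQ, the second that of P - iQ, so the cross
terms cancel. This is why β pairs both kinds of derivative of δ̃. -/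
theorem sum_normSq_add (P Q : Cn n) :
    ∑ j, (‖(conj (P j) - Complex.I * conj (Q j)) / 4‖ ^ 2 + ‖(P j - Complex.I * Q j) / 4‖ ^ 2)
      = (‖P‖ ^ 2 + ‖Q‖ ^ 2) / 8 := by
  rw [EuclideanSpace.norm_sq_eq, EuclideanSpace.norm_sq_eq, ← Finset.sum_add_distrib,
    Finset.sum_div]
  refine Finset.sum_congr rfl fun j _ => ?_
  simp only [← Complex.normSq_eq_norm_sq, Complex.normSq_apply]
  simp
  ring

theorem normSq_sub_I_mul (a b : ℝ) : ‖(a : ℂ) - Complex.I * (b : ℂ)‖ ^ 2 = a ^ 2 + b ^ 2 := by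
  rw [← Complex.normSq_eq_norm_sq, Complex.normSq_apply]
  simp
  ring

theorem beta_eq (h : IsCollar k Ω W) (hk : 3 ≤ k) (hz : z ∈ W) (τ : Cn n) :
    beta Ω z τ = (‖shape Ω z τ‖ ^ 2 + ‖shape Ω z (Complex.I • τ)‖ ^ 2
      - twistRe Ω z τ ^ 2 - twistIm Ω z τ ^ 2) / 8 := by
  rw [beta]
  simp only [h.del_dz_sd hk hz, h.del_dzbar_sd hk hz]
  rw [sum_normSq_add, h.alpha_eq hk hz, norm_div, div_pow, normSq_sub_I_mul]
  norm_num
  ring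

theorem gradientSide_eq (h : IsCollar k Ω W) (hk : 3 ≤ k) (hz : z ∈ W) (s : ℝ) {φ : Cn n → ℝ}
    (hφ : DifferentiableAt ℝ φ z) (τ : Cn n) :
    gradientSide Ω s φ z τ = s / (1 - s) * ((fderiv ℝ φ z τ - twistRe Ω z τ) ^ 2
      + (fderiv ℝ φ z (Complex.I • τ) - twistIm Ω z τ) ^ 2) / 4 := by
  rw [gradientSide, del_ofReal hφ, h.alpha_eq hk hz]
  rw [show ((fderiv ℝ φ z τ : ℂ) - Complex.I * (fderiv ℝ φ z (Complex.I • τ) : ℂ)) / 2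
      - 2 * (((twistRe Ω z τ : ℂ) - Complex.I * (twistIm Ω z τ : ℂ)) / 4)
      = (((fderiv ℝ φ z τ - twistRe Ω z τ : ℝ) : ℂ)
        - Complex.I * ((fderiv ℝ φ z (Complex.I • τ) - twistIm Ω z τ : ℝ) : ℂ)) / 2 by
    push_cast; ring, norm_div, div_pow, normSq_sub_I_mul]
  norm_num
  ring

theorem hessianSide_eq (h : IsCollar k Ω W) (hk : 3 ≤ k) (hz : z ∈ W) {φ : Cn n → ℝ}
    (hφ : ContDiffAt ℝ 2 φ z) (τ : Cn n) :
    hessianSide Ω φ z τ = (realLevi φ z τ + ‖shape Ω z τ‖ ^ 2 + ‖shape Ω z (Complex.I • τ)‖ ^ 2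
      - twistRe Ω z τ ^ 2 - twistIm Ω z τ ^ 2) / 4 := by
  rw [hessianSide, leviForm_eq hφ, h.beta_eq hk hz]
  ring

end IsCollar

/-! ### Plurisubharmonicity of powers of a defining function -/

theorem hess_comp {h : ℝ → ℝ} {f : Cn n → ℝ} {z : Cn n} {h1 : ℝ → ℝ} {h2 : ℝ}
    (hf : ContDiffAt ℝ 2 f z) (hh : ∀ᶠ y in 𝓝 (f z), HasDerivAt h (h1 y) y)
    (hh2 : HasDerivAt h1 h2 (f z)) (u v : Cn n) :
    hess (fun w => h (f w)) z u v
      = h1 (f z) * hess f z u v + h2 * (fderiv ℝ f z u * fderiv ℝ f z v) := by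
  have hev : fderiv ℝ (fun w => h (f w)) =ᶠ[𝓝 z] fun w => h1 (f w) • fderiv ℝ f w := by
    filter_upwards [hf.eventually_differentiableAt, hf.continuousAt.eventually hh] with w hw hw'
    exact (hw'.comp_hasFDerivAt w hw.hasFDerivAt).fderiv
  have hd := (hh2.comp_hasFDerivAt z (hf.differentiableAt (by norm_num)).hasFDerivAt).smul
    hf.hasFDerivAt_fderiv
  have hd' : HasFDerivAt (fun w => h1 (f w) • fderiv ℝ f w) _ z := hd
  rw [hess, hev.fderiv_eq, hd'.fderiv]
  simp [hess]
  ring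

theorem realLevi_comp {h : ℝ → ℝ} {f : Cn n → ℝ} {z : Cn n} {h1 : ℝ → ℝ} {h2 : ℝ}
    (hf : ContDiffAt ℝ 2 f z) (hh : ∀ᶠ y in 𝓝 (f z), HasDerivAt h (h1 y) y)
    (hh2 : HasDerivAt h1 h2 (f z)) (τ : Cn n) :
    realLevi (fun w => h (f w)) z τ
      = h1 (f z) * realLevi f z τ
        + h2 * (fderiv ℝ f z τ ^ 2 + fderiv ℝ f z (Complex.I • τ) ^ 2) := by
  rw [realLevi, realLevi, hess_comp hf hh hh2, hess_comp hf hh hh2]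
  ring

/-- The Levi form of `-(-ρ)^η` in terms of `ψ = -log(-ρ)`. -/
theorem leviForm_neg_rpow {ρ : Cn n → ℝ} {z : Cn n} (hρ : ContDiffAt ℝ 2 ρ z) (hneg : ρ z < 0)
    (η : ℝ) (τ : Cn n) :
    leviForm (fun w => -(-ρ w) ^ η) z τ
      = η * (-ρ z) ^ η / 4 * (realLevi (fun w => -Real.log (-ρ w)) z τ
        - η * (fderiv ℝ (fun w => -Real.log (-ρ w)) z τ ^ 2
          + fderiv ℝ (fun w => -Real.log (-ρ w)) z (Complex.I • τ) ^ 2)) := by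
  have hψ : ContDiffAt ℝ 2 (fun w => -Real.log (-ρ w)) z :=
    (hρ.neg.log (by simpa using hneg.ne)).neg
  -- The function is g(ψ) with g(y) = -exp(-ηy), for which g' > 0 when η > 0 and g'' = -ηg';
  -- factoring out g' leaves B_ψ minus η times the square of the gradient.
  have hev : (fun w => -(-ρ w) ^ η) =ᶠ[𝓝 z] fun w => -Real.exp (-η * (-Real.log (-ρ w))) := by
    filter_upwards [hρ.continuousAt.eventually_lt_const hneg] with w hw
    rw [Real.rpow_def_of_pos (by linarith)]
    congr 2; ring
  have hd : ∀ y : ℝ, HasDerivAt (fun y => -Real.exp (-η * y)) (η * Real.exp (-η * y)) y := by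
    intro y
    have := ((hasDerivAt_id' y).const_mul (-η)).exp.neg
    exact this.congr_deriv (by ring)
  have hd2 : ∀ y : ℝ, HasDerivAt (fun y => η * Real.exp (-η * y)) (-η ^ 2 * Real.exp (-η * y)) y := by
    intro y
    have := (((hasDerivAt_id' y).const_mul (-η)).exp).const_mul η
    exact this.congr_deriv (by ring)
  have hL : leviForm (fun w => -(-ρ w) ^ η) z τ
      = leviForm (fun w => -Real.exp (-η * (-Real.log (-ρ w)))) z τ := by
    have hc : ∀ k, dzbar k (fun w => ((-(-ρ w) ^ η : ℝ) : ℂ))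
        =ᶠ[𝓝 z] dzbar k (fun w => ((-Real.exp (-η * (-Real.log (-ρ w))) : ℝ) : ℂ)) := by
      intro k
      have h1 : (fun w => ((-(-ρ w) ^ η : ℝ) : ℂ))
          =ᶠ[𝓝 z] (fun w => ((-Real.exp (-η * (-Real.log (-ρ w))) : ℝ) : ℂ)) :=
        hev.mono fun w hw => congrArg Complex.ofReal hw
      filter_upwards [h1.fderiv (𝕜 := ℝ)] with w hw
      simp only [dzbar, hw]
    simp only [leviForm, dz]
    congr 1
    refine Finset.sum_congr rfl fun j _ => Finset.sum_congr rfl fun k _ => ?_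
    rw [(hc k).fderiv_eq]
  have hexp : Real.exp (-η * (-Real.log (-ρ z))) = (-ρ z) ^ η := by
    rw [Real.rpow_def_of_pos (by linarith)]; congr 1; ring
  rw [hL, leviForm_eq ((contDiffAt_const.mul hψ).exp.neg),
    realLevi_comp hψ (Eventually.of_forall hd) (hd2 _), hexp]
  ring

end

end DFIndex

/-! ### Levi's theorem by analytic discs. -/

namespace DFIndex

noncomputable section

variable {n : ℕ}

theorem hasFDerivAt_of_contDiffAt {f : Cn n → ℝ} {z : Cn n} (hf : ContDiffAt ℝ 2 f z) :
    HasFDerivAt f (fderiv ℝ f z) z := (hf.differentiableAt (by norm_num)).hasFDerivAt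

/-- Second order Taylor expansion. -/
theorem taylor_two {f : Cn n → ℝ} {p : Cn n} (hf : ContDiffAt ℝ 2 f p) {c : ℝ} (hc : 0 < c) :
    ∀ᶠ h in 𝓝 (0 : Cn n),
      |f (p + h) - f p - fderiv ℝ f p h - hess f p h h / 2| ≤ c * ‖h‖ ^ 2 := by
  set R : Cn n → ℝ := fun h => f (p + h) - f p - fderiv ℝ f p h - hess f p h h / 2 with hR
  set A := fderiv ℝ (fderiv ℝ f) p with hA
  have hadd : Tendsto (fun h : Cn n => p + h) (𝓝 0) (𝓝 p) := by
    have : ContinuousAt (fun h : Cn n => p + h) 0 := by fun_prop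
    simpa [ContinuousAt] using this
  have h1 : ∀ᶠ h in 𝓝 (0 : Cn n),
      HasFDerivAt R (fderiv ℝ f (p + h) - fderiv ℝ f p - A h) h := by
    filter_upwards [hadd.eventually hf.eventually_differentiableAt] with h hh
    have a1 : HasFDerivAt (fun h => f (p + h)) (fderiv ℝ f (p + h)) h :=
      (hh.hasFDerivAt.comp h ((hasFDerivAt_id h).const_add p))
    have a2 : HasFDerivAt (fun h => A h h) (A h + A.flip h) h := by
      refine (A.hasFDerivAt.clm_apply (hasFDerivAt_id h)).congr_fderiv ?_
      ext v; simp
    have a3 := ((a1.sub_const (f p)).sub (fderiv ℝ f p).hasFDerivAt).sub (a2.mul_const (2 : ℝ)⁻¹)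
    refine (a3.congr_of_eventuallyEq (Eventually.of_forall fun w => ?_)).congr_fderiv ?_
    · simp [hR, hess, hA, div_eq_mul_inv]
    · ext v
      have hs : A v h = A h v := hess_symm hf v h
      simp [hs]
      ring
  have h2 : ∀ᶠ h in 𝓝 (0 : Cn n), ‖fderiv ℝ f (p + h) - fderiv ℝ f p - A h‖ ≤ c * ‖h‖ := by
    have := (hasFDerivAt_iff_isLittleO_nhds_zero.1 hf.hasFDerivAt_fderiv).def hc
    exact this
  obtain ⟨ε, hε, hb⟩ := Metric.eventually_nhds_iff_ball.1 (h1.and h2)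
  filter_upwards [Metric.ball_mem_nhds (0 : Cn n) hε] with h hh
  have hseg : ∀ x ∈ segment ℝ (0 : Cn n) h, ‖x‖ ≤ ‖h‖ := by
    intro x hx
    rw [segment_eq_image] at hx
    obtain ⟨θ, hθ, rfl⟩ := hx
    simp only [smul_zero, zero_add, norm_smul, Real.norm_eq_abs, abs_of_nonneg hθ.1]
    exact mul_le_of_le_one_left (norm_nonneg _) hθ.2
  have hsb : ∀ x ∈ segment ℝ (0 : Cn n) h, x ∈ Metric.ball (0 : Cn n) ε := fun x hx => by
    rw [mem_ball_zero_iff] at hh ⊢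
    exact (hseg x hx).trans_lt hh
  -- On the segment from 0 to h the derivative of the remainder is at most c‖h‖, so the mean value
  -- inequality yields c‖h‖².
  have := (convex_segment (0 : Cn n) h).norm_image_sub_le_of_norm_hasFDerivWithin_le
    (f := R) (C := c * ‖h‖) (fun x hx => (hb x (hsb x hx)).1.hasFDerivWithinAt)
    (fun x hx => (hb x (hsb x hx)).2.trans (by gcongr; exact hseg x hx))
    (left_mem_segment ℝ 0 h) (right_mem_segment ℝ 0 h)
  have hR0 : R 0 = 0 := by simp [hR, hess]
  rw [hR0, sub_zero, sub_zero, Real.norm_eq_abs] at this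
  calc |R h| ≤ _ := this
    _ = _ := by ring

/-- The second order necessary condition at a maximum along a parabola. -/
theorem hess_le_of_isLocalMax {u : Cn n → ℝ} {q a b : Cn n} (hu : ContDiffAt ℝ 2 u q)
    (hmax : IsLocalMax (fun s : ℝ => u (q + s • a + s ^ 2 • b)) 0) :
    hess u q a a + 2 * fderiv ℝ u q b ≤ 0 := by
  by_contra hpos
  push Not at hpos
  set c : ℝ → Cn n := fun s => q + s • a + s ^ 2 • b with hc
  set φ : ℝ → ℝ := fun s => u (c s) with hφ
  have hc' : ∀ s, HasDerivAt c (a + (2 * s) • b) s := by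
    intro s
    have h1 := ((hasDerivAt_id' s).smul_const a).const_add q
    have h2 := (hasDerivAt_pow 2 s).smul_const b
    refine (h1.add h2).congr_deriv ?_
    simp
  have hc0 : c 0 = q := by simp [hc]
  have hct : Tendsto c (𝓝 0) (𝓝 q) := by
    have := (hc' 0).continuousAt
    rwa [ContinuousAt, hc0] at this
  have hφ' : ∀ᶠ s in 𝓝 (0 : ℝ), HasDerivAt φ (fderiv ℝ u (c s) (a + (2 * s) • b)) s := by
    filter_upwards [hct.eventually hu.eventually_differentiableAt] with s hs
    exact hs.hasFDerivAt.comp_hasDerivAt s (hc' s)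
  have hd1 : deriv φ =ᶠ[𝓝 0] fun s => fderiv ℝ u (c s) (a + (2 * s) • b) :=
    hφ'.mono fun s hs => hs.deriv
  have hd2 : HasDerivAt (fun s => fderiv ℝ u (c s) (a + (2 * s) • b))
      (hess u q a a + 2 * fderiv ℝ u q b) 0 := by
    have h1 : HasDerivAt (fun s => fderiv ℝ u (c s)) (fderiv ℝ (fderiv ℝ u) q a) 0 := by
      have h0 : HasFDerivAt (fderiv ℝ u) (fderiv ℝ (fderiv ℝ u) q) (c 0) := by
        rw [hc0]; exact hu.hasFDerivAt_fderiv
      refine (h0.comp_hasDerivAt (0 : ℝ) (hc' 0)).congr_deriv ?_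
      simp
    have h2 : HasDerivAt (fun s : ℝ => a + (2 * s) • b) ((2 : ℝ) • b) 0 := by
      have := (((hasDerivAt_id' (0 : ℝ)).const_mul 2).smul_const b).const_add a
      simpa using this
    refine (h1.clm_apply h2).congr_deriv ?_
    simp [hess, hc0]
  have hdd : deriv (deriv φ) 0 = hess u q a a + 2 * fderiv ℝ u q b := by
    rw [hd1.deriv_eq, hd2.deriv]
  -- A positive second derivative would make 0 a local minimum as well, hence φ locally constant,
  -- contradicting that very positivity.
  have hmin : IsLocalMin φ 0 := isLocalMin_of_deriv_deriv_pos (by rw [hdd]; exact hpos)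
    hmax.deriv_eq_zero hφ'.self_of_nhds.continuousAt
  have hconst : φ =ᶠ[𝓝 0] fun _ => φ 0 := by
    filter_upwards [hmin, hmax] with s h1 h2 using le_antisymm h2 h1
  have : deriv (deriv φ) 0 = 0 := by
    rw [hconst.deriv.deriv_eq]; simp
  linarith

theorem hess_quadratic {f : Cn n → ℝ} {z : Cn n} (hf : ContDiffAt ℝ 2 f z) (u v : Cn n) (a b : ℝ) :
    hess f z (a • u + b • v) (a • u + b • v)
      = a ^ 2 * hess f z u u + 2 * a * b * hess f z u v + b ^ 2 * hess f z v v := by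
  have h := hess_symm hf u v
  unfold hess at *
  simp only [map_add, map_smul, add_apply, smul_apply, smul_eq_mul]
  rw [h]; ring

theorem complex_smul_eq (ζ : ℂ) (v : Cn n) : ζ • v = ζ.re • v + ζ.im • Complex.I • v := by
  ext i
  simp only [PiLp.smul_apply, PiLp.add_apply, smul_eq_mul, Complex.real_smul]
  nth_rewrite 1 [← Complex.re_add_im ζ]
  ring

theorem hess_bound (f : Cn n → ℝ) (z u v : Cn n) :
    |hess f z u v| ≤ ‖fderiv ℝ (fderiv ℝ f) z‖ * ‖u‖ * ‖v‖ :=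
  (fderiv ℝ (fderiv ℝ f) z).le_opNorm₂ u v

set_option maxHeartbeats 1000000 in
/-- In a direction where the Levi form is negative, a parabolic disc touches the boundary from
inside. -/
theorem IsCollar.exists_parabolic_disc {k : ℕ∞} {Ω W : Set (Cn n)} (h : IsCollar k Ω W)
    (hk : 3 ≤ k) {p : Cn n} (hp : p ∈ frontier Ω) {τ : Cn n}
    (h1 : inner ℝ (nrm Ω p) τ = 0) (h2 : inner ℝ (nrm Ω p) (Complex.I • τ) = 0)
    (hB : realLevi (signedDist Ω) p τ < 0) :
    ∃ w : ℂ, ∀ᶠ ζ in 𝓝 (0 : ℂ), signedDist Ω (p + (ζ • τ + (ζ ^ 2 * w) • nrm Ω p))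
      ≤ realLevi (signedDist Ω) p τ / 8 * ‖ζ‖ ^ 2 := by
  have hpW := h.subset hp
  have hd2 : ContDiffAt ℝ 2 (signedDist Ω) p := (h.contDiffAt_three hk hpW).of_le (by norm_num)
  set g := nrm Ω p with hg
  set B := realLevi (signedDist Ω) p τ with hBdef
  have hgg : inner ℝ g g = 1 := h.inner_nrm_self hpW
  have hgI : inner ℝ g (Complex.I • g) = 0 := by
    rw [real_inner_comm]; exact real_inner_I_smul_self g
  have hg1 : ‖g‖ = 1 := h.norm_nrm p hpW
  set h11 := hess (signedDist Ω) p τ τ with h11d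
  set h12 := hess (signedDist Ω) p τ (Complex.I • τ) with h12d
  set h22 := hess (signedDist Ω) p (Complex.I • τ) (Complex.I • τ) with h22d
  have hBs : B = h11 + h22 := rfl
  -- This w cancels the harmonic part of ζ ↦ D²δ̃(ζτ,ζτ)/2, leaving the radial part B|ζ|²/4. The
  -- Taylor error and the terms of order three and more cost at most |B||ζ|²/16 each, whence B/8.
  set w : ℂ := ⟨-(h11 - h22) / 4, h12 / 2⟩ with hw
  refine ⟨w, ?_⟩
  set M := ‖fderiv ℝ (fderiv ℝ (signedDist Ω)) p‖ with hM
  set N := ‖τ‖ + ‖w‖ + 1 with hN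
  have hNpos : 0 < N := by positivity
  have hc : 0 < -B / (16 * N ^ 2) := div_pos (by linarith) (by positivity)
  have ht : Tendsto (fun ζ : ℂ => ζ • τ + (ζ ^ 2 * w) • g) (𝓝 0) (𝓝 0) := by
    have : Continuous (fun ζ : ℂ => ζ • τ + (ζ ^ 2 * w) • g) := by fun_prop
    have := this.tendsto 0
    simpa using this
  have hsmall : ∀ᶠ ζ in 𝓝 (0 : ℂ), (M * (2 * N * N + N ^ 2)) * ‖ζ‖ < -B / 16 := by
    have : Tendsto (fun ζ : ℂ => (M * (2 * N * N + N ^ 2)) * ‖ζ‖) (𝓝 0) (𝓝 0) := by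
      have : Continuous (fun ζ : ℂ => (M * (2 * N * N + N ^ 2)) * ‖ζ‖) := by fun_prop
      simpa using this.tendsto 0
    exact this.eventually_lt_const (by linarith)
  filter_upwards [ht.eventually (taylor_two hd2 hc), hsmall,
    Metric.ball_mem_nhds (0 : ℂ) one_pos] with ζ hζ hζs hζ1
  rw [mem_ball_zero_iff] at hζ1
  set a := ζ.re with ha
  set b := ζ.im with hb
  have hζn : ‖ζ‖ ^ 2 = a ^ 2 + b ^ 2 := by
    rw [← Complex.normSq_eq_norm_sq, Complex.normSq_apply]; ring
  set v1 := ζ • τ with hv1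
  set v2 := (ζ ^ 2 * w) • g with hv2
  have hn1 : ‖v1‖ ≤ ‖ζ‖ * N := by
    rw [hv1, norm_smul]; gcongr; rw [hN]; linarith [norm_nonneg w]
  have hn2 : ‖v2‖ ≤ ‖ζ‖ ^ 2 * N := by
    rw [hv2, norm_smul, hg1, mul_one, norm_mul, norm_pow]
    gcongr; rw [hN]; linarith [norm_nonneg τ]
  have hn2' : ‖v2‖ ≤ ‖ζ‖ * ‖w‖ := by
    rw [hv2, norm_smul, hg1, mul_one, norm_mul, norm_pow]
    gcongr
    rw [sq]; exact mul_le_of_le_one_left (norm_nonneg _) hζ1.le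
  have hn : ‖v1 + v2‖ ≤ ‖ζ‖ * N := by
    refine (norm_add_le _ _).trans ?_
    have : ‖v1‖ = ‖ζ‖ * ‖τ‖ := norm_smul _ _
    rw [this, hN]
    have := norm_nonneg ζ
    rw [mul_add, mul_add]
    linarith
  have hlin : fderiv ℝ (signedDist Ω) p (v1 + v2) = (a ^ 2 - b ^ 2) * w.re - 2 * a * b * w.im := by
    rw [h.fderiv_apply hk hpW, hv1, hv2, complex_smul_eq ζ, complex_smul_eq (ζ ^ 2 * w)]
    have hre : (ζ ^ 2 * w).re = (a ^ 2 - b ^ 2) * w.re - 2 * a * b * w.im := by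
      simp only [sq, Complex.mul_re, Complex.mul_im, ← ha, ← hb]; ring
    simp only [inner_add_right, inner_smul_right, ← hg, h1, h2, hgg, hgI, hre]
    ring
  have hq1 : hess (signedDist Ω) p v1 v1 = a ^ 2 * h11 + 2 * a * b * h12 + b ^ 2 * h22 := by
    rw [hv1, complex_smul_eq ζ]
    exact hess_quadratic hd2 τ (Complex.I • τ) a b
  have hq : hess (signedDist Ω) p (v1 + v2) (v1 + v2)
      = hess (signedDist Ω) p v1 v1 + 2 * hess (signedDist Ω) p v1 v2
        + hess (signedDist Ω) p v2 v2 := by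
    have := hess_quadratic hd2 v1 v2 1 1
    simpa using this
  have hb12 : |hess (signedDist Ω) p v1 v2| ≤ M * (‖ζ‖ * N) * (‖ζ‖ ^ 2 * N) :=
    (hess_bound _ _ _ _).trans (by gcongr)
  have hb22 : |hess (signedDist Ω) p v2 v2| ≤ M * (‖ζ‖ ^ 2 * N) * (‖ζ‖ ^ 2 * N) :=
    (hess_bound _ _ _ _).trans (by gcongr)
  have hcube : M * (‖ζ‖ ^ 2 * N) * (‖ζ‖ ^ 2 * N) ≤ M * N ^ 2 * ‖ζ‖ * ‖ζ‖ ^ 2 := by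
    have : ‖ζ‖ ^ 2 ≤ ‖ζ‖ := by rw [sq]; exact mul_le_of_le_one_left (norm_nonneg _) hζ1.le
    calc M * (‖ζ‖ ^ 2 * N) * (‖ζ‖ ^ 2 * N) = M * N ^ 2 * ‖ζ‖ ^ 2 * ‖ζ‖ ^ 2 := by ring
      _ ≤ _ := by gcongr
  have hT := (abs_le.1 hζ).2
  have hpert : -B / (16 * N ^ 2) * ‖v1 + v2‖ ^ 2 ≤ -B / 16 * ‖ζ‖ ^ 2 := by
    calc -B / (16 * N ^ 2) * ‖v1 + v2‖ ^ 2 ≤ -B / (16 * N ^ 2) * (‖ζ‖ * N) ^ 2 := by gcongr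
      _ = _ := by field_simp
  have hsm2 : (M * (2 * N * N + N ^ 2)) * ‖ζ‖ * ‖ζ‖ ^ 2 ≤ -B / 16 * ‖ζ‖ ^ 2 := by
    gcongr
  rw [signedDist_frontier hp, hlin, hq, hq1] at hT
  have e1 := (abs_le.1 hb12).2
  have e2 := (abs_le.1 hb22).2
  have hwre : w.re = -(h11 - h22) / 4 := rfl
  have hwim : w.im = h12 / 2 := rfl
  rw [hwre, hwim] at hT
  change signedDist Ω (p + (v1 + v2)) ≤ _
  have hmain : (a ^ 2 - b ^ 2) * (-(h11 - h22) / 4) - 2 * a * b * (h12 / 2)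
      + (a ^ 2 * h11 + 2 * a * b * h12 + b ^ 2 * h22) / 2 = B / 4 * ‖ζ‖ ^ 2 := by
    rw [hζn, hBs]; ring
  have hMN : M * (‖ζ‖ * N) * (‖ζ‖ ^ 2 * N) = M * N * N * ‖ζ‖ * ‖ζ‖ ^ 2 := by ring
  have hX : 0 ≤ M * N ^ 2 * ‖ζ‖ * ‖ζ‖ ^ 2 := by positivity
  linarith
/-- Levi's theorem: the boundary of a pseudoconvex domain has non-negative Levi form. -/
theorem IsCollar.realLevi_nonneg {k : ℕ∞} {Ω W : Set (Cn n)} (h : IsCollar k Ω W) (hk : 3 ≤ k)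
    (hΩ : IsOpen Ω) (hpsc : IsPseudoconvex Ω) {p : Cn n} (hp : p ∈ frontier Ω) {τ : Cn n}
    (h1 : inner ℝ (nrm Ω p) τ = 0) (h2 : inner ℝ (nrm Ω p) (Complex.I • τ) = 0) :
    0 ≤ realLevi (signedDist Ω) p τ := by
  by_contra hB
  push Not at hB
  obtain ⟨u, -, ⟨huC, huL⟩, hex⟩ := hpsc
  have hpW := h.subset hp
  have hd2 : ContDiffAt ℝ 2 (signedDist Ω) p := (h.contDiffAt_three hk hpW).of_le (by norm_num)
  set g := nrm Ω p with hg
  set B := realLevi (signedDist Ω) p τ with hBdef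
  have hgg : inner ℝ g g = 1 := h.inner_nrm_self hpW
  have hgI : inner ℝ g (Complex.I • g) = 0 := by
    rw [real_inner_comm]; exact real_inner_I_smul_self g
  have hg1 : ‖g‖ = 1 := h.norm_nrm p hpW
  have hτ0 : τ ≠ 0 := by
    intro h0
    rw [hBdef, h0] at hB
    simp [realLevi, hess] at hB
  obtain ⟨w, hdisc⟩ := h.exists_parabolic_disc hk hp h1 h2 hB
  set ψ : ℂ → Cn n := fun ζ => p + (ζ • τ + (ζ ^ 2 * w) • g) with hψ
  have hψc : Continuous ψ := by fun_prop
  have hψ0 : ψ 0 = p := by simp [hψ]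
  -- moving inwards decreases the signed distance
  have hmove : ∀ᶠ y in 𝓝 p, y ∈ W ∧ 0 < inner ℝ (nrm Ω y) g := by
    have hcont : ContinuousAt (fun y => inner ℝ (nrm Ω y) g) p :=
      (h.continuousAt_nrm hk hpW).inner continuousAt_const
    have hpos : (0 : ℝ) < (fun y => inner ℝ (nrm Ω y) g) p := by
      change (0 : ℝ) < inner ℝ g g; rw [hgg]; exact one_pos
    filter_upwards [h.isOpen.mem_nhds hpW, hcont.eventually_const_lt hpos] with y hy hy'
    exact ⟨hy, hy'⟩
  obtain ⟨ρ, hρ, hρb⟩ := Metric.eventually_nhds_iff_ball.1 hmove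
  obtain ⟨r, hr, hrb⟩ := Metric.nhds_basis_closedBall.eventually_iff.1
    (hdisc.and (hψc.continuousAt.eventually (by
      rw [hψ0]; exact Metric.ball_mem_nhds p (half_pos hρ))))
  have hin : ∀ ζ ∈ Metric.closedBall (0 : ℂ) r, ∀ ε ∈ Icc 0 (ρ / 4), (ζ ≠ 0 ∨ 0 < ε) →
      ψ ζ - ε • g ∈ Ω := by
    intro ζ hζ ε hε hor
    obtain ⟨hle, hball⟩ := hrb hζ
    have hy : ψ ζ ∈ Metric.ball p ρ := Metric.ball_subset_ball (by linarith) hball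
    have hy' : ψ ζ - ε • g ∈ Metric.ball p ρ := by
      rw [Metric.mem_ball]
      replace hball : dist (ψ ζ) p < ρ / 2 := hball
      have : dist (ψ ζ - ε • g) (ψ ζ) ≤ ρ / 4 := by
        rw [dist_eq_norm, sub_sub_cancel_left, norm_neg, norm_smul, hg1, mul_one,
          Real.norm_eq_abs, abs_of_nonneg hε.1]
        exact hε.2
      linarith [dist_triangle (ψ ζ - ε • g) (ψ ζ) p]
    obtain ⟨ξ, hξ, hξe⟩ := domain_mvt (s := Metric.ball p ρ) (f := signedDist Ω)
      (f' := fun y => innerSL ℝ (nrm Ω y))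
      (fun y hy => (h.hasFDerivAt hk (hρb y hy).1).hasFDerivWithinAt) (convex_ball p ρ) hy hy'
    have hip := (hρb ξ ((convex_ball p ρ).segment_subset hy hy' hξ)).2
    simp only [innerSL_apply_apply, sub_sub_cancel_left, inner_neg_right, inner_smul_right] at hξe
    apply mem_of_signedDist_neg
    rcases hor with h0 | h0
    · have : B / 8 * ‖ζ‖ ^ 2 < 0 :=
        mul_neg_of_neg_of_pos (by linarith) (by have := norm_pos_iff.2 h0; positivity)
      have := mul_nonneg hε.1 hip.le
      linarith
    · have : B / 8 * ‖ζ‖ ^ 2 ≤ 0 :=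
        mul_nonpos_of_nonpos_of_nonneg (by linarith) (by positivity)
      have := mul_pos h0 hip
      linarith
  -- the exhaustion function is bounded on the circles
  obtain ⟨C, hC⟩ : ∃ C, ∀ ζ ∈ Metric.sphere (0 : ℂ) r, ∀ ε ∈ Icc 0 (ρ / 4), u (ψ ζ - ε • g) ≤ C := by
    have hcomp : IsCompact (Metric.sphere (0 : ℂ) r ×ˢ Icc 0 (ρ / 4)) :=
      (isCompact_sphere _ _).prod isCompact_Icc
    have hcont : ContinuousOn (fun q : ℂ × ℝ => u (ψ q.1 - q.2 • g))
        (Metric.sphere (0 : ℂ) r ×ˢ Icc 0 (ρ / 4)) := by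
      refine huC.continuousOn.comp (by fun_prop) ?_
      rintro ⟨ζ, ε⟩ ⟨hζ, hε⟩
      exact hin ζ (Metric.sphere_subset_closedBall hζ) ε hε
        (Or.inl (ne_zero_of_mem_sphere hr.ne' ⟨ζ, hζ⟩))
    obtain ⟨C, hC⟩ := hcomp.bddAbove_image hcont
    exact ⟨C, fun ζ hζ ε hε => hC ⟨(ζ, ε), ⟨hζ, hε⟩, rfl⟩⟩
  -- maximum principle
  have hmaxp : ∀ ε ∈ Ioc 0 (ρ / 4), u (p - ε • g) ≤ C := by
    intro ε hε
    have hε' : ε ∈ Icc 0 (ρ / 4) := ⟨hε.1.le, hε.2⟩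
    have hcont : ContinuousOn (fun ζ => u (ψ ζ - ε • g)) (Metric.closedBall (0 : ℂ) r) :=
      huC.continuousOn.comp (by fun_prop) fun ζ hζ => hin ζ hζ ε hε' (Or.inr hε.1)
    obtain ⟨ζ₀, hζ₀, hmax⟩ := (isCompact_closedBall (0 : ℂ) r).exists_isMaxOn
      ⟨0, Metric.mem_closedBall_self hr.le⟩ hcont
    have h0 : u (p - ε • g) ≤ u (ψ ζ₀ - ε • g) := by
      have := hmax (Metric.mem_closedBall_self hr.le)
      simpa [hψ0] using this
    refine h0.trans ?_
    by_cases hs : ζ₀ ∈ Metric.sphere (0 : ℂ) r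
    · exact hC ζ₀ hs ε hε'
    exfalso
    have hζb : ζ₀ ∈ Metric.ball (0 : ℂ) r := by
      rw [mem_ball_zero_iff]
      rw [mem_closedBall_zero_iff] at hζ₀
      rw [mem_sphere_zero_iff_norm] at hs
      exact lt_of_le_of_ne hζ₀ hs
    set q := ψ ζ₀ - ε • g with hq
    have hqΩ : q ∈ Ω := hin ζ₀ hζ₀ ε hε' (Or.inr hε.1)
    have huq : ContDiffAt ℝ 2 u q := huC.contDiffAt (hΩ.mem_nhds hqΩ)
    set a := τ + (2 * ζ₀ * w) • g with ha
    -- Restricting the disc to the real line through ζ₀ in direction d gives the parabola with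
    -- velocity d·a and quadratic coefficient d²wN. For d = 1 and d = i these coefficients are
    -- opposite, so the first order terms cancel in the sum of the two second order conditions.
    have hlocal : ∀ d b : ℂ, d ^ 2 = b →
        IsLocalMax (fun s : ℝ => u (q + s • (d • a) + s ^ 2 • ((b * w) • g))) 0 := by
      rintro d b rfl
      have hcurve : ∀ s : ℝ, q + s • (d • a) + s ^ 2 • ((d ^ 2 * w) • g)
          = ψ (ζ₀ + s * d) - ε • g := by
        intro s
        ext i
        simp only [hq, ha, hψ, PiLp.add_apply, PiLp.sub_apply, PiLp.smul_apply, smul_eq_mul,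
          Complex.real_smul]
        push_cast
        ring
      have hcur : Tendsto (fun s : ℝ => ζ₀ + s * d) (𝓝 0) (𝓝 ζ₀) := by
        have : Continuous (fun s : ℝ => ζ₀ + s * d) := by fun_prop
        simpa using this.tendsto 0
      filter_upwards [hcur.eventually (Metric.isOpen_ball.mem_nhds hζb)] with s hs
      rw [hcurve, hcurve]
      simpa using hmax (Metric.ball_subset_closedBall hs)
    have m1 := hess_le_of_isLocalMax huq (hlocal 1 1 (by norm_num))
    have m2 := hess_le_of_isLocalMax huq (hlocal Complex.I (-1) (by simp))
    have hneg : ((-1 : ℂ) * w) • g = -((1 * w) • g) := by rw [neg_mul, neg_smul]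
    rw [hneg, map_neg] at m2
    rw [one_smul] at m1
    -- τ is orthogonal to N and iN, so its component in a cannot be cancelled.
    have ha0 : a ≠ 0 := by
      intro h0
      have hz : inner ℝ τ a = ‖τ‖ ^ 2 := by
        rw [ha, complex_smul_eq, inner_add_right, inner_add_right, inner_smul_right,
          inner_smul_right, real_inner_self_eq_norm_sq, real_inner_comm g τ, h1,
          real_inner_comm (Complex.I • g) τ, real_inner_I_smul_left, h2]
        simp
      rw [h0, inner_zero_right] at hz
      exact hτ0 (norm_eq_zero.1 (by simpa using hz.symm))
    have hpos := huL q hqΩ a ha0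
    rw [leviForm_eq huq, realLevi] at hpos
    linarith
  -- contradiction with the exhaustion property
  have hK := hex C
  have hlim : Tendsto (fun ε : ℝ => p - ε • g) (𝓝[>] 0) (𝓝 p) := by
    have : Continuous (fun ε : ℝ => p - ε • g) := by fun_prop
    have := this.tendsto 0
    simp only [zero_smul, sub_zero] at this
    exact this.mono_left nhdsWithin_le_nhds
  have hmem : ∀ᶠ ε in 𝓝[>] (0 : ℝ), p - ε • g ∈ {z ∈ Ω | u z ≤ C} := by
    filter_upwards [Ioc_mem_nhdsGT (show (0 : ℝ) < ρ / 4 by linarith)] with ε hε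
    refine ⟨?_, hmaxp ε hε⟩
    have := hin 0 (Metric.mem_closedBall_self hr.le) ε ⟨hε.1.le, hε.2⟩ (Or.inr hε.1)
    rwa [hψ0] at this
  have hpΩ : p ∈ Ω := (hK.isClosed.mem_of_tendsto hlim hmem).1
  rw [hΩ.frontier_eq] at hp
  exact hp.2 hpΩ

end

end DFIndex

/-! ### Hessians of logarithms, completing the square, and the cost of the perturbation. -/

namespace DFIndex

noncomputable section

variable {n : ℕ}

/-! ### Calculus of Hessians -/

theorem hess_congr {f f' : Cn n → ℝ} {z : Cn n} (h : f =ᶠ[𝓝 z] f') (u v : Cn n) :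
    hess f z u v = hess f' z u v := by
  rw [hess, hess, (h.fderiv (𝕜 := ℝ)).fderiv_eq]

theorem realLevi_congr {f f' : Cn n → ℝ} {z : Cn n} (h : f =ᶠ[𝓝 z] f') (τ : Cn n) :
    realLevi f z τ = realLevi f' z τ := by
  rw [realLevi, realLevi, hess_congr h, hess_congr h]

theorem hess_add {f f' : Cn n → ℝ} {z : Cn n} (hf : ContDiffAt ℝ 2 f z) (hf' : ContDiffAt ℝ 2 f' z)
    (u v : Cn n) : hess (fun w => f w + f' w) z u v = hess f z u v + hess f' z u v := by
  have hev : fderiv ℝ (fun w => f w + f' w) =ᶠ[𝓝 z] fun w => fderiv ℝ f w + fderiv ℝ f' w := by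
    filter_upwards [hf.eventually_differentiableAt, hf'.eventually_differentiableAt] with w h1 h2
    exact fderiv_fun_add h1 h2
  rw [hess, hev.fderiv_eq,
    fderiv_fun_add hf.hasFDerivAt_fderiv.differentiableAt hf'.hasFDerivAt_fderiv.differentiableAt]
  rfl

theorem realLevi_add {f f' : Cn n → ℝ} {z : Cn n} (hf : ContDiffAt ℝ 2 f z)
    (hf' : ContDiffAt ℝ 2 f' z) (τ : Cn n) :
    realLevi (fun w => f w + f' w) z τ = realLevi f z τ + realLevi f' z τ := by
  rw [realLevi, hess_add hf hf', hess_add hf hf', realLevi, realLevi]; ring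

theorem realLevi_smul (f : Cn n → ℝ) (z : Cn n) (r : ℝ) (X : Cn n) :
    realLevi f z (r • X) = r ^ 2 * realLevi f z X := by
  simp only [realLevi, hess, smul_comm Complex.I r X, map_smul, smul_apply, smul_eq_mul]
  ring

theorem fderiv_const_mul_norm_sq (ε : ℝ) (z τ : Cn n) :
    fderiv ℝ (fun w : Cn n => ε * ‖w‖ ^ 2) z τ = ε * (2 * inner ℝ z τ) := by
  have := ((hasStrictFDerivAt_norm_sq z).hasFDerivAt.const_mul ε).fderiv
  rw [this]
  simp

theorem realLevi_const_mul_norm_sq (ε : ℝ) (z τ : Cn n) :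
    realLevi (fun w : Cn n => ε * ‖w‖ ^ 2) z τ = 4 * ε * ‖τ‖ ^ 2 := by
  have h1 : fderiv ℝ (fun w : Cn n => ε * ‖w‖ ^ 2) = (2 * ε) • innerSL ℝ (E := Cn n) := by
    funext w; ext v
    rw [fderiv_const_mul_norm_sq]; simp; ring
  have h2 : ∀ u v : Cn n, hess (fun w : Cn n => ε * ‖w‖ ^ 2) z u v = 2 * ε * inner ℝ u v := by
    intro u v
    rw [hess, h1, ((innerSL ℝ (E := Cn n)).hasFDerivAt.const_smul (2 * ε)).fderiv]
    simp
    exact Or.inl rfl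
  rw [realLevi, h2, h2, real_inner_self_eq_norm_sq, real_inner_self_eq_norm_sq, norm_I_smul]
  ring

theorem contDiff_const_mul_norm_sq (ε : ℝ) {k : WithTop ℕ∞} :
    ContDiff ℝ k (fun w : Cn n => ε * ‖w‖ ^ 2) :=
  contDiff_const.mul (contDiff_norm_sq ℝ)

theorem hasDerivAt_neg_log_neg {y : ℝ} (hy : y < 0) :
    HasDerivAt (fun y => -Real.log (-y)) (-y⁻¹) y := by
  have := ((hasDerivAt_neg' y).log (by linarith)).neg
  exact this.congr_deriv (by field_simp)

theorem contDiffAt_neg_log_neg {ρ : Cn n → ℝ} {z : Cn n} {k : WithTop ℕ∞} (hρ : ContDiffAt ℝ k ρ z)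
    (hneg : ρ z < 0) : ContDiffAt ℝ k (fun w => -Real.log (-ρ w)) z :=
  (hρ.neg.log (by simpa using hneg.ne)).neg

theorem fderiv_neg_log_neg {ρ : Cn n → ℝ} {z : Cn n} (hρ : DifferentiableAt ℝ ρ z)
    (hneg : ρ z < 0) (v : Cn n) :
    fderiv ℝ (fun w => -Real.log (-ρ w)) z v = fderiv ℝ ρ z v / (-ρ z) := by
  have h := ((hasDerivAt_neg_log_neg hneg).comp_hasFDerivAt z hρ.hasFDerivAt).fderiv
  have h' : fderiv ℝ (fun w => -Real.log (-ρ w)) z = -(ρ z)⁻¹ • fderiv ℝ ρ z := h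
  rw [h']
  simp
  field_simp

theorem hess_neg_log_neg {ρ : Cn n → ℝ} {z : Cn n} (hρ : ContDiffAt ℝ 2 ρ z)
    (hneg : ρ z < 0) (u v : Cn n) :
    hess (fun w => -Real.log (-ρ w)) z u v
      = hess ρ z u v / (-ρ z) + fderiv ℝ ρ z u * fderiv ℝ ρ z v / (-ρ z) ^ 2 := by
  have h2 : HasDerivAt (fun y : ℝ => -y⁻¹) ((ρ z ^ 2)⁻¹) (ρ z) :=
    ((hasDerivAt_inv hneg.ne).neg).congr_deriv (by ring)
  rw [hess_comp (h := fun y => -Real.log (-y)) hρ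
    ((eventually_lt_nhds hneg).mono fun y hy => hasDerivAt_neg_log_neg hy) h2]
  have := hneg.ne
  field_simp

theorem continuousAt_hess {f : Cn n → ℝ} {p : Cn n} (hf : ContDiffAt ℝ 2 f p) :
    ContinuousAt (fderiv ℝ (fderiv ℝ f)) p :=
  ((hf.fderiv_right (m := 1) (by norm_num)).fderiv_right (m := 0) (by norm_num)).continuousAt

theorem continuousAt_fderiv {f : Cn n → ℝ} {p : Cn n} (hf : ContDiffAt ℝ 2 f p) :
    ContinuousAt (fderiv ℝ f) p :=
  (hf.fderiv_right (m := 1) (by norm_num)).continuousAt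

/-! ### Algebra of the quadratic forms -/

/-- Completing the square in the normal direction. -/
theorem complete_square {η : ℝ} (hη : η < 1) (a x d : ℝ) :
    2 * d * a + d ^ 2 - η * (x + d) ^ 2
      = -a ^ 2 - η / (1 - η) * (x - a) ^ 2 + (1 - η) * (d - (η * x - a) / (1 - η)) ^ 2 := by
  have : 1 - η ≠ 0 := by linarith
  field_simp
  ring

theorem div_one_sub_lt {s η : ℝ} (h : s < η) (hη : η < 1) : s / (1 - s) < η / (1 - η) := by
  rw [div_lt_div_iff₀ (by linarith) (by linarith)]
  nlinarith

/-- A loss in the constant pays for adding a small multiple of `‖z‖²`. -/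
theorem exists_perturbation {κ κ' R : ℝ} (hκ : 0 ≤ κ) (hκ' : κ < κ') (hR : 0 ≤ R) :
    ∃ ε > 0, ∀ y₁ y₂ e₁ e₂ T : ℝ, 0 ≤ T → e₁ ^ 2 + e₂ ^ 2 ≤ R * T →
      κ * ((y₁ + ε * e₁) ^ 2 + (y₂ + ε * e₂) ^ 2) + ε * T
        ≤ κ' * (y₁ ^ 2 + y₂ ^ 2) + 4 * ε * T := by
  have hd : 0 < κ' - κ := by linarith
  set C := κ * κ' / (κ' - κ) with hC
  have hC0 : 0 ≤ C := by have : 0 ≤ κ' := by linarith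
                         positivity
  -- C is the sharp constant here: the difference of the two sides is a perfect square divided by κ'
  -- - κ.
  have key : ∀ y f : ℝ, κ * (y + f) ^ 2 ≤ κ' * y ^ 2 + C * f ^ 2 := by
    intro y f
    have : κ' * y ^ 2 + C * f ^ 2 - κ * (y + f) ^ 2
        = ((κ' - κ) * y - κ * f) ^ 2 / (κ' - κ) := by
      rw [hC]; field_simp; ring
    have h2 : 0 ≤ ((κ' - κ) * y - κ * f) ^ 2 / (κ' - κ) := by positivity
    linarith
  -- The term ε‖z‖² contributes 4εT to B. One εT is reserved for strictness, so the quadratic error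
  -- Cε²RT must stay below 3εT.
  refine ⟨3 / (C * R + 1), by positivity, fun y₁ y₂ e₁ e₂ T hT he => ?_⟩
  set ε := 3 / (C * R + 1) with hε
  have hε0 : 0 < ε := by positivity
  have hεR : ε * (C * R) ≤ 3 := by
    have : ε * (C * R + 1) = 3 := by rw [hε]; field_simp
    linarith
  have k1 := key y₁ (ε * e₁)
  have k2 := key y₂ (ε * e₂)
  have h3 : C * (ε * e₁) ^ 2 + C * (ε * e₂) ^ 2 ≤ ε * 3 * T := by
    calc C * (ε * e₁) ^ 2 + C * (ε * e₂) ^ 2 = C * ε ^ 2 * (e₁ ^ 2 + e₂ ^ 2) := by ring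
      _ ≤ C * ε ^ 2 * (R * T) := by gcongr
      _ = ε * (ε * (C * R)) * T := by ring
      _ ≤ ε * 3 * T := by gcongr
  linarith

/-- The perturbation `ε‖z‖²` satisfies the hypotheses of `exists_perturbation`. -/
theorem sq_inner_add_sq_inner_le {z τ : Cn n} {R : ℝ} (hz : ‖z‖ ≤ R) :
    (2 * inner ℝ z τ) ^ 2 + (2 * inner ℝ z (Complex.I • τ)) ^ 2 ≤ 8 * R ^ 2 * ‖τ‖ ^ 2 := by
  have h1 := abs_real_inner_le_norm z τ
  have h2 := abs_real_inner_le_norm z (Complex.I • τ)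
  rw [norm_I_smul] at h2
  have h3 : ‖z‖ * ‖τ‖ ≤ R * ‖τ‖ := by gcongr
  have h4 : (inner ℝ z τ) ^ 2 ≤ (R * ‖τ‖) ^ 2 := sq_le_sq' (abs_le.1 (h1.trans h3)).1 (abs_le.1 (h1.trans h3)).2
  have h5 : (inner ℝ z (Complex.I • τ)) ^ 2 ≤ (R * ‖τ‖) ^ 2 :=
    sq_le_sq' (abs_le.1 (h2.trans h3)).1 (abs_le.1 (h2.trans h3)).2
  linarith [mul_pow R ‖τ‖ 2]

/-- The real form of the boundary inequality, with strict inequality. -/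
def StrictBoundaryIneq (Ω : Set (Cn n)) (κ : ℝ) (φ : Cn n → ℝ) (z τ : Cn n) : Prop :=
  κ * ((fderiv ℝ φ z τ - twistRe Ω z τ) ^ 2 + (fderiv ℝ φ z (Complex.I • τ) - twistIm Ω z τ) ^ 2)
    < realLevi φ z τ + ‖shape Ω z τ‖ ^ 2 + ‖shape Ω z (Complex.I • τ)‖ ^ 2
      - twistRe Ω z τ ^ 2 - twistIm Ω z τ ^ 2

end

end DFIndex

/-! ### A lower bound for the form of φ - log(-δ̃), continuous up to the boundary. -/

namespace DFIndex

noncomputable section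

variable {n : ℕ}

/-- The vector `τ + δ (d₁ N - d₂ iN)` at `z`, where `N` is the gradient of the signed distance and `δ`
the distance to the boundary. -/
def normalShift (Ω : Set (Cn n)) (z : Cn n) (v : Cn n × ℝ × ℝ) : Cn n :=
  v.1 + (-signedDist Ω z) • (v.2.1 • nrm Ω z - v.2.2 • Complex.I • nrm Ω z)

theorem normalShift_smul (Ω : Set (Cn n)) (z : Cn n) (r : ℝ) (v : Cn n × ℝ × ℝ) :
    normalShift Ω z (r • v) = r • normalShift Ω z v := by
  rw [normalShift, normalShift, Prod.smul_fst, Prod.smul_snd, Prod.smul_fst, Prod.smul_snd]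
  generalize Complex.I • nrm Ω z = w
  module

/-- A lower bound, continuous up to the boundary, for the form
`B_ψ(X, X) - η (Dψ(X)² + Dψ(iX)²)`, where `ψ = φ - log(-δ̃)` and `X` is `normalShift Ω z v`. -/
def barrierForm (Ω : Set (Cn n)) (φ : Cn n → ℝ) (η : ℝ) (z : Cn n) (v : Cn n × ℝ × ℝ) : ℝ :=
  realLevi φ z (normalShift Ω z v)
    + inner ℝ (shape Ω z v.1) (shape Ω (z - signedDist Ω z • nrm Ω z) v.1)
    + inner ℝ (shape Ω z (Complex.I • v.1))
        (shape Ω (z - signedDist Ω z • nrm Ω z) (Complex.I • v.1))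
    + 2 * v.2.1 * twistRe Ω z v.1 + 2 * v.2.2 * twistIm Ω z v.1
    + (-signedDist Ω z) * (v.2.1 ^ 2 + v.2.2 ^ 2)
        * inner ℝ (shape Ω z (Complex.I • nrm Ω z)) (Complex.I • nrm Ω z)
    + (v.2.1 ^ 2 + v.2.2 ^ 2)
    - η * ((fderiv ℝ φ z (normalShift Ω z v) + v.2.1) ^ 2
      + (fderiv ℝ φ z (Complex.I • normalShift Ω z v) + v.2.2) ^ 2)

/-- The barrier form is positive at the boundary. -/
theorem barrierForm_pos {Ω : Set (Cn n)} {p : Cn n} (hp : p ∈ frontier Ω)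
    {φ : Cn n → ℝ} {η : ℝ} (hη : η < 1) (v : Cn n × ℝ × ℝ) (hv : v ≠ 0)
    (hs : v.1 ≠ 0 → StrictBoundaryIneq Ω (η / (1 - η)) φ p v.1) :
    0 < barrierForm Ω φ η p v := by
  obtain ⟨τ, d₁, d₂⟩ := v
  have h0 := signedDist_frontier hp
  have hX : normalShift Ω p (τ, d₁, d₂) = τ := by simp [normalShift, h0]
  have hF : barrierForm Ω φ η p (τ, d₁, d₂) = realLevi φ p τ + ‖shape Ω p τ‖ ^ 2
      + ‖shape Ω p (Complex.I • τ)‖ ^ 2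
      + (2 * d₁ * twistRe Ω p τ + d₁ ^ 2 - η * (fderiv ℝ φ p τ + d₁) ^ 2)
      + (2 * d₂ * twistIm Ω p τ + d₂ ^ 2 - η * (fderiv ℝ φ p (Complex.I • τ) + d₂) ^ 2) := by
    rw [barrierForm, hX]
    simp only [h0, zero_smul, sub_zero, real_inner_self_eq_norm_sq]
    ring
  rw [hF, complete_square hη, complete_square hη]
  have hη1 : 0 < 1 - η := by linarith
  -- For τ = 0 all that remains is (1-η)(d₁² + d₂²). Otherwise the boundary inequality gives
  -- positivity, and the completed squares are discarded.
  by_cases hτ : τ = 0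
  · subst hτ
    simp only [realLevi, hess, twistRe, twistIm, smul_zero, map_zero, inner_zero_right, norm_zero,
      mul_zero, sub_zero, neg_zero, zero_div]
    have hd : 0 < d₁ ^ 2 + d₂ ^ 2 := by
      by_contra hle
      have e1 : d₁ ^ 2 = 0 := by nlinarith [sq_nonneg d₁, sq_nonneg d₂]
      have e2 : d₂ ^ 2 = 0 := by nlinarith [sq_nonneg d₁, sq_nonneg d₂]
      exact hv (by simp [pow_eq_zero_iff two_ne_zero |>.1 e1, pow_eq_zero_iff two_ne_zero |>.1 e2])
    nlinarith [mul_pos hη1 hd]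
  · have hs' := hs hτ
    simp only [StrictBoundaryIneq] at hs'
    have q1 : 0 ≤ (1 - η) * (d₁ - (η * fderiv ℝ φ p τ - twistRe Ω p τ) / (1 - η)) ^ 2 := by positivity
    have q2 : 0 ≤ (1 - η) * (d₂ - (η * fderiv ℝ φ p (Complex.I • τ) - twistIm Ω p τ) / (1 - η)) ^ 2 := by
      positivity
    linarith

namespace IsCollar

variable {k : ℕ∞} {Ω W : Set (Cn n)} {z p : Cn n}

/-- Joint continuity in the point and the vector is what lets positivity on the boundary spread to a
neighbourhood, uniformly over the unit sphere of vectors. -/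
theorem continuousAt_barrierForm (h : IsCollar k Ω W) (hk : 3 ≤ k) (hp : p ∈ frontier Ω)
    {φ : Cn n → ℝ} (hφ : ContDiffAt ℝ 2 φ p) (η : ℝ) (v : Cn n × ℝ × ℝ) :
    ContinuousAt (fun q : Cn n × (Cn n × ℝ × ℝ) => barrierForm Ω φ η q.1 q.2) (p, v) := by
  have hpW := h.subset hp
  have lift : ∀ {Y : Type} [TopologicalSpace Y] {f : Cn n → Y}, ContinuousAt f p →
      ContinuousAt (fun q : Cn n × (Cn n × ℝ × ℝ) => f q.1) (p, v) :=
    fun hf => ContinuousAt.comp (f := Prod.fst) hf continuousAt_fst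
  have hd := lift (h.contDiffAt_three hk hpW).continuousAt
  have hg := lift (h.continuousAt_nrm hk hpW)
  have hS := lift (h.continuousAt_shape hk hpW)
  have hS' : ContinuousAt (fun q : Cn n × (Cn n × ℝ × ℝ) =>
      shape Ω (q.1 - signedDist Ω q.1 • nrm Ω q.1)) (p, v) := by
    refine lift (f := fun x => shape Ω (x - signedDist Ω x • nrm Ω x)) ?_
    refine ContinuousAt.comp (g := shape Ω) ?_ (h.hasFDerivAt_foot hk hpW).continuousAt
    have : p - signedDist Ω p • nrm Ω p = p := by simp [signedDist_frontier hp]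
    rw [this]
    exact h.continuousAt_shape hk hpW
  have hD := lift (continuousAt_fderiv hφ)
  have hDD := lift (continuousAt_hess hφ)
  have hτ : ContinuousAt (fun q : Cn n × (Cn n × ℝ × ℝ) => q.2.1) (p, v) := by fun_prop
  have h1 : ContinuousAt (fun q : Cn n × (Cn n × ℝ × ℝ) => q.2.2.1) (p, v) := by fun_prop
  have h2 : ContinuousAt (fun q : Cn n × (Cn n × ℝ × ℝ) => q.2.2.2) (p, v) := by fun_prop
  have hIg := hg.const_smul Complex.I
  have hIτ := hτ.const_smul Complex.I
  have hX : ContinuousAt (fun q : Cn n × (Cn n × ℝ × ℝ) => normalShift Ω q.1 q.2) (p, v) :=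
    hτ.add (hd.neg.smul ((h1.smul hg).sub (h2.smul hIg)))
  have hIX := hX.const_smul Complex.I
  have hc2 : ContinuousAt (fun _ : Cn n × (Cn n × ℝ × ℝ) => (2 : ℝ)) (p, v) := continuousAt_const
  have hn := (h1.pow 2).add (h2.pow 2)
  exact (((((((((hDD.clm_apply hX).clm_apply hX).add ((hDD.clm_apply hIX).clm_apply hIX)).add
    ((hS.clm_apply hτ).inner (hS'.clm_apply hτ))).add
    ((hS.clm_apply hIτ).inner (hS'.clm_apply hIτ))).add
    ((hc2.mul h1).mul (hIg.inner (hS.clm_apply hIτ)))).add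
    ((hc2.mul h2).mul (hIg.inner (hS.clm_apply hτ)).neg)).add
    ((hd.neg.mul hn).mul ((hS.clm_apply hIg).inner hIg))).add hn).sub
    (continuousAt_const.mul ((((hD.clm_apply hX).add h1).pow 2).add
      (((hD.clm_apply hIX).add h2).pow 2)))

/-- The barrier form is a lower bound. -/
theorem barrierForm_le (h : IsCollar k Ω W) (hk : 3 ≤ k) (hz : z ∈ W) (hneg : signedDist Ω z < 0)
    (hlevi : ∀ p ∈ frontier Ω, ∀ τ, inner ℝ (nrm Ω p) τ = 0 → inner ℝ (nrm Ω p) (Complex.I • τ) = 0 →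
      0 ≤ realLevi (signedDist Ω) p τ)
    {φ : Cn n → ℝ} (hφ : ContDiffAt ℝ 2 φ z) (η : ℝ) (v : Cn n × ℝ × ℝ)
    (h1 : inner ℝ (nrm Ω z) v.1 = 0) (h2 : inner ℝ (nrm Ω z) (Complex.I • v.1) = 0) :
    barrierForm Ω φ η z v
      ≤ realLevi (fun w => φ w + -Real.log (-signedDist Ω w)) z (normalShift Ω z v)
        - η * (fderiv ℝ (fun w => φ w + -Real.log (-signedDist Ω w)) z (normalShift Ω z v) ^ 2
          + fderiv ℝ (fun w => φ w + -Real.log (-signedDist Ω w)) z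
            (Complex.I • normalShift Ω z v) ^ 2) := by
  obtain ⟨τ, d₁, d₂⟩ := v
  simp only at h1 h2
  have hd2 : ContDiffAt ℝ 2 (signedDist Ω) z := (h.contDiffAt_three hk hz).of_le (by norm_num)
  set δ := -signedDist Ω z with hδ
  have hδ0 : 0 < δ := by linarith
  have hsd : signedDist Ω z = -δ := by rw [hδ, neg_neg]
  set g := nrm Ω z with hg
  set X := normalShift Ω z (τ, d₁, d₂) with hX
  have hXe : X = τ + (δ * d₁) • g + (-(δ * d₂)) • Complex.I • g := by
    rw [hX, normalShift]
    simp only [← hδ, ← hg, smul_sub, smul_smul, neg_smul]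
    abel
  have hIX : Complex.I • X = Complex.I • τ + (δ * d₁) • Complex.I • g + (δ * d₂) • g := by
    rw [hXe, smul_add, smul_add, smul_comm Complex.I (δ * d₁) g,
      smul_comm Complex.I (-(δ * d₂)) (Complex.I • g), I_smul_I_smul, smul_neg, neg_smul, neg_neg]
  have hgg : inner ℝ g g = 1 := h.inner_nrm_self hz
  have hgI : inner ℝ g (Complex.I • g) = 0 := by
    rw [real_inner_comm]; exact real_inner_I_smul_self g
  -- The normal components of X and iX are δd₁ and δd₂, so -log(-δ̃) has derivatives exactly d₁ and
  -- d₂ along them.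
  have hgX : inner ℝ g X = δ * d₁ := by
    rw [hXe]
    simp only [inner_add_right, inner_smul_right, h1, hgg, hgI]
    ring
  have hgIX : inner ℝ g (Complex.I • X) = δ * d₂ := by
    rw [hIX]
    simp only [inner_add_right, inner_smul_right, h2, hgg, hgI]
    ring
  set S := shape Ω z with hS
  have hSg : S g = 0 := h.shape_nrm hk hz
  have hsym : ∀ u v, inner ℝ (S u) v = inner ℝ u (S v) := h.shape_symm hk hz
  have hSX : S X = S τ - (δ * d₂) • S (Complex.I • g) := by
    rw [hXe, map_add, map_add, S.map_smul (δ * d₁), S.map_smul (-(δ * d₂)), hSg, smul_zero, add_zero,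
      neg_smul, sub_eq_add_neg]
  have hSIX : S (Complex.I • X) = S (Complex.I • τ) + (δ * d₁) • S (Complex.I • g) := by
    rw [hIX, map_add, map_add, S.map_smul (δ * d₁), S.map_smul (δ * d₂), hSg, smul_zero, add_zero]
  have hre : twistRe Ω z τ = inner ℝ (S (Complex.I • g)) (Complex.I • τ) := by
    rw [twistRe, hsym]
  have him : twistIm Ω z τ = -inner ℝ (S (Complex.I • g)) τ := by
    rw [twistIm, hsym]
  set e := inner ℝ (S (Complex.I • g)) (Complex.I • g) with he
  have hgSX : ∀ u, inner ℝ (S u) g = 0 := fun u => by rw [hsym, hSg, inner_zero_right]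
  have hLX : inner ℝ (S X) X + inner ℝ (S (Complex.I • X)) (Complex.I • X)
      = inner ℝ (S τ) τ + inner ℝ (S (Complex.I • τ)) (Complex.I • τ)
        + 2 * (δ * d₁) * twistRe Ω z τ + 2 * (δ * d₂) * twistIm Ω z τ
        + δ ^ 2 * (d₁ ^ 2 + d₂ ^ 2) * e := by
    have e1 : inner ℝ (S τ) (Complex.I • g) = inner ℝ (S (Complex.I • g)) τ := by
      rw [hsym, real_inner_comm]
    have e2 : inner ℝ (S (Complex.I • τ)) (Complex.I • g)
        = inner ℝ (S (Complex.I • g)) (Complex.I • τ) := by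
      rw [hsym, real_inner_comm]
    rw [hSX, hSIX]
    nth_rewrite 1 [hXe]
    nth_rewrite 1 [hIX]
    simp only [inner_add_right, inner_add_left, inner_sub_left, inner_smul_right,
      real_inner_smul_left, hgSX, hre, him, e1, e2, ← he]
    ring
  -- the Levi form at the foot point
  set p := z - signedDist Ω z • g with hp
  have hpf : p ∈ frontier Ω := h.foot_mem z hz
  have hgp : nrm Ω p = g := h.nrm_foot z hz
  -- By S_z = S_p + δ S_p S_z on tangential vectors, passing to the foot point costs only a term
  -- with a factor δ, which stays bounded after division by δ.
  have hfoot : ∀ u, inner ℝ g u = 0 →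
      inner ℝ (S u) u = inner ℝ (shape Ω p u) u + δ * inner ℝ (S u) (shape Ω p u) := by
    intro u hu
    have := h.shape_eq_shape_foot hk hz hu
    rw [← hg, ← hp, hsd, neg_smul, sub_neg_eq_add, ← hS] at this
    nth_rewrite 1 [this]
    rw [inner_add_left, real_inner_smul_left, h.shape_symm hk (h.subset hpf) (S u) u]
  have hL0 := hlevi p hpf τ (by rw [hgp]; exact h1) (by rw [hgp]; exact h2)
  rw [realLevi, h.hess_eq hk (h.subset hpf), h.hess_eq hk (h.subset hpf)] at hL0
  -- derivatives of the logarithmic potential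
  have hlog := contDiffAt_neg_log_neg hd2 hneg
  have hD : ∀ u, fderiv ℝ (fun w => φ w + -Real.log (-signedDist Ω w)) z u
      = fderiv ℝ φ z u + inner ℝ g u / δ := by
    intro u
    rw [fderiv_fun_add (hφ.differentiableAt (by norm_num)) (hlog.differentiableAt (by norm_num)),
      add_apply, fderiv_neg_log_neg (hd2.differentiableAt (by norm_num)) hneg,
      h.fderiv_apply hk hz]
  have hH : realLevi (fun w => φ w + -Real.log (-signedDist Ω w)) z X
      = realLevi φ z X + (inner ℝ (S X) X + inner ℝ (S (Complex.I • X)) (Complex.I • X)) / δ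
        + (d₁ ^ 2 + d₂ ^ 2) := by
    rw [realLevi_add hφ hlog]
    nth_rewrite 2 [realLevi]
    rw [hess_neg_log_neg hd2 hneg, hess_neg_log_neg hd2 hneg, h.fderiv_apply hk hz,
      h.fderiv_apply hk hz, h.hess_eq hk hz, h.hess_eq hk hz, ← hg, hgX, hgIX, ← hδ]
    field_simp
    ring
  rw [hH, hD, hD, hgX, hgIX, hLX, hfoot τ h1, hfoot _ h2]
  have hc1 : δ * d₁ / δ = d₁ := by field_simp
  have hc2 : δ * d₂ / δ = d₂ := by field_simp
  rw [hc1, hc2, barrierForm, ← hX]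
  simp only [← hδ, ← hg, ← hS, ← hp, ← he]
  set A := inner ℝ (shape Ω p τ) τ
  set B := inner ℝ (shape Ω p (Complex.I • τ)) (Complex.I • τ)
  set A' := inner ℝ (S τ) (shape Ω p τ)
  set B' := inner ℝ (S (Complex.I • τ)) (shape Ω p (Complex.I • τ))
  have hexp : (A + δ * A' + (B + δ * B') + 2 * (δ * d₁) * twistRe Ω z τ
      + 2 * (δ * d₂) * twistIm Ω z τ + δ ^ 2 * (d₁ ^ 2 + d₂ ^ 2) * e) / δ
      = (A + B) / δ + A' + B' + 2 * d₁ * twistRe Ω z τ + 2 * d₂ * twistIm Ω z τ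
        + δ * (d₁ ^ 2 + d₂ ^ 2) * e := by
    field_simp
    ring
  rw [hexp]
  -- The only term that may blow up at the boundary is the Levi form of δ̃ at the foot point over δ;
  -- by pseudoconvexity it has the good sign.
  have : 0 ≤ (A + B) / δ := div_nonneg hL0 hδ0.le
  linarith

/-- Near a boundary point where the boundary inequality is strict, `φ - log(-δ̃)` satisfies the
differential inequality which characterises plurisubharmonicity of `-(-δ̃ e^{-φ})^η`. -/
theorem eventually_barrier (h : IsCollar k Ω W) (hk : 3 ≤ k) (hΩ : IsOpen Ω) (hp : p ∈ frontier Ω)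
    (hlevi : ∀ p ∈ frontier Ω, ∀ τ, inner ℝ (nrm Ω p) τ = 0 → inner ℝ (nrm Ω p) (Complex.I • τ) = 0 →
      0 ≤ realLevi (signedDist Ω) p τ)
    {φ : Cn n → ℝ} {η : ℝ} (hφ : ContDiffAt ℝ 2 φ p) (hη : η < 1)
    (hs : ∀ τ, τ ≠ 0 → inner ℝ (nrm Ω p) τ = 0 → inner ℝ (nrm Ω p) (Complex.I • τ) = 0 →
      StrictBoundaryIneq Ω (η / (1 - η)) φ p τ) :
    ∀ᶠ z in 𝓝 p, z ∈ Ω → ∀ X : Cn n, X ≠ 0 →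
      η * (fderiv ℝ (fun w => φ w + -Real.log (-signedDist Ω w)) z X ^ 2
          + fderiv ℝ (fun w => φ w + -Real.log (-signedDist Ω w)) z (Complex.I • X) ^ 2)
        < realLevi (fun w => φ w + -Real.log (-signedDist Ω w)) z X := by
  have hpW := h.subset hp
  have hK : IsCompact (Metric.sphere (0 : Cn n × ℝ × ℝ) 1) := isCompact_sphere _ _
  have hloc : ∀ v ∈ Metric.sphere (0 : Cn n × ℝ × ℝ) 1, ∀ᶠ q in 𝓝 (p, v),
      (inner ℝ (nrm Ω q.1) q.2.1 = 0 → inner ℝ (nrm Ω q.1) (Complex.I • q.2.1) = 0 →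
        0 < barrierForm Ω φ η q.1 q.2) := by
    intro v hv
    have hg : ContinuousAt (fun q : Cn n × (Cn n × ℝ × ℝ) => nrm Ω q.1) (p, v) :=
      ContinuousAt.comp (f := Prod.fst) (h.continuousAt_nrm hk hpW) continuousAt_fst
    have hτ : ContinuousAt (fun q : Cn n × (Cn n × ℝ × ℝ) => q.2.1) (p, v) := by fun_prop
    -- If τ is not complex tangent at p, it is not so at nearby points either, and the implication
    -- is vacuous there.
    by_cases ht : inner ℝ (nrm Ω p) v.1 = 0 ∧ inner ℝ (nrm Ω p) (Complex.I • v.1) = 0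
    · have hpos := barrierForm_pos hp hη v (ne_zero_of_mem_sphere one_ne_zero ⟨v, hv⟩)
        (fun h0 => hs v.1 h0 ht.1 ht.2)
      filter_upwards [(h.continuousAt_barrierForm hk hp hφ η v).eventually_const_lt hpos] with q hq _ _
      exact hq
    · rw [not_and_or] at ht
      rcases ht with ht | ht
      · filter_upwards [(hg.inner (𝕜 := ℝ) hτ).eventually_ne ht] with q hq h1 _
        exact absurd h1 hq
      · filter_upwards [(hg.inner (𝕜 := ℝ) (hτ.const_smul Complex.I)).eventually_ne ht] with q hq _ h1
        exact absurd h1 hq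
  filter_upwards [hK.eventually_forall_of_forall_eventually
    (P := fun z v => inner ℝ (nrm Ω z) v.1 = 0 → inner ℝ (nrm Ω z) (Complex.I • v.1) = 0 →
      0 < barrierForm Ω φ η z v) hloc, h.isOpen.mem_nhds hpW,
    hφ.eventually (by simp)] with z hzK hzW hφz hzΩ X hX
  have hneg := signedDist_neg hΩ ⟨p, hp⟩ hzΩ
  set δ := -signedDist Ω z with hδ
  have hδ0 : 0 < δ := by linarith
  set g := nrm Ω z with hg
  -- Any X is a shift: d₁ and d₂ are its normal components over δ. They may be huge near the
  -- boundary, but the inequality is homogeneous of degree two, so (τ, d₁, d₂) can be normalised to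
  -- the unit sphere.
  set d₁ := inner ℝ g X / δ with hd1
  set d₂ := inner ℝ g (Complex.I • X) / δ with hd2
  set τ := X - δ • (d₁ • g - d₂ • Complex.I • g) with hτ
  have hgg : inner ℝ g g = 1 := h.inner_nrm_self hzW
  have hgI : inner ℝ g (Complex.I • g) = 0 := by
    rw [real_inner_comm]; exact real_inner_I_smul_self g
  have e1 : δ * d₁ = inner ℝ g X := by rw [hd1]; field_simp
  have e2 : δ * d₂ = inner ℝ g (Complex.I • X) := by rw [hd2]; field_simp
  have ht1 : inner ℝ g τ = 0 := by
    rw [hτ, inner_sub_right, inner_smul_right, inner_sub_right, inner_smul_right, inner_smul_right,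
      hgg, hgI, ← e1]
    ring
  have hIτ : Complex.I • τ = Complex.I • X - δ • (d₁ • Complex.I • g + d₂ • g) := by
    rw [hτ, smul_sub, smul_comm Complex.I δ, smul_sub, smul_comm Complex.I d₁,
      smul_comm Complex.I d₂ (Complex.I • g), I_smul_I_smul, smul_neg, sub_neg_eq_add]
  have ht2 : inner ℝ g (Complex.I • τ) = 0 := by
    rw [hIτ, inner_sub_right, inner_smul_right, inner_add_right, inner_smul_right, inner_smul_right,
      hgg, hgI, ← e2]
    ring
  set v : Cn n × ℝ × ℝ := (τ, d₁, d₂) with hv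
  have hXv : normalShift Ω z v = X := by
    rw [normalShift, ← hδ, ← hg, hv, hτ]; simp
  have hv0 : v ≠ 0 := by
    intro h0
    apply hX
    rw [← hXv, h0]
    simp [normalShift]
  have hn : 0 < ‖v‖ := norm_pos_iff.2 hv0
  set r := ‖v‖⁻¹ with hr
  have hr0 : 0 < r := inv_pos.2 hn
  have hsph : r • v ∈ Metric.sphere (0 : Cn n × ℝ × ℝ) 1 := by
    rw [mem_sphere_zero_iff_norm, norm_smul, hr, norm_inv, norm_norm, inv_mul_cancel₀ hn.ne']
  have hshift : normalShift Ω z (r • v) = r • X := by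
    rw [normalShift_smul, hXv]
  have ht1' : inner ℝ g (r • v).1 = 0 := by simp [hv, inner_smul_right, ht1]
  have ht2' : inner ℝ g (Complex.I • (r • v).1) = 0 := by
    rw [Prod.smul_fst, smul_comm Complex.I r, inner_smul_right, ht2, mul_zero]
  have hpos := hzK _ hsph ht1' ht2'
  have hle := h.barrierForm_le hk hzW hneg hlevi hφz η (r • v) ht1' ht2'
  rw [hshift, realLevi_smul, smul_comm Complex.I r X, map_smul, map_smul] at hle
  have hfin := hpos.trans_le hle
  simp only [smul_eq_mul] at hfin
  have hr2 : 0 < r ^ 2 := by positivity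
  by_contra hcon
  push Not at hcon
  nlinarith [mul_le_mul_of_nonneg_left hcon hr2.le]

end IsCollar

end

end DFIndex

/-! ### From the boundary inequality to a defining function. -/

namespace DFIndex

noncomputable section

variable {n : ℕ}

theorem contDiffAt_neg_rpow {ρ : Cn n → ℝ} {z : Cn n} {k : WithTop ℕ∞} (hρ : ContDiffAt ℝ k ρ z)
    (hneg : ρ z < 0) (η : ℝ) : ContDiffAt ℝ k (fun w => -(-ρ w) ^ η) z :=
  (hρ.neg.rpow_const_of_ne (by simpa using hneg.ne)).neg

theorem isCompact_frontier_of_isBounded {Ω : Set (Cn n)} (hb : Bornology.IsBounded Ω) :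
    IsCompact (frontier Ω) :=
  Metric.isCompact_of_isClosed_isBounded isClosed_frontier (hb.closure.subset frontier_subset_closure)

/-- For ρ = δ̃ exp(-Φ) with Φ = φ + ε‖z‖², one has -log(-ρ) = Φ - log(-δ̃) inside Ω, which is the
function controlled by the barrier. Lowering s to η turns the weak inequality for φ into the strict
one for Φ. -/
theorem exists_defining_function {Ω : Set (Cn n)} (hΩ : IsOpen Ω) (hb : Bornology.IsBounded Ω)
    (hpsc : IsPseudoconvex Ω) {k : ℕ∞} (hk : 3 ≤ k) {W : Set (Cn n)} (h : IsCollar k Ω W)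
    {s : ℝ} (hs1 : s < 1) {Us : Set (Cn n)} {φ : Cn n → ℝ}
    (hUs : IsBoundaryNhd Ω Us) (hφ : ContDiffOn ℝ k φ Us)
    (hineq : ∀ z ∈ frontier Ω, ∀ τ : Cn n, IsComplexTangent Ω z τ →
      gradientSide Ω s φ z τ ≤ hessianSide Ω φ z τ) {η : ℝ} (hη0 : 0 < η) (hηs : η < s) :
    ∃ (V : Set (Cn n)) (ρ : Cn n → ℝ), IsDefiningFunctionOn k Ω V ρ ∧
      ∃ Uη : Set (Cn n), IsBoundaryNhd Ω Uη ∧ Uη ⊆ V ∧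
        IsC2StrictlyPshOn (fun z => -(-ρ z) ^ η) (Uη ∩ Ω) := by
  -- The boundary can be empty, as for n = 0; the empty neighbourhood then serves.
  rcases (frontier Ω).eq_empty_or_nonempty with hemp | hne
  · refine ⟨∅, fun _ => 0, ⟨⟨isOpen_empty, by rw [hemp]⟩, contDiffOn_const, by simp, by simp,
      by simp [hemp]⟩, ∅, ⟨isOpen_empty, by rw [hemp]⟩, subset_rfl, ?_⟩
    simp [IsC2StrictlyPshOn]
  have hη1 : η < 1 := hηs.trans hs1
  have hk2 : (2 : WithTop ℕ∞) ≤ k := by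
    have : ((2 : ℕ∞) : WithTop ℕ∞) ≤ k := by exact_mod_cast le_trans (by norm_num) hk
    exact this
  obtain ⟨R, hR⟩ := (isCompact_frontier_of_isBounded hb).isBounded.exists_norm_le
  obtain ⟨ε, hε, hpert⟩ := exists_perturbation (κ := η / (1 - η)) (κ' := s / (1 - s)) (R := 8 * R ^ 2)
    (div_nonneg hη0.le (by linarith)) (div_one_sub_lt hηs hs1) (by positivity)
  set Φ : Cn n → ℝ := fun z => φ z + ε * ‖z‖ ^ 2 with hΦ
  have hφat : ∀ z ∈ Us, ContDiffAt ℝ k φ z := fun z hz => hφ.contDiffAt (hUs.1.mem_nhds hz)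
  have hΦat : ∀ z ∈ Us, ContDiffAt ℝ k Φ z := fun z hz =>
    (hφat z hz).add (contDiff_const_mul_norm_sq ε).contDiffAt
  have hstrict : ∀ p ∈ frontier Ω, ∀ τ, τ ≠ 0 → inner ℝ (nrm Ω p) τ = 0 →
      inner ℝ (nrm Ω p) (Complex.I • τ) = 0 → StrictBoundaryIneq Ω (η / (1 - η)) Φ p τ := by
    intro p hp τ hτ h1 h2
    have hpW := h.subset hp
    have hφ2 := (hφat p (hUs.2 hp)).of_le hk2
    have hd := hφ2.differentiableAt (by norm_num)
    have hN : ContDiff ℝ 2 (fun w : Cn n => ε * ‖w‖ ^ 2) := contDiff_const_mul_norm_sq ε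
    have hw := hineq p hp τ ((h.isComplexTangent_iff hk hpW τ).2 ⟨h1, h2⟩)
    rw [h.gradientSide_eq hk hpW s hd, h.hessianSide_eq hk hpW hφ2] at hw
    have hD : ∀ u, fderiv ℝ Φ p u = fderiv ℝ φ p u + ε * (2 * inner ℝ p u) := by
      intro u
      rw [← fderiv_const_mul_norm_sq, hΦ,
        fderiv_fun_add hd (hN.differentiable (by norm_num)).differentiableAt]
      rfl
    rw [StrictBoundaryIneq, hD, hD, hΦ, realLevi_add hφ2 hN.contDiffAt, realLevi_const_mul_norm_sq]
    have hp4 := hpert (fderiv ℝ φ p τ - twistRe Ω p τ)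
      (fderiv ℝ φ p (Complex.I • τ) - twistIm Ω p τ) (2 * inner ℝ p τ)
      (2 * inner ℝ p (Complex.I • τ)) (‖τ‖ ^ 2) (by positivity) (sq_inner_add_sq_inner_le (hR p hp))
    have hpos : 0 < ε * ‖τ‖ ^ 2 := by have := norm_pos_iff.2 hτ; positivity
    rw [add_sub_right_comm, add_sub_right_comm]
    linarith
  have hlevi : ∀ p ∈ frontier Ω, ∀ τ, inner ℝ (nrm Ω p) τ = 0 →
      inner ℝ (nrm Ω p) (Complex.I • τ) = 0 → 0 ≤ realLevi (signedDist Ω) p τ :=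
    fun p hp τ h1 h2 => h.realLevi_nonneg hk hΩ hpsc hp h1 h2
  set V := W ∩ Us with hV
  have hVo : IsOpen V := h.isOpen.inter hUs.1
  have hbV : frontier Ω ⊆ V := subset_inter h.subset hUs.2
  set ρ : Cn n → ℝ := fun z => signedDist Ω z * Real.exp (-Φ z) with hρ
  have hρC : ∀ z ∈ V, ContDiffAt ℝ k ρ z := fun z hz =>
    (h.contDiffAt hz.1).mul (hΦat z hz.2).neg.exp
  have hsign : ∀ z, ρ z < 0 ↔ signedDist Ω z < 0 := fun z => by
    simp only [hρ]
    refine ⟨fun hlt => ?_, fun hlt => mul_neg_of_neg_of_pos hlt (Real.exp_pos _)⟩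
    by_contra hge
    exact absurd hlt (not_lt.2 (mul_nonneg (not_lt.1 hge) (Real.exp_pos _).le))
  have hnegiff : ∀ z, signedDist Ω z < 0 ↔ z ∈ Ω := fun z =>
    ⟨mem_of_signedDist_neg, signedDist_neg hΩ hne⟩
  refine ⟨V, ρ, ⟨⟨hVo, hbV⟩, fun z hz => (hρC z hz).contDiffWithinAt, fun z _ => ?_, fun z _ => ?_,
    fun z hz => ?_⟩, ?_⟩
  · rw [hsign, hnegiff]
  · rw [← signedDist_eq_zero hΩ hne]
    simp only [hρ, mul_eq_zero, (Real.exp_pos _).ne', or_false]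
  · have hzW := h.subset hz
    have hΦd := ((hΦat z (hUs.2 hz)).of_le hk2).differentiableAt (by norm_num)
    have hd : HasFDerivAt ρ _ z := (h.hasFDerivAt hk hzW).mul hΦd.hasFDerivAt.neg.exp
    intro h0
    have := congrArg (fun L : Cn n →L[ℝ] ℝ => L (nrm Ω z)) (hd.fderiv.symm.trans h0)
    simp [signedDist_frontier hz, h.norm_nrm z hzW] at this
  set good : Set (Cn n) := {z | z ∈ V ∧ (z ∈ Ω → ∀ X : Cn n, X ≠ 0 →
      η * (fderiv ℝ (fun w => Φ w + -Real.log (-signedDist Ω w)) z X ^ 2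
          + fderiv ℝ (fun w => Φ w + -Real.log (-signedDist Ω w)) z (Complex.I • X) ^ 2)
        < realLevi (fun w => Φ w + -Real.log (-signedDist Ω w)) z X)} with hgood
  have hgoodnhd : ∀ p ∈ frontier Ω, p ∈ interior good := by
    intro p hp
    rw [mem_interior_iff_mem_nhds]
    filter_upwards [hVo.mem_nhds (hbV hp), h.eventually_barrier hk hΩ hp hlevi
      ((hΦat p (hUs.2 hp)).of_le hk2) hη1 (hstrict p hp)] with z hz hz'
    exact ⟨hz, hz'⟩
  refine ⟨interior good, ⟨isOpen_interior, hgoodnhd⟩, fun z hz => (interior_subset hz).1, ?_, ?_⟩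
  · rintro z ⟨hz, hzΩ⟩
    have hneg : ρ z < 0 := (hsign z).2 ((hnegiff z).2 hzΩ)
    exact (contDiffAt_neg_rpow ((hρC z (interior_subset hz).1).of_le hk2) hneg η).contDiffWithinAt
  · rintro z ⟨hz, hzΩ⟩ X hX
    have hneg : ρ z < 0 := (hsign z).2 ((hnegiff z).2 hzΩ)
    have hbar := (interior_subset hz).2 hzΩ X hX
    have hev : (fun w => -Real.log (-ρ w)) =ᶠ[𝓝 z] fun w => Φ w + -Real.log (-signedDist Ω w) := by
      filter_upwards [hΩ.mem_nhds hzΩ] with w hw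
      have hw' : 0 < -signedDist Ω w := by linarith [(hnegiff w).2 hw]
      rw [hρ]
      simp only
      rw [← neg_mul, Real.log_mul hw'.ne' (Real.exp_pos _).ne', Real.log_exp]
      ring
    rw [leviForm_neg_rpow ((hρC z (interior_subset hz).1).of_le hk2) hneg, realLevi_congr hev,
      hev.fderiv_eq]
    have : 0 < η * (-ρ z) ^ η / 4 := by
      have : 0 < (-ρ z) ^ η := Real.rpow_pos_of_pos (by linarith) _
      positivity
    exact mul_pos this (by linarith)

end

end DFIndex

/-! ### Growth of -log(-ρ) and its derivatives along inward normals. -/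

namespace DFIndex

noncomputable section

variable {n : ℕ}

/-! ### Defining functions at the boundary -/

namespace IsDefiningFunctionOn

variable {k : ℕ∞} {Ω V W : Set (Cn n)} {ρ : Cn n → ℝ} {p : Cn n}

theorem contDiffAt (hρ : IsDefiningFunctionOn 2 Ω V ρ) {z : Cn n} (hz : z ∈ V) :
    ContDiffAt ℝ 2 ρ z := hρ.contDiffOn.contDiffAt (hρ.isBoundaryNhd.1.mem_nhds hz)

theorem eq_zero (hρ : IsDefiningFunctionOn 2 Ω V ρ) (hp : p ∈ frontier Ω) : ρ p = 0 :=
  (hρ.zero_iff p (hρ.isBoundaryNhd.2 hp)).2 hp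

theorem fderiv_tangent (hρ : IsDefiningFunctionOn 2 Ω V ρ) (h : IsCollar k Ω W) (hk : 3 ≤ k)
    (hp : p ∈ frontier Ω) {v : Cn n} (hv : inner ℝ (nrm Ω p) v = 0) : fderiv ℝ ρ p v = 0 :=
  h.fderiv_eq_zero_of_tangent hk hp (hasFDerivAt_of_contDiffAt (hρ.contDiffAt (hρ.isBoundaryNhd.2 hp)))
    (fun _ hx => hρ.eq_zero hx) hv

theorem fderiv_eq (hρ : IsDefiningFunctionOn 2 Ω V ρ) (h : IsCollar k Ω W) (hk : 3 ≤ k)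
    (hp : p ∈ frontier Ω) (v : Cn n) :
    fderiv ℝ ρ p v = fderiv ℝ ρ p (nrm Ω p) * inner ℝ (nrm Ω p) v := by
  have ht : inner ℝ (nrm Ω p) (v - inner ℝ (nrm Ω p) v • nrm Ω p) = 0 := by
    rw [inner_sub_right, inner_smul_right, h.inner_nrm_self (h.subset hp), mul_one, sub_self]
  have := hρ.fderiv_tangent h hk hp ht
  rw [map_sub, map_smul, smul_eq_mul, sub_eq_zero] at this
  rw [this, mul_comm]

/-- On the boundary Dρ(v) = Dρ(N)⟨N,v⟩. Differentiate this along the tangential u: the derivative of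
the factor Dρ(N) is killed by ⟨N,v⟩ = 0, leaving Dρ(N)⟨Su,v⟩. -/
theorem hess_tangent (hρ : IsDefiningFunctionOn 2 Ω V ρ) (h : IsCollar k Ω W) (hk : 3 ≤ k)
    (hp : p ∈ frontier Ω) {u v : Cn n} (hu : inner ℝ (nrm Ω p) u = 0)
    (hv : inner ℝ (nrm Ω p) v = 0) :
    hess ρ p u v = fderiv ℝ ρ p (nrm Ω p) * inner ℝ (shape Ω p u) v := by
  have hD := (hρ.contDiffAt (hρ.isBoundaryNhd.2 hp)).hasFDerivAt_fderiv
  have hg := h.hasFDerivAt_nrm hk (h.subset hp)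
  have h1 := (hD.clm_apply (hasFDerivAt_const v p)).sub
    ((hD.clm_apply hg).mul (hg.inner ℝ (hasFDerivAt_const v p)))
  have h2 := h.fderiv_eq_zero_of_tangent hk hp h1 (fun x hx => sub_eq_zero.2 (hρ.fderiv_eq h hk hx v)) hu
  simp [fderivInnerCLM_apply, hv] at h2
  rw [hess]
  linarith

end IsDefiningFunctionOn

/-! ### Limits along inward normals -/

section Limits

variable {ι : Type*} {l : Filter ι} {t : ι → ℝ} {p : ι → Cn n} {p₀ : Cn n}

theorem tendsto_clm_apply {E G : Type*} [NormedAddCommGroup E] [NormedSpace ℝ E]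
    [NormedAddCommGroup G] [NormedSpace ℝ G] {A : ι → E →L[ℝ] G} {A₀ : E →L[ℝ] G} {v : ι → E}
    {v₀ : E} (hA : Tendsto A l (𝓝 A₀)) (hv : Tendsto v l (𝓝 v₀)) :
    Tendsto (fun i => A i (v i)) l (𝓝 (A₀ v₀)) :=
  (isBoundedBilinearMap_apply.continuous.tendsto (A₀, v₀)).comp (hA.prodMk_nhds hv)

theorem tendsto_inward (ht : Tendsto t l (𝓝[>] 0)) (hp : Tendsto p l (𝓝 p₀)) {g : ι → Cn n}
    {g₀ : Cn n} (hg : Tendsto g l (𝓝 g₀)) : Tendsto (fun i => p i - t i • g i) l (𝓝 p₀) := by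
  have := hp.sub ((ht.mono_right nhdsWithin_le_nhds).smul hg)
  simpa using this

/-- Strict differentiability at p₀ is needed because the base points p i move as well; this makes
all later limits locally uniform along the boundary. -/
theorem tendsto_inv_smul_sub {G : Type*} [NormedAddCommGroup G] [NormedSpace ℝ G] {F : Cn n → G}
    {F' : Cn n →L[ℝ] G} (hF : HasStrictFDerivAt F F' p₀) (ht : Tendsto t l (𝓝[>] 0))
    (hp : Tendsto p l (𝓝 p₀)) {g : ι → Cn n} {g₀ : Cn n} (hg : Tendsto g l (𝓝 g₀)) :
    Tendsto (fun i => (t i)⁻¹ • (F (p i - t i • g i) - F (p i))) l (𝓝 (-F' g₀)) := by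
  have h1 := hF.isLittleO.comp_tendsto ((tendsto_inward ht hp hg).prodMk_nhds hp)
  have h2 : (fun i => F (p i - t i • g i) - F (p i) + t i • F' (g i)) =o[l] fun i => t i • g i := by
    refine (h1.congr (fun i => ?_) (fun i => ?_)).trans_isBigO
      ((Asymptotics.isBigO_refl (fun i => t i • g i) l).neg_left)
    · simp
    · simp
  have h3 : (fun i => t i • g i) =O[l] t := by
    have := (Asymptotics.isBigO_refl t l).smul (hg.isBigO_one ℝ)
    simpa using this
  have h4 := (h2.trans_isBigO h3)
  have hpos : ∀ᶠ i in l, 0 < t i := ht.eventually self_mem_nhdsWithin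
  have h5 : Tendsto (fun i => (t i)⁻¹ • (F (p i - t i • g i) - F (p i) + t i • F' (g i))) l (𝓝 0) := by
    exact h4.tendsto_inv_smul_nhds_zero
  have h6 : Tendsto (fun i => F' (g i)) l (𝓝 (F' g₀)) := (F'.continuous.tendsto g₀).comp hg
  have h7 := h5.sub h6
  rw [zero_sub] at h7
  refine h7.congr' ?_
  filter_upwards [hpos] with i hi
  rw [smul_add, smul_smul, inv_mul_cancel₀ hi.ne', one_smul, add_sub_cancel_right]

variable {k : ℕ∞} {Ω V W : Set (Cn n)} {ρ : Cn n → ℝ}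

/-- The point obtained from `x` by moving a distance `t` inwards. -/
def inward (Ω : Set (Cn n)) (t : ℝ) (x : Cn n) : Cn n := x - t • nrm Ω x

/-- A family of boundary points approaching `p₀`, with positive numbers tending to zero. -/
structure InwardFamily (Ω : Set (Cn n)) (p₀ : Cn n) (l : Filter ι) (t : ι → ℝ) (p : ι → Cn n) :
    Prop where
  mem₀ : p₀ ∈ frontier Ω
  lim_t : Tendsto t l (𝓝[>] 0)
  lim_p : Tendsto p l (𝓝 p₀)
  mem : ∀ᶠ i in l, p i ∈ frontier Ω

namespace InwardFamily

theorem pos (f : InwardFamily Ω p₀ l t p) : ∀ᶠ i in l, 0 < t i :=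
  f.lim_t.eventually self_mem_nhdsWithin

theorem lim_t₀ (f : InwardFamily Ω p₀ l t p) : Tendsto t l (𝓝 0) :=
  f.lim_t.mono_right nhdsWithin_le_nhds

theorem lim_nrm (f : InwardFamily Ω p₀ l t p) (h : IsCollar k Ω W) (hk : 3 ≤ k) :
    Tendsto (fun i => nrm Ω (p i)) l (𝓝 (nrm Ω p₀)) :=
  (h.continuousAt_nrm hk (h.subset f.mem₀)).tendsto.comp f.lim_p

theorem lim_shape (f : InwardFamily Ω p₀ l t p) (h : IsCollar k Ω W) (hk : 3 ≤ k) :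
    Tendsto (fun i => shape Ω (p i)) l (𝓝 (shape Ω p₀)) :=
  (h.continuousAt_shape hk (h.subset f.mem₀)).tendsto.comp f.lim_p

theorem lim_inward (f : InwardFamily Ω p₀ l t p) (h : IsCollar k Ω W) (hk : 3 ≤ k) :
    Tendsto (fun i => inward Ω (t i) (p i)) l (𝓝 p₀) :=
  tendsto_inward f.lim_t f.lim_p (f.lim_nrm h hk)

theorem eventually_mem (f : InwardFamily Ω p₀ l t p) (h : IsCollar k Ω W) (hk : 3 ≤ k) :
    ∀ᶠ i in l, inward Ω (t i) (p i) ∈ Ω := by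
  have hp := h.subset f.mem₀
  have hs : HasStrictFDerivAt (signedDist Ω) (innerSL ℝ (nrm Ω p₀)) p₀ := by
    rw [← (h.hasFDerivAt hk hp).fderiv]
    exact (h.contDiffAt_three hk hp).hasStrictFDerivAt (by norm_num)
  have h1 := tendsto_inv_smul_sub hs f.lim_t f.lim_p (f.lim_nrm h hk)
  have h2 : -(innerSL ℝ (nrm Ω p₀)) (nrm Ω p₀) < 0 := by
    rw [innerSL_apply_apply, h.inner_nrm_self hp]; norm_num
  filter_upwards [h1.eventually_lt_const h2, f.pos, f.mem] with i hi hti hpi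
  rw [signedDist_frontier hpi, sub_zero, smul_eq_mul] at hi
  apply mem_of_signedDist_neg
  by_contra hge
  exact absurd hi (not_lt.2 (mul_nonneg (inv_pos.2 hti).le (not_lt.1 hge)))

theorem eventually_mem_nhd (f : InwardFamily Ω p₀ l t p) (h : IsCollar k Ω W) (hk : 3 ≤ k)
    {U : Set (Cn n)} (hU : IsBoundaryNhd Ω U) : ∀ᶠ i in l, inward Ω (t i) (p i) ∈ U :=
  (f.lim_inward h hk).eventually (hU.1.mem_nhds (hU.2 f.mem₀))

theorem eventually_neg (f : InwardFamily Ω p₀ l t p) (h : IsCollar k Ω W) (hk : 3 ≤ k)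
    (hρ : IsDefiningFunctionOn 2 Ω V ρ) :
    ∀ᶠ i in l, ContDiffAt ℝ 2 ρ (inward Ω (t i) (p i)) ∧ ρ (inward Ω (t i) (p i)) < 0 := by
  filter_upwards [f.eventually_mem h hk, f.eventually_mem_nhd h hk hρ.isBoundaryNhd] with i hi hiV
  exact ⟨hρ.contDiffAt hiV, (hρ.neg_iff _ hiV).2 hi⟩

theorem lim_rho (f : InwardFamily Ω p₀ l t p) (h : IsCollar k Ω W) (hk : 3 ≤ k)
    (hρ : IsDefiningFunctionOn 2 Ω V ρ) :
    Tendsto (fun i => (t i)⁻¹ * (-ρ (inward Ω (t i) (p i)))) l (𝓝 (fderiv ℝ ρ p₀ (nrm Ω p₀))) := by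
  have hs := (hρ.contDiffAt (hρ.isBoundaryNhd.2 f.mem₀)).hasStrictFDerivAt (by norm_num)
  have h1 := (tendsto_inv_smul_sub hs f.lim_t f.lim_p (f.lim_nrm h hk)).neg
  rw [neg_neg] at h1
  refine h1.congr' ?_
  filter_upwards [f.mem] with i hi
  rw [hρ.eq_zero hi, sub_zero, smul_eq_mul, mul_neg]
  rfl

end InwardFamily

/-- The normal derivative is the limit of -ρ/t ≥ 0 along the inward normal. Were it zero, dρ would
vanish, since it already kills the tangent vectors. -/
theorem IsDefiningFunctionOn.fderiv_nrm_pos (hρ : IsDefiningFunctionOn 2 Ω V ρ)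
    (h : IsCollar k Ω W) (hk : 3 ≤ k) (hp : p₀ ∈ frontier Ω) : 0 < fderiv ℝ ρ p₀ (nrm Ω p₀) := by
  have f : InwardFamily Ω p₀ (𝓝[>] (0 : ℝ)) id (fun _ => p₀) :=
    ⟨hp, tendsto_id, tendsto_const_nhds, Eventually.of_forall fun _ => hp⟩
  have h0 : 0 ≤ fderiv ℝ ρ p₀ (nrm Ω p₀) := by
    refine ge_of_tendsto (f.lim_rho h hk hρ) ?_
    filter_upwards [f.eventually_neg h hk hρ, f.pos] with i hi hti
    exact mul_nonneg (inv_pos.2 hti).le (by linarith [hi.2])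
  refine lt_of_le_of_ne h0 fun heq => hρ.fderiv_ne_zero p₀ hp ?_
  ext v
  rw [hρ.fderiv_eq h hk hp, ← heq, zero_mul]
  rfl

namespace InwardFamily

variable {u v : ι → Cn n} {u₀ v₀ : Cn n}

/-- The limit of `D(-log(-ρ))` along tangent vectors. -/
def tangentSlope (Ω : Set (Cn n)) (ρ : Cn n → ℝ) (p u : Cn n) : ℝ :=
  -hess ρ p (nrm Ω p) u / fderiv ℝ ρ p (nrm Ω p)

/-- Dρ(u) vanishes at the boundary point itself, so at depth t it is O(t), the order of -ρ; the
quotient has a finite limit. In a general direction Dψ is only O(1/t), as the next lemma makes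
precise. -/
theorem lim_fderiv_tangent (f : InwardFamily Ω p₀ l t p) (h : IsCollar k Ω W) (hk : 3 ≤ k)
    (hρ : IsDefiningFunctionOn 2 Ω V ρ) (hu : Tendsto u l (𝓝 u₀))
    (hut : ∀ᶠ i in l, inner ℝ (nrm Ω (p i)) (u i) = 0) :
    Tendsto (fun i => fderiv ℝ (fun w => -Real.log (-ρ w)) (inward Ω (t i) (p i)) (u i)) l
      (𝓝 (tangentSlope Ω ρ p₀ u₀)) := by
  have hC := hρ.contDiffAt (hρ.isBoundaryNhd.2 f.mem₀)
  have hs : HasStrictFDerivAt (fderiv ℝ ρ) (fderiv ℝ (fderiv ℝ ρ) p₀) p₀ :=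
    (hC.fderiv_right (m := 1) (by norm_num)).hasStrictFDerivAt (by norm_num)
  have h1 := tendsto_clm_apply (tendsto_inv_smul_sub hs f.lim_t f.lim_p (f.lim_nrm h hk)) hu
  have h2 := h1.div (f.lim_rho h hk hρ) (hρ.fderiv_nrm_pos h hk f.mem₀).ne'
  refine h2.congr' ?_
  filter_upwards [f.eventually_neg h hk hρ, f.pos, f.mem, hut] with i hi hti hpi hui
  rw [fderiv_neg_log_neg (hi.1.differentiableAt (by norm_num)) hi.2, Pi.div_apply, smul_apply, sub_apply,
    hρ.fderiv_tangent h hk hpi hui, sub_zero, smul_eq_mul,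
    mul_div_mul_left _ _ (inv_pos.2 hti).ne']
  rfl

theorem lim_mul_fderiv (f : InwardFamily Ω p₀ l t p) (h : IsCollar k Ω W) (hk : 3 ≤ k)
    (hρ : IsDefiningFunctionOn 2 Ω V ρ) (hv : Tendsto v l (𝓝 v₀)) :
    Tendsto (fun i => t i * fderiv ℝ (fun w => -Real.log (-ρ w)) (inward Ω (t i) (p i)) (v i)) l
      (𝓝 (inner ℝ (nrm Ω p₀) v₀)) := by
  have hC := hρ.contDiffAt (hρ.isBoundaryNhd.2 f.mem₀)
  have hpos := hρ.fderiv_nrm_pos h hk f.mem₀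
  have h1 := tendsto_clm_apply ((continuousAt_fderiv hC).tendsto.comp (f.lim_inward h hk)) hv
  have h2 := h1.div (f.lim_rho h hk hρ) hpos.ne'
  rw [hρ.fderiv_eq h hk f.mem₀, mul_div_cancel_left₀ _ hpos.ne'] at h2
  refine h2.congr' ?_
  filter_upwards [f.eventually_neg h hk hρ, f.pos] with i hi hti
  rw [fderiv_neg_log_neg (hi.1.differentiableAt (by norm_num)) hi.2]
  have := hi.2.ne
  simp only [Function.comp_apply, Pi.div_apply]
  field_simp

theorem lim_hess (f : InwardFamily Ω p₀ l t p) (h : IsCollar k Ω W) (hk : 3 ≤ k)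
    (hρ : IsDefiningFunctionOn 2 Ω V ρ) (hu : Tendsto u l (𝓝 u₀)) (hv : Tendsto v l (𝓝 v₀)) :
    Tendsto (fun i => hess ρ (inward Ω (t i) (p i)) (u i) (v i)) l (𝓝 (hess ρ p₀ u₀ v₀)) :=
  tendsto_clm_apply (tendsto_clm_apply ((continuousAt_hess
    (hρ.contDiffAt (hρ.isBoundaryNhd.2 f.mem₀))).tendsto.comp (f.lim_inward h hk)) hu) hv

/-- D²ψ = D²ρ/(-ρ) + Dψ⊗Dψ, arranged so that -ρ appears only as -ρ/t, which has a positive limit. It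
follows that D²ψ is O(1/t) when one argument is tangential and O(1/t²) in general. -/
theorem hess_log_eq (f : InwardFamily Ω p₀ l t p) (h : IsCollar k Ω W) (hk : 3 ≤ k)
    (hρ : IsDefiningFunctionOn 2 Ω V ρ) :
    ∀ᶠ i in l, 0 < t i ∧ ∀ u v,
      hess (fun w => -Real.log (-ρ w)) (inward Ω (t i) (p i)) u v
        = (t i)⁻¹ * (hess ρ (inward Ω (t i) (p i)) u v / ((t i)⁻¹ * (-ρ (inward Ω (t i) (p i)))))
          + fderiv ℝ (fun w => -Real.log (-ρ w)) (inward Ω (t i) (p i)) u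
            * fderiv ℝ (fun w => -Real.log (-ρ w)) (inward Ω (t i) (p i)) v := by
  filter_upwards [f.eventually_neg h hk hρ, f.pos] with i hi hti
  refine ⟨hti, fun u v => ?_⟩
  rw [hess_neg_log_neg hi.1 hi.2, fderiv_neg_log_neg (hi.1.differentiableAt (by norm_num)) hi.2,
    fderiv_neg_log_neg (hi.1.differentiableAt (by norm_num)) hi.2]
  have := hi.2.ne
  field_simp

theorem lim_mul_hess (f : InwardFamily Ω p₀ l t p) (h : IsCollar k Ω W) (hk : 3 ≤ k)
    (hρ : IsDefiningFunctionOn 2 Ω V ρ) (hu : Tendsto u l (𝓝 u₀)) (hv : Tendsto v l (𝓝 v₀))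
    (hut : ∀ᶠ i in l, inner ℝ (nrm Ω (p i)) (u i) = 0) :
    Tendsto (fun i => t i *
        hess (fun w => -Real.log (-ρ w)) (inward Ω (t i) (p i)) (u i) (v i)) l
      (𝓝 (hess ρ p₀ u₀ v₀ / fderiv ℝ ρ p₀ (nrm Ω p₀)
        + tangentSlope Ω ρ p₀ u₀ * inner ℝ (nrm Ω p₀) v₀)) := by
  have h1 := (f.lim_hess h hk hρ hu hv).div (f.lim_rho h hk hρ) (hρ.fderiv_nrm_pos h hk f.mem₀).ne'
  refine (h1.add ((f.lim_fderiv_tangent h hk hρ hu hut).mul (f.lim_mul_fderiv h hk hρ hv))).congr' ?_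
  filter_upwards [f.hess_log_eq h hk hρ] with i hi
  rw [hi.2, mul_add, mul_inv_cancel_left₀ hi.1.ne', Pi.div_apply]
  ring

theorem lim_sq_mul_hess (f : InwardFamily Ω p₀ l t p) (h : IsCollar k Ω W) (hk : 3 ≤ k)
    (hρ : IsDefiningFunctionOn 2 Ω V ρ) (hu : Tendsto u l (𝓝 u₀)) (hv : Tendsto v l (𝓝 v₀)) :
    Tendsto (fun i => t i ^ 2 *
        hess (fun w => -Real.log (-ρ w)) (inward Ω (t i) (p i)) (u i) (v i)) l
      (𝓝 (inner ℝ (nrm Ω p₀) u₀ * inner ℝ (nrm Ω p₀) v₀)) := by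
  have h1 := (f.lim_hess h hk hρ hu hv).div (f.lim_rho h hk hρ) (hρ.fderiv_nrm_pos h hk f.mem₀).ne'
  have h2 := (f.lim_t₀.mul h1).add ((f.lim_mul_fderiv h hk hρ hu).mul (f.lim_mul_fderiv h hk hρ hv))
  rw [zero_mul, zero_add] at h2
  refine h2.congr' ?_
  filter_upwards [f.hess_log_eq h hk hρ] with i hi
  rw [hi.2]
  rw [mul_add, Pi.div_apply, sq, mul_assoc (t i) (t i) ((t i)⁻¹ * _), mul_inv_cancel_left₀ hi.1.ne']
  ring

end InwardFamily

end Limits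

end

end DFIndex

/-! ### The boundary inequality for inward translates. -/

namespace DFIndex

noncomputable section

variable {n : ℕ}

theorem realLevi_add_smul {f : Cn n → ℝ} {z : Cn n} (hf : ContDiffAt ℝ 2 f z) (τ w : Cn n) (t : ℝ) :
    realLevi f z (τ + t • w) = realLevi f z τ
      + 2 * (t * hess f z τ w + t * hess f z (Complex.I • τ) (Complex.I • w))
      + (t ^ 2 * hess f z w w + t ^ 2 * hess f z (Complex.I • w) (Complex.I • w)) := by
  have h1 := hess_quadratic hf τ w 1 t
  have h2 := hess_quadratic hf (Complex.I • τ) (Complex.I • w) 1 t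
  rw [one_smul] at h1 h2
  rw [realLevi, smul_add, smul_comm Complex.I t w, h1, h2, realLevi]
  ring

/-- First derivative of a function composed with the inward translation. -/
theorem IsCollar.fderiv_comp_inward {k : ℕ∞} {Ω W : Set (Cn n)} (h : IsCollar k Ω W) (hk : 3 ≤ k)
    {x : Cn n} (hx : x ∈ W) {t : ℝ} {f : Cn n → ℝ} (hf : DifferentiableAt ℝ f (inward Ω t x)) (v : Cn n) :
    fderiv ℝ (fun y => f (inward Ω t y)) x v
      = fderiv ℝ f (inward Ω t x) (v - t • shape Ω x v) := by
  have h1 : HasFDerivAt (inward Ω t) (ContinuousLinearMap.id ℝ (Cn n) - t • shape Ω x) x :=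
    (hasFDerivAt_id x).sub ((h.hasFDerivAt_nrm hk hx).const_smul t)
  have h2 : HasFDerivAt (fun y => f (inward Ω t y)) _ x :=
    HasFDerivAt.comp (g := f) x hf.hasFDerivAt h1
  rw [h2.fderiv]
  rfl

theorem IsCollar.contDiffAt_inward {k : ℕ∞} {Ω W : Set (Cn n)} (h : IsCollar k Ω W) (hk : 3 ≤ k)
    {x : Cn n} (hx : x ∈ W) (t : ℝ) : ContDiffAt ℝ 2 (inward Ω t) x :=
  contDiffAt_id.sub ((h.contDiffAt_nrm hk hx).const_smul t)

/-- Second derivative of a function composed with the inward translation. -/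
theorem IsCollar.hess_comp_inward {k : ℕ∞} {Ω W : Set (Cn n)} (h : IsCollar k Ω W) (hk : 3 ≤ k)
    {x : Cn n} (hx : x ∈ W) {t : ℝ} {f : Cn n → ℝ} (hf : ContDiffAt ℝ 2 f (inward Ω t x)) (u : Cn n) :
    hess (fun y => f (inward Ω t y)) x u u
      = hess f (inward Ω t x) (u - t • shape Ω x u) (u - t • shape Ω x u)
        - t * fderiv ℝ f (inward Ω t x) (fderiv ℝ (shape Ω) x u u) := by
  have hcont : ContinuousAt (inward Ω t) x := (h.contDiffAt_inward hk hx t).continuousAt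
  have h1 : HasFDerivAt (inward Ω t) (ContinuousLinearMap.id ℝ (Cn n) - t • shape Ω x) x :=
    (hasFDerivAt_id x).sub ((h.hasFDerivAt_nrm hk hx).const_smul t)
  have hS : HasFDerivAt (shape Ω) (fderiv ℝ (shape Ω) x) x :=
    ((h.contDiffAt_shape hk hx).differentiableAt (by norm_num)).hasFDerivAt
  have hC : ContDiffAt ℝ 2 (fun y => f (inward Ω t y)) x := hf.comp x (h.contDiffAt_inward hk hx t)
  have h2 : HasFDerivAt (fun y => fderiv ℝ (fun y => f (inward Ω t y)) y u)
      ((fderiv ℝ (fderiv ℝ (fun y => f (inward Ω t y))) x).flip u) x := by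
    refine (hC.hasFDerivAt_fderiv.clm_apply (hasFDerivAt_const u x)).congr_fderiv ?_
    ext; simp
  have hev : (fun y => fderiv ℝ (fun y => f (inward Ω t y)) y u)
      =ᶠ[𝓝 x] fun y => fderiv ℝ f (inward Ω t y) (u - t • shape Ω y u) := by
    filter_upwards [h.isOpen.mem_nhds hx, hcont.eventually hf.eventually_differentiableAt]
      with y hy hfy
    exact h.fderiv_comp_inward hk hy hfy u
  have h3 : HasFDerivAt (fun y => fderiv ℝ f (inward Ω t y)) _ x :=
    HasFDerivAt.comp (g := fderiv ℝ f) x hf.hasFDerivAt_fderiv h1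
  have h4 : HasFDerivAt (fun y => u - t • shape Ω y u) (-(t • (fderiv ℝ (shape Ω) x).flip u)) x := by
    have := ((hS.clm_apply (hasFDerivAt_const u x)).const_smul t).const_sub u
    refine this.congr_fderiv ?_
    ext; simp
  have h5 := (h3.clm_apply h4).congr_of_eventuallyEq hev
  have h6 := congrArg (fun L : Cn n →L[ℝ] ℝ => L u) (h2.unique h5)
  simp only [ContinuousLinearMap.flip_apply, add_apply, ContinuousLinearMap.comp_apply, neg_apply,
    smul_apply, sub_apply, ContinuousLinearMap.id_apply, map_neg, map_smul, smul_eq_mul] at h6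
  rw [hess, h6, hess]
  ring

/-- Differentiate ⟨N, Su⟩ = 0 in the direction u. -/
theorem IsCollar.inner_nrm_fderiv_shape {k : ℕ∞} {Ω W : Set (Cn n)} (h : IsCollar k Ω W) (hk : 3 ≤ k)
    {x : Cn n} (hx : x ∈ W) (u : Cn n) :
    inner ℝ (nrm Ω x) (fderiv ℝ (shape Ω) x u u) = -‖shape Ω x u‖ ^ 2 := by
  have hS : HasFDerivAt (shape Ω) (fderiv ℝ (shape Ω) x) x :=
    ((h.contDiffAt_shape hk hx).differentiableAt (by norm_num)).hasFDerivAt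
  have h1 := (h.hasFDerivAt_nrm hk hx).inner ℝ (hS.clm_apply (hasFDerivAt_const u x))
  have h2 : HasFDerivAt (fun y => inner ℝ (nrm Ω y) (shape Ω y u)) (0 : Cn n →L[ℝ] ℝ) x := by
    refine (hasFDerivAt_const (0 : ℝ) x).congr_of_eventuallyEq ?_
    filter_upwards [h.isOpen.mem_nhds hx] with y hy
    exact h.inner_nrm_shape hk hy u
  have h3 := congrArg (fun L : Cn n →L[ℝ] ℝ => L u) (h1.unique h2)
  simp [fderivInnerCLM_apply] at h3
  linarith

namespace InwardFamily

variable {ι : Type*} {l : Filter ι} {t : ι → ℝ} {p : ι → Cn n} {p₀ : Cn n}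
  {k : ℕ∞} {Ω V W : Set (Cn n)} {ρ : Cn n → ℝ} {u τ : ι → Cn n} {u₀ τ₀ : Cn n}

theorem lim_tangent [l.NeBot] (f : InwardFamily Ω p₀ l t p) (h : IsCollar k Ω W) (hk : 3 ≤ k)
    (hu : Tendsto u l (𝓝 u₀)) (hut : ∀ᶠ i in l, inner ℝ (nrm Ω (p i)) (u i) = 0) :
    inner ℝ (nrm Ω p₀) u₀ = 0 :=
  tendsto_nhds_unique ((f.lim_nrm h hk).inner hu) (tendsto_const_nhds.congr' (hut.mono fun _ h => h.symm))

/-- A lower bound for the Levi form of `-log(-ρ)` along tangent vectors, if `-(-ρ)^η` is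
plurisubharmonic. -/
theorem exists_lower_bound [l.NeBot] (f : InwardFamily Ω p₀ l t p) (h : IsCollar k Ω W) (hk : 3 ≤ k)
    (hρ : IsDefiningFunctionOn 2 Ω V ρ) {U : Set (Cn n)} (hU : IsBoundaryNhd Ω U) {η : ℝ} (hη : η < 1)
    (hpsh : ∀ z ∈ U ∩ Ω, ∀ X, η * (fderiv ℝ (fun w => -Real.log (-ρ w)) z X ^ 2
      + fderiv ℝ (fun w => -Real.log (-ρ w)) z (Complex.I • X) ^ 2)
        ≤ realLevi (fun w => -Real.log (-ρ w)) z X)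
    (hτ : Tendsto τ l (𝓝 τ₀)) (hτ1 : ∀ᶠ i in l, inner ℝ (nrm Ω (p i)) (τ i) = 0)
    (hτ2 : ∀ᶠ i in l, inner ℝ (nrm Ω (p i)) (Complex.I • τ i) = 0) :
    ∃ L : ι → ℝ, Tendsto L l (𝓝 (twistRe Ω p₀ τ₀ ^ 2 + twistIm Ω p₀ τ₀ ^ 2
        + η / (1 - η) * ((tangentSlope Ω ρ p₀ τ₀ - twistRe Ω p₀ τ₀) ^ 2
          + (tangentSlope Ω ρ p₀ (Complex.I • τ₀) - twistIm Ω p₀ τ₀) ^ 2))) ∧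
      ∀ᶠ i in l, L i ≤ realLevi (fun w => -Real.log (-ρ w)) (inward Ω (t i) (p i)) (τ i) := by
  have hpW := h.subset f.mem₀
  set ψ : Cn n → ℝ := fun w => -Real.log (-ρ w) with hψ
  set g := nrm Ω p₀ with hg
  set a₁ := twistRe Ω p₀ τ₀ with ha1
  set a₂ := twistIm Ω p₀ τ₀ with ha2
  set x₁ := tangentSlope Ω ρ p₀ τ₀ with hx1
  set x₂ := tangentSlope Ω ρ p₀ (Complex.I • τ₀) with hx2
  -- The values at which the last square of `complete_square` vanishes, so that testing on τ + tw
  -- loses nothing.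
  set d₁ := (η * x₁ - a₁) / (1 - η) with hd1
  set d₂ := (η * x₂ - a₂) / (1 - η) with hd2
  have hIτ := hτ.const_smul Complex.I
  have h01 : inner ℝ g τ₀ = 0 := f.lim_tangent h hk hτ hτ1
  have h02 : inner ℝ g (Complex.I • τ₀) = 0 := f.lim_tangent h hk hIτ hτ2
  have hgg : inner ℝ g g = 1 := h.inner_nrm_self hpW
  have hgI : inner ℝ g (Complex.I • g) = 0 := by
    rw [real_inner_comm]; exact real_inner_I_smul_self g
  set w : ι → Cn n := fun i => d₁ • nrm Ω (p i) - d₂ • Complex.I • nrm Ω (p i) with hw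
  set w₀ : Cn n := d₁ • g - d₂ • Complex.I • g with hw0
  have hIw0 : Complex.I • w₀ = d₁ • Complex.I • g + d₂ • g := by
    rw [hw0, smul_sub, smul_comm Complex.I d₁, smul_comm Complex.I d₂ (Complex.I • g),
      I_smul_I_smul, smul_neg, sub_neg_eq_add]
  have hgl := f.lim_nrm h hk
  have hwl : Tendsto w l (𝓝 w₀) := (hgl.const_smul d₁).sub ((hgl.const_smul Complex.I).const_smul d₂)
  have hIwl := hwl.const_smul Complex.I
  have hgw : inner ℝ g w₀ = d₁ := by
    rw [hw0, inner_sub_right, inner_smul_right, inner_smul_right, hgg, hgI]; ring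
  have hgIw : inner ℝ g (Complex.I • w₀) = d₂ := by
    rw [hIw0, inner_add_right, inner_smul_right, inner_smul_right, hgg, hgI]; ring
  set lam := fderiv ℝ ρ p₀ g with hlam
  have hlam0 : 0 < lam := hρ.fderiv_nrm_pos h hk f.mem₀
  have hCρ : ContDiffAt ℝ 2 ρ p₀ := hρ.contDiffAt (hρ.isBoundaryNhd.2 f.mem₀)
  have hsl : ∀ v, hess ρ p₀ v g / lam = -tangentSlope Ω ρ p₀ v := by
    intro v
    rw [tangentSlope, hess_symm hCρ v g, ← hg, ← hlam, neg_div, neg_neg]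
  -- The part of D²ρ(τ,w) along N cancels the product of slopes, since D²ρ(τ,N)/λ = -x₁. The part
  -- along iN is tangential and gives the twist.
  have hc1 : hess ρ p₀ τ₀ w₀ / lam + x₁ * d₁ = d₂ * a₂ := by
    have hb : hess ρ p₀ τ₀ w₀ = d₁ * hess ρ p₀ τ₀ g - d₂ * hess ρ p₀ τ₀ (Complex.I • g) := by
      simp only [hw0, hess, map_sub, map_smul, smul_eq_mul]
    have he : hess ρ p₀ τ₀ (Complex.I • g) / lam = -a₂ := by
      rw [hρ.hess_tangent h hk f.mem₀ h01 hgI, ← hg, ← hlam, mul_div_cancel_left₀ _ hlam0.ne', ha2,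
        twistIm, neg_neg, real_inner_comm]
    rw [hb, sub_div, mul_div_assoc, mul_div_assoc, hsl, he, ← hx1]
    ring
  have hc2 : hess ρ p₀ (Complex.I • τ₀) (Complex.I • w₀) / lam + x₂ * d₂ = d₁ * a₁ := by
    have hb : hess ρ p₀ (Complex.I • τ₀) (Complex.I • w₀)
        = d₁ * hess ρ p₀ (Complex.I • τ₀) (Complex.I • g) + d₂ * hess ρ p₀ (Complex.I • τ₀) g := by
      rw [hIw0]
      simp only [hess, map_add, map_smul, smul_eq_mul]
    have he : hess ρ p₀ (Complex.I • τ₀) (Complex.I • g) / lam = a₁ := by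
      rw [hρ.hess_tangent h hk f.mem₀ h02 hgI, ← hg, ← hlam, mul_div_cancel_left₀ _ hlam0.ne', ha1,
        twistRe, real_inner_comm]
    rw [hb, add_div, mul_div_assoc, mul_div_assoc, hsl, he, ← hx2]
    ring
  set z : ι → Cn n := fun i => inward Ω (t i) (p i) with hz
  have l1 := f.lim_fderiv_tangent h hk hρ hτ hτ1
  have l2 := f.lim_fderiv_tangent h hk hρ hIτ hτ2
  have l3 := f.lim_mul_fderiv h hk hρ hwl
  have l4 := f.lim_mul_fderiv h hk hρ hIwl
  have l5 := f.lim_mul_hess h hk hρ hτ hwl hτ1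
  have l6 := f.lim_mul_hess h hk hρ hIτ hIwl hτ2
  have l7 := f.lim_sq_mul_hess h hk hρ hwl hwl
  have l8 := f.lim_sq_mul_hess h hk hρ hIwl hIwl
  rw [← hg, hgw] at l3 l5 l7
  rw [← hg, hgIw] at l4 l6 l8
  rw [← hlam, ← hx1, hc1] at l5
  rw [← hlam, ← hx2, hc2] at l6
  have hlim := (((((l1.add l3).pow 2).add ((l2.add l4).pow 2)).const_mul η).sub
    ((l5.add l6).const_mul 2)).sub (l7.add l8)
  -- Plurisubharmonicity at τ + tw, solved for B_ψ(τ). Only a lower bound with a limit is possible: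
  -- B_ψ(τ) itself may tend to infinity where the Levi form of the boundary is positive.
  refine ⟨fun i => η * ((fderiv ℝ ψ (z i) (τ i) + t i * fderiv ℝ ψ (z i) (w i)) ^ 2
      + (fderiv ℝ ψ (z i) (Complex.I • τ i) + t i * fderiv ℝ ψ (z i) (Complex.I • w i)) ^ 2)
      - 2 * (t i * hess ψ (z i) (τ i) (w i)
        + t i * hess ψ (z i) (Complex.I • τ i) (Complex.I • w i))
      - (t i ^ 2 * hess ψ (z i) (w i) (w i)
        + t i ^ 2 * hess ψ (z i) (Complex.I • w i) (Complex.I • w i)), ?_, ?_⟩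
  · have heq : η * ((x₁ + d₁) ^ 2 + (x₂ + d₂) ^ 2) - 2 * (d₂ * a₂ + d₁ * a₁) - (d₁ * d₁ + d₂ * d₂)
        = a₁ ^ 2 + a₂ ^ 2 + η / (1 - η) * ((x₁ - a₁) ^ 2 + (x₂ - a₂) ^ 2) := by
      have e1 := complete_square hη a₁ x₁ d₁
      have e2 := complete_square hη a₂ x₂ d₂
      rw [← hd1, sub_self] at e1
      rw [← hd2, sub_self] at e2
      linarith
    rw [← heq]
    exact hlim
  · filter_upwards [f.eventually_mem h hk, f.eventually_mem_nhd h hk hU, f.eventually_neg h hk hρ]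
      with i hiΩ hiU hneg
    have hC := contDiffAt_neg_log_neg hneg.1 hneg.2
    have hX := hpsh (z i) ⟨hiU, hiΩ⟩ (τ i + t i • w i)
    rw [realLevi_add_smul hC, smul_add, smul_comm Complex.I (t i), map_add, map_add,
      map_smul (fderiv ℝ ψ (z i)) (t i) (w i),
      map_smul (fderiv ℝ ψ (z i)) (t i) (Complex.I • w i), smul_eq_mul, smul_eq_mul] at hX
    linarith

/-- Comparison of the Hessian of `-log(-ρ)` composed with the inward translation and the Hessian of
`-log(-ρ)`. -/
theorem lim_hess_comp_sub [l.NeBot] (f : InwardFamily Ω p₀ l t p) (h : IsCollar k Ω W) (hk : 3 ≤ k)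
    (hρ : IsDefiningFunctionOn 2 Ω V ρ) (hu : Tendsto u l (𝓝 u₀))
    (hut : ∀ᶠ i in l, inner ℝ (nrm Ω (p i)) (u i) = 0) :
    Tendsto (fun i => hess (fun y => -Real.log (-ρ (inward Ω (t i) y))) (p i) (u i) (u i)
        - hess (fun w => -Real.log (-ρ w)) (inward Ω (t i) (p i)) (u i) (u i)) l
      (𝓝 (-‖shape Ω p₀ u₀‖ ^ 2)) := by
  have hpW := h.subset f.mem₀
  have h0 := f.lim_tangent h hk hu hut
  have hSu : Tendsto (fun i => shape Ω (p i) (u i)) l (𝓝 (shape Ω p₀ u₀)) :=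
    tendsto_clm_apply (f.lim_shape h hk) hu
  have hDS : Tendsto (fun i => fderiv ℝ (shape Ω) (p i) (u i) (u i)) l
      (𝓝 (fderiv ℝ (shape Ω) p₀ u₀ u₀)) := by
    have : ContinuousAt (fderiv ℝ (shape Ω)) p₀ :=
      ((h.contDiffAt_shape hk hpW).fderiv_right (m := 0) (by norm_num)).continuousAt
    exact tendsto_clm_apply (tendsto_clm_apply (this.tendsto.comp f.lim_p) hu) hu
  have l1 := f.lim_mul_hess h hk hρ hu hSu hut
  have l2 := f.lim_sq_mul_hess h hk hρ hSu hSu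
  have l3 := f.lim_mul_fderiv h hk hρ hDS
  rw [h.inner_nrm_shape hk hpW, hρ.hess_tangent h hk f.mem₀ h0 (h.inner_nrm_shape hk hpW u₀),
    mul_div_cancel_left₀ _ (hρ.fderiv_nrm_pos h hk f.mem₀).ne', mul_zero, add_zero,
    real_inner_self_eq_norm_sq] at l1
  rw [h.inner_nrm_shape hk hpW, mul_zero] at l2
  rw [h.inner_nrm_fderiv_shape hk hpW] at l3
  -- D²ψ is evaluated at u - tSu: the cross term gives -2|Su|² and the square of Su gives 0. The
  -- curvature of the translation adds -tDψ(DS(u)u), which tends to +|Su|².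
  have hlim := ((l1.const_mul (-2)).add l2).sub l3
  have heq : -2 * ‖shape Ω p₀ u₀‖ ^ 2 + 0 - -‖shape Ω p₀ u₀‖ ^ 2 = -‖shape Ω p₀ u₀‖ ^ 2 := by ring
  rw [heq] at hlim
  refine hlim.congr' ?_
  filter_upwards [f.eventually_neg h hk hρ, f.mem] with i hneg hpi
  have hC := contDiffAt_neg_log_neg hneg.1 hneg.2
  have hq := hess_quadratic hC (u i) (shape Ω (p i) (u i)) 1 (-t i)
  rw [one_smul, neg_smul, ← sub_eq_add_neg] at hq
  rw [h.hess_comp_inward hk (h.subset hpi) hC, hq]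
  ring

/-- The translation changes the slope by tDψ(Su), which tends to ⟨N,Su⟩ = 0. -/
theorem lim_fderiv_comp [l.NeBot] (f : InwardFamily Ω p₀ l t p) (h : IsCollar k Ω W) (hk : 3 ≤ k)
    (hρ : IsDefiningFunctionOn 2 Ω V ρ) (hu : Tendsto u l (𝓝 u₀))
    (hut : ∀ᶠ i in l, inner ℝ (nrm Ω (p i)) (u i) = 0) :
    Tendsto (fun i => fderiv ℝ (fun y => -Real.log (-ρ (inward Ω (t i) y))) (p i) (u i)) l
      (𝓝 (tangentSlope Ω ρ p₀ u₀)) := by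
  have hpW := h.subset f.mem₀
  have hSu : Tendsto (fun i => shape Ω (p i) (u i)) l (𝓝 (shape Ω p₀ u₀)) :=
    tendsto_clm_apply (f.lim_shape h hk) hu
  have hlim := (f.lim_fderiv_tangent h hk hρ hu hut).sub (f.lim_mul_fderiv h hk hρ hSu)
  rw [h.inner_nrm_shape hk hpW, sub_zero] at hlim
  refine hlim.congr' ?_
  filter_upwards [f.eventually_neg h hk hρ, f.mem] with i hneg hpi
  have hC := contDiffAt_neg_log_neg hneg.1 hneg.2
  rw [h.fderiv_comp_inward hk (h.subset hpi) (f := fun w => -Real.log (-ρ w))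
    (hC.differentiableAt (by norm_num)), map_sub, map_smul, smul_eq_mul]

theorem lim_twist (f : InwardFamily Ω p₀ l t p) (h : IsCollar k Ω W) (hk : 3 ≤ k)
    (hτ : Tendsto τ l (𝓝 τ₀)) :
    Tendsto (fun i => twistRe Ω (p i) (τ i)) l (𝓝 (twistRe Ω p₀ τ₀)) ∧
      Tendsto (fun i => twistIm Ω (p i) (τ i)) l (𝓝 (twistIm Ω p₀ τ₀)) := by
  have hg := (f.lim_nrm h hk).const_smul Complex.I
  exact ⟨hg.inner (tendsto_clm_apply (f.lim_shape h hk) (hτ.const_smul Complex.I)),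
    (hg.inner (tendsto_clm_apply (f.lim_shape h hk) hτ)).neg⟩

/-- The strict boundary inequality for the translates of `-log(-ρ)`, perturbed by `ε‖z‖²`. -/
theorem eventually_strictBoundaryIneq [l.NeBot] (f : InwardFamily Ω p₀ l t p) (h : IsCollar k Ω W)
    (hk : 3 ≤ k) (hρ : IsDefiningFunctionOn 2 Ω V ρ) {U : Set (Cn n)} (hU : IsBoundaryNhd Ω U) {η : ℝ}
    (hη : η < 1)
    (hpsh : ∀ z ∈ U ∩ Ω, ∀ X, η * (fderiv ℝ (fun w => -Real.log (-ρ w)) z X ^ 2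
      + fderiv ℝ (fun w => -Real.log (-ρ w)) z (Complex.I • X) ^ 2)
        ≤ realLevi (fun w => -Real.log (-ρ w)) z X)
    (hτ : Tendsto τ l (𝓝 τ₀)) (hτ1 : ∀ᶠ i in l, inner ℝ (nrm Ω (p i)) (τ i) = 0)
    (hτ2 : ∀ᶠ i in l, inner ℝ (nrm Ω (p i)) (Complex.I • τ i) = 0) (hτ0 : τ₀ ≠ 0)
    {κ ε R : ℝ} (hε : 0 < ε) (hR : ‖p₀‖ ≤ R)
    (hpert : ∀ y₁ y₂ e₁ e₂ T : ℝ, 0 ≤ T → e₁ ^ 2 + e₂ ^ 2 ≤ 8 * R ^ 2 * T →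
      κ * ((y₁ + ε * e₁) ^ 2 + (y₂ + ε * e₂) ^ 2) + ε * T
        ≤ η / (1 - η) * (y₁ ^ 2 + y₂ ^ 2) + 4 * ε * T) :
    ∀ᶠ i in l, StrictBoundaryIneq Ω κ
      (fun y => -Real.log (-ρ (inward Ω (t i) y)) + ε * ‖y‖ ^ 2) (p i) (τ i) := by
  have hIτ := hτ.const_smul Complex.I
  obtain ⟨L, hL, hLle⟩ := f.exists_lower_bound h hk hρ hU hη hpsh hτ hτ1 hτ2
  obtain ⟨ht1, ht2⟩ := f.lim_twist h hk hτ
  have hS1 := (tendsto_clm_apply (f.lim_shape h hk) hτ).norm.pow 2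
  have hS2 := (tendsto_clm_apply (f.lim_shape h hk) hIτ).norm.pow 2
  have hD1 := (f.lim_fderiv_comp h hk hρ hτ hτ1).add
    (((f.lim_p.inner hτ (𝕜 := ℝ)).const_mul 2).const_mul ε)
  have hD2 := (f.lim_fderiv_comp h hk hρ hIτ hτ2).add
    (((f.lim_p.inner hIτ (𝕜 := ℝ)).const_mul 2).const_mul ε)
  have hH := (f.lim_hess_comp_sub h hk hρ hτ hτ1).add (f.lim_hess_comp_sub h hk hρ hIτ hτ2)
  have hN := (hτ.norm.pow 2).const_mul (4 * ε)
  have hlim := ((((((hL.add hH).add hN).add hS1).add hS2).sub (ht1.pow 2)).sub (ht2.pow 2)).sub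
    ((((hD1.sub ht1).pow 2).add ((hD2.sub ht2).pow 2)).const_mul κ)
  -- In the limit the terms in |Sτ|², |S(iτ)|² and in the squared twists cancel. What remains
  -- compares κ with η/(1-η), with a margin ε‖τ₀‖².
  have hpos := hpert (tangentSlope Ω ρ p₀ τ₀ - twistRe Ω p₀ τ₀)
    (tangentSlope Ω ρ p₀ (Complex.I • τ₀) - twistIm Ω p₀ τ₀) (2 * inner ℝ p₀ τ₀)
    (2 * inner ℝ p₀ (Complex.I • τ₀)) (‖τ₀‖ ^ 2) (by positivity) (sq_inner_add_sq_inner_le hR)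
  have hT : 0 < ε * ‖τ₀‖ ^ 2 := by have := norm_pos_iff.2 hτ0; positivity
  rw [← add_sub_right_comm, ← add_sub_right_comm] at hpos
  have hev := hlim.eventually_const_lt (u := 0) (by linarith)
  filter_upwards [hev, hLle, f.mem, f.eventually_neg h hk hρ] with i hi hLi hpi hneg
  have hC := contDiffAt_neg_log_neg hneg.1 hneg.2
  have hC' : ContDiffAt ℝ 2 (fun y => -Real.log (-ρ (inward Ω (t i) y))) (p i) :=
    ContDiffAt.comp (g := fun w => -Real.log (-ρ w)) (p i) hC
      (h.contDiffAt_inward hk (h.subset hpi) (t i))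
  have hN2 : ContDiff ℝ 2 (fun w : Cn n => ε * ‖w‖ ^ 2) := contDiff_const_mul_norm_sq ε
  have hD : ∀ u, fderiv ℝ (fun y => -Real.log (-ρ (inward Ω (t i) y)) + ε * ‖y‖ ^ 2) (p i) u
      = fderiv ℝ (fun y => -Real.log (-ρ (inward Ω (t i) y))) (p i) u
        + ε * (2 * inner ℝ (p i) u) := by
    intro u
    rw [← fderiv_const_mul_norm_sq, fderiv_fun_add (hC'.differentiableAt (by norm_num))
      (hN2.differentiable (by norm_num)).differentiableAt]
    rfl
  rw [StrictBoundaryIneq, hD, hD, realLevi_add hC' hN2.contDiffAt, realLevi_const_mul_norm_sq]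
  simp only [realLevi] at hLi ⊢
  linarith

end InwardFamily

end

end DFIndex

/-! ### Smooth approximation in C² near a compact set. -/

namespace DFIndex

noncomputable section

section Smoothing

variable {E F : Type*} [NormedAddCommGroup E] [NormedSpace ℝ E]
  [NormedAddCommGroup F] [NormedSpace ℝ F]

/-- A function of class `C^m` near a compact set agrees near that set with a compactly supported
one. -/
theorem exists_compactlySupported_eventuallyEq [FiniteDimensional ℝ E] {m : ℕ∞} {f : E → ℝ}
    {K W : Set E} (hK : IsCompact K) (hW : IsOpen W) (hKW : K ⊆ W) (hf : ContDiffOn ℝ m f W) :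
    ∃ g : E → ℝ, ContDiff ℝ m g ∧ HasCompactSupport g ∧ ∀ x ∈ K, g =ᶠ[𝓝 x] f := by
  obtain ⟨t, ht, hKt, htW⟩ := exists_compact_between hK hW hKW
  obtain ⟨χ, h1, h0, -⟩ := exists_contMDiffMap_one_nhds_of_subset_interior
    (modelWithCornersSelf ℝ E) (n := m) hK.isClosed hKt
  have hχ : ContDiff ℝ m χ := contMDiff_iff_contDiff.1 χ.contMDiff
  refine ⟨fun x => χ x * f x, contDiff_iff_contDiffAt.2 fun x => ?_, ?_, fun x hx => ?_⟩
  · by_cases hx : x ∈ t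
    · exact hχ.contDiffAt.mul (hf.contDiffAt (hW.mem_nhds (htW hx)))
    · refine (contDiffAt_const (c := (0 : ℝ))).congr_of_eventuallyEq ?_
      filter_upwards [ht.isClosed.isOpen_compl.mem_nhds hx] with y hy
      rw [h0 y hy, zero_mul]
  · exact HasCompactSupport.intro ht fun x hx => by rw [h0 x hx, zero_mul]
  · filter_upwards [(eventually_nhdsSet_iff_forall.1 h1) x hx] with y hy
    rw [hy, one_mul]

open MeasureTheory in
/-- Differentiation commutes with scalar convolution. -/
theorem fderiv_convolution_lsmul [MeasurableSpace E] [BorelSpace E] {μ : Measure E} [SFinite μ]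
    [μ.IsAddLeftInvariant] {φ : E → ℝ}
    {g : E → F} (hφ : LocallyIntegrable φ μ) (hg : ContDiff ℝ 1 g) (hgs : HasCompactSupport g) :
    fderiv ℝ (convolution φ g (ContinuousLinearMap.lsmul ℝ ℝ) μ)
      = convolution φ (fderiv ℝ g) (ContinuousLinearMap.lsmul ℝ ℝ) μ := by
  funext x
  rw [(hgs.hasFDerivAt_convolution_right (ContinuousLinearMap.lsmul ℝ ℝ) hφ hg x).fderiv]
  congr 1

open MeasureTheory in
/-- Mollification of a compactly supported continuous function converges uniformly. -/
theorem exists_forall_norm_convolution_sub_le [FiniteDimensional ℝ E] [CompleteSpace F]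
    [MeasurableSpace E] [BorelSpace E] (μ : Measure E) [μ.IsAddHaarMeasure] {g : E → F}
    (hg : Continuous g) (hgs : HasCompactSupport g) {ε : ℝ} (hε : 0 < ε) :
    ∃ δ > 0, ∀ φ : ContDiffBump (0 : E), φ.rOut ≤ δ → ∀ x,
      ‖convolution (φ.normed μ) g (ContinuousLinearMap.lsmul ℝ ℝ) μ x - g x‖ ≤ ε := by
  obtain ⟨δ, hδ, hu⟩ := Metric.uniformContinuous_iff.1
    (hg.uniformContinuous_of_tendsto_cocompact hgs.is_zero_at_infty) ε hε
  refine ⟨δ, hδ, fun φ hφ x => ?_⟩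
  rw [← dist_eq_norm]
  exact φ.dist_normed_convolution_le hg.aestronglyMeasurable fun y hy =>
    (hu ((Metric.mem_ball.1 hy).trans_le hφ)).le

open MeasureTheory in
/-- Smooth approximation in `C²` of a compactly supported `C²` function. -/
theorem exists_contDiff_fderiv_sub_le [FiniteDimensional ℝ E] {g : E → ℝ} (hg : ContDiff ℝ 2 g)
    (hgs : HasCompactSupport g) {ε : ℝ} (hε : 0 < ε) :
    ∃ G : E → ℝ, ContDiff ℝ ∞ G ∧ ∀ x, ‖fderiv ℝ G x - fderiv ℝ g x‖ ≤ ε ∧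
      ‖fderiv ℝ (fderiv ℝ G) x - fderiv ℝ (fderiv ℝ g) x‖ ≤ ε := by
  borelize E
  have hg1 : ContDiff ℝ 1 (fderiv ℝ g) := hg.fderiv_right (by norm_num)
  have hs1 := hgs.fderiv (𝕜 := ℝ)
  obtain ⟨δ₁, hδ₁, hu₁⟩ := exists_forall_norm_convolution_sub_le Measure.addHaar
    hg1.continuous hs1 hε
  obtain ⟨δ₂, hδ₂, hu₂⟩ := exists_forall_norm_convolution_sub_le Measure.addHaar
    (hg1.continuous_fderiv (by norm_num)) (hs1.fderiv (𝕜 := ℝ)) hε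
  have hδ : 0 < min δ₁ δ₂ := lt_min hδ₁ hδ₂
  set φ : ContDiffBump (0 : E) := ⟨min δ₁ δ₂ / 2, min δ₁ δ₂, half_pos hδ, half_lt_self hδ⟩
  have hφ : LocallyIntegrable (φ.normed Measure.addHaar) (Measure.addHaar : Measure E) :=
    φ.continuous_normed.locallyIntegrable
  refine ⟨convolution (φ.normed Measure.addHaar) g (ContinuousLinearMap.lsmul ℝ ℝ) Measure.addHaar,
    φ.hasCompactSupport_normed.contDiff_convolution_left _ φ.contDiff_normed
      hg.continuous.locallyIntegrable, fun x => ?_⟩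
  -- Both derivatives fall on g, so the derivatives of the mollified function are mollifications of
  -- continuous compactly supported maps, and one bump serves both.
  rw [fderiv_convolution_lsmul hφ (hg.of_le (by norm_num)) hgs,
    fderiv_convolution_lsmul hφ hg1 hs1]
  exact ⟨hu₁ φ (min_le_left _ _) x, hu₂ φ (min_le_right _ _) x⟩

/-- Smooth approximation in `C²` on a compact set. -/
theorem exists_contDiff_approx [FiniteDimensional ℝ E] {f : E → ℝ} {K W : Set E}
    (hK : IsCompact K) (hW : IsOpen W) (hKW : K ⊆ W) (hf : ContDiffOn ℝ 2 f W) {ε : ℝ} (hε : 0 < ε) :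
    ∃ G : E → ℝ, ContDiff ℝ ∞ G ∧ ∀ x ∈ K, ‖fderiv ℝ G x - fderiv ℝ f x‖ ≤ ε ∧
      ‖fderiv ℝ (fderiv ℝ G) x - fderiv ℝ (fderiv ℝ f) x‖ ≤ ε := by
  obtain ⟨g, hg, hgs, hgf⟩ := exists_compactlySupported_eventuallyEq (m := 2) hK hW hKW hf
  obtain ⟨G, hG, happ⟩ := exists_contDiff_fderiv_sub_le hg hgs hε
  refine ⟨G, hG, fun x hx => ?_⟩
  rw [← (hgf x hx).fderiv_eq, ← (hgf x hx).fderiv.fderiv_eq]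
  exact happ x

end Smoothing

end

end DFIndex

/-! ### From a defining function to the boundary inequality. -/

namespace DFIndex

noncomputable section

variable {n : ℕ}

/-- Tube lemma: a property that holds for small t near each point of K, tested on K only, holds on K
with a single bound on t. -/
theorem _root_.IsCompact.eventually_nhdsGT_forall {Y : Type*} [TopologicalSpace Y] {K : Set Y}
    (hK : IsCompact K) {P : ℝ → Y → Prop}
    (h : ∀ y ∈ K, ∀ᶠ q in (𝓝[>] (0 : ℝ) ×ˢ 𝓝 y) ⊓ 𝓟 {q | q.2 ∈ K}, P q.1 q.2) :
    ∀ᶠ t in 𝓝[>] (0 : ℝ), ∀ y ∈ K, P t y := by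
  have h1 : {q : ℝ × Y | q.2 ∈ K → P q.1 q.2} ∈ 𝓝[>] (0 : ℝ) ×ˢ 𝓝ˢ K :=
    hK.mem_prod_nhdsSet_of_forall fun y hy => eventually_inf_principal.1 (h y hy)
  have h2 : ∀ᶠ q : ℝ × Y in 𝓝[>] (0 : ℝ) ×ˢ 𝓟 K, q.2 ∈ K → P q.1 q.2 :=
    (Filter.prod_mono le_rfl principal_le_nhdsSet) h1
  filter_upwards [eventually_prod_principal_iff.1 h2] with t ht y hy using ht y hy hy

/-- The unit complex tangent vectors at boundary points. -/
def unitTangent (Ω : Set (Cn n)) : Set (Cn n × Cn n) :=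
  {q | q.1 ∈ frontier Ω ∧ ‖q.2‖ = 1 ∧ inner ℝ (nrm Ω q.1) q.2 = 0 ∧
    inner ℝ (nrm Ω q.1) (Complex.I • q.2) = 0}

theorem IsCollar.isCompact_unitTangent {k : ℕ∞} {Ω W : Set (Cn n)} (h : IsCollar k Ω W)
    (hk : 3 ≤ k) (hb : Bornology.IsBounded Ω) : IsCompact (unitTangent Ω) := by
  have hC : IsCompact (frontier Ω ×ˢ Metric.sphere (0 : Cn n) 1) :=
    (isCompact_frontier_of_isBounded hb).prod (isCompact_sphere _ _)
  have hn : ContinuousOn (fun q : Cn n × Cn n => nrm Ω q.1) (frontier Ω ×ˢ Metric.sphere 0 1) :=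
    fun q hq => ((h.continuousAt_nrm hk (h.subset hq.1)).comp continuousAt_fst).continuousWithinAt
  have hg : ContinuousOn (fun q : Cn n × Cn n =>
      ((inner ℝ (nrm Ω q.1) q.2 : ℝ), (inner ℝ (nrm Ω q.1) (Complex.I • q.2) : ℝ)))
      (frontier Ω ×ˢ Metric.sphere 0 1) :=
    (hn.inner continuousOn_snd).prodMk (hn.inner (continuousOn_snd.const_smul Complex.I))
  have heq : unitTangent Ω = (frontier Ω ×ˢ Metric.sphere (0 : Cn n) 1) ∩ (fun q : Cn n × Cn n =>
      ((inner ℝ (nrm Ω q.1) q.2 : ℝ), (inner ℝ (nrm Ω q.1) (Complex.I • q.2) : ℝ))) ⁻¹' {0} := by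
    ext q
    simp [unitTangent, Prod.ext_iff, and_assoc]
  rw [heq]
  exact hC.of_isClosed_subset (hg.preimage_isClosed_of_isClosed hC.isClosed isClosed_singleton)
    inter_subset_left

theorem StrictBoundaryIneq.smul {Ω : Set (Cn n)} {κ : ℝ} {φ : Cn n → ℝ} {z τ : Cn n}
    (h : StrictBoundaryIneq Ω κ φ z τ) {r : ℝ} (hr : 0 < r) :
    StrictBoundaryIneq Ω κ φ z (r • τ) := by
  simp only [StrictBoundaryIneq, realLevi_smul, twistRe, twistIm, smul_comm Complex.I r, map_smul,
    inner_smul_right_eq_smul, norm_smul, Real.norm_eq_abs, mul_pow, sq_abs, smul_eq_mul] at h ⊢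
  have := mul_lt_mul_of_pos_left h (pow_pos hr 2)
  linarith

theorem tendsto_of_norm_sub_le {ι E : Type*} [NormedAddCommGroup E] {l : Filter ι} {f g : ι → E}
    {a : E} {e : ι → ℝ} (he : Tendsto e l (𝓝 0)) (hfg : ∀ᶠ i in l, ‖f i - g i‖ ≤ e i)
    (hg : Tendsto g l (𝓝 a)) : Tendsto f l (𝓝 a) := by
  simpa using (squeeze_zero_norm' hfg he).add hg

/-- The strict boundary inequality is stable under `C²` approximation. -/
theorem IsCollar.eventually_strictBoundaryIneq_of_approx {k : ℕ∞} {Ω W : Set (Cn n)}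
    (h : IsCollar k Ω W) (hk : 3 ≤ k) (hb : Bornology.IsBounded Ω) {κ : ℝ} {φ : Cn n → ℝ}
    (hφ : ∀ p ∈ frontier Ω, ContDiffAt ℝ 2 φ p)
    (hφK : ∀ q ∈ unitTangent Ω, StrictBoundaryIneq Ω κ φ q.1 q.2) {G : ℝ → Cn n → ℝ}
    (hG : ∀ ε > 0, ∀ p ∈ frontier Ω, ‖fderiv ℝ (G ε) p - fderiv ℝ φ p‖ ≤ ε ∧
      ‖fderiv ℝ (fderiv ℝ (G ε)) p - fderiv ℝ (fderiv ℝ φ) p‖ ≤ ε) :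
    ∀ᶠ ε in 𝓝[>] (0 : ℝ), ∀ q ∈ unitTangent Ω, StrictBoundaryIneq Ω κ (G ε) q.1 q.2 := by
  refine (h.isCompact_unitTangent hk hb).eventually_nhdsGT_forall fun q₀ hq₀ => ?_
  have hC := hφ q₀.1 hq₀.1
  set l : Filter (ℝ × (Cn n × Cn n)) := (𝓝[>] (0 : ℝ) ×ˢ 𝓝 q₀) ⊓ 𝓟 {q | q.2 ∈ unitTangent Ω}
  have hl1 : Tendsto (fun q : ℝ × (Cn n × Cn n) => q.1) l (𝓝[>] 0) :=
    tendsto_fst.mono_left inf_le_left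
  have hl2 : Tendsto (fun q : ℝ × (Cn n × Cn n) => q.2) l (𝓝 q₀) := tendsto_snd.mono_left inf_le_left
  have hmem : ∀ᶠ q in l, q.2 ∈ unitTangent Ω := mem_inf_of_right (mem_principal_self _)
  have hp : Tendsto (fun q : ℝ × (Cn n × Cn n) => q.2.1) l (𝓝 q₀.1) :=
    (continuous_fst.tendsto q₀).comp hl2
  have hτ : Tendsto (fun q : ℝ × (Cn n × Cn n) => q.2.2) l (𝓝 q₀.2) :=
    (continuous_snd.tendsto q₀).comp hl2
  have hIτ := hτ.const_smul Complex.I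
  have h0 : Tendsto (fun q : ℝ × (Cn n × Cn n) => q.1) l (𝓝 0) :=
    hl1.mono_right nhdsWithin_le_nhds
  have hpos : ∀ᶠ q in l, 0 < q.1 := hl1.eventually self_mem_nhdsWithin
  have hD1 : Tendsto (fun q : ℝ × (Cn n × Cn n) => fderiv ℝ (G q.1) q.2.1) l
      (𝓝 (fderiv ℝ φ q₀.1)) := by
    refine tendsto_of_norm_sub_le h0 ?_ ((continuousAt_fderiv hC).tendsto.comp hp)
    filter_upwards [hmem, hpos] with q hq hq0 using (hG q.1 hq0 q.2.1 hq.1).1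
  have hD2 : Tendsto (fun q : ℝ × (Cn n × Cn n) => fderiv ℝ (fderiv ℝ (G q.1)) q.2.1) l
      (𝓝 (fderiv ℝ (fderiv ℝ φ) q₀.1)) := by
    refine tendsto_of_norm_sub_le (E := Cn n →L[ℝ] Cn n →L[ℝ] ℝ) h0 ?_
      ((continuousAt_hess hC).tendsto.comp hp)
    filter_upwards [hmem, hpos] with q hq hq0 using (hG q.1 hq0 q.2.1 hq.1).2
  have hnrm := (h.continuousAt_nrm hk (h.subset hq₀.1)).tendsto.comp hp
  have hS := (h.continuousAt_shape hk (h.subset hq₀.1)).tendsto.comp hp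
  have hSτ := tendsto_clm_apply hS hτ
  have hSI := tendsto_clm_apply hS hIτ
  have ht1 := (hnrm.const_smul Complex.I).inner hSI (𝕜 := ℝ)
  have ht2 := ((hnrm.const_smul Complex.I).inner hSτ (𝕜 := ℝ)).neg
  have hL := (((((tendsto_clm_apply (tendsto_clm_apply hD2 hτ) hτ).add
    (tendsto_clm_apply (tendsto_clm_apply hD2 hIτ) hIτ)).add (hSτ.norm.pow 2)).add
      (hSI.norm.pow 2)).sub (ht1.pow 2)).sub (ht2.pow 2)
  have hR := ((((tendsto_clm_apply hD1 hτ).sub ht1).pow 2).add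
    (((tendsto_clm_apply hD1 hIτ).sub ht2).pow 2)).const_mul κ
  exact hR.eventually_lt hL (hφK q₀ hq₀)

/-- A smooth function satisfying the strict boundary inequality, obtained from the translates of
`-log(-ρ)` when `-(-ρ)^η` is plurisubharmonic. -/
theorem exists_boundary_function {Ω : Set (Cn n)} (hb : Bornology.IsBounded Ω) {k : ℕ∞}
    (hk : 3 ≤ k) {W : Set (Cn n)} (h : IsCollar k Ω W) {η : ℝ} (hη0 : 0 < η) (hη1 : η < 1)
    {V : Set (Cn n)} {ρ : Cn n → ℝ} (hρ : IsDefiningFunctionOn 2 Ω V ρ) {U : Set (Cn n)}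
    (hU : IsBoundaryNhd Ω U) (hUV : U ⊆ V) (hpsh : IsC2PshOn (fun z => -(-ρ z) ^ η) (U ∩ Ω))
    (hΩ : IsOpen Ω) {s : ℝ} (hs0 : 0 < s) (hs : s < η) :
    ∃ φ : Cn n → ℝ, ContDiff ℝ ∞ φ ∧
      ∀ z ∈ frontier Ω, ∀ τ : Cn n, IsComplexTangent Ω z τ → τ ≠ 0 →
        gradientSide Ω s φ z τ < hessianSide Ω φ z τ := by
  have hcpt := isCompact_frontier_of_isBounded hb
  obtain ⟨R, hR⟩ := hcpt.isBounded.exists_norm_le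
  obtain ⟨ε, hε, hpert⟩ := exists_perturbation (κ := s / (1 - s)) (κ' := η / (1 - η))
    (R := 8 * R ^ 2) (div_nonneg hs0.le (by linarith)) (div_one_sub_lt hs hη1) (by positivity)
  have hneg : ∀ z ∈ U ∩ Ω, ρ z < 0 := fun z hz => (hρ.neg_iff z (hUV hz.1)).2 hz.2
  have hlog : ∀ z ∈ U ∩ Ω, ContDiffAt ℝ 2 (fun w => -Real.log (-ρ w)) z := fun z hz =>
    contDiffAt_neg_log_neg (hρ.contDiffAt (hUV hz.1)) (hneg z hz)
  have hpsh' : ∀ z ∈ U ∩ Ω, ∀ X, η * (fderiv ℝ (fun w => -Real.log (-ρ w)) z X ^ 2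
      + fderiv ℝ (fun w => -Real.log (-ρ w)) z (Complex.I • X) ^ 2)
        ≤ realLevi (fun w => -Real.log (-ρ w)) z X := by
    intro z hz X
    have h1 := hpsh.2 z hz X
    rw [leviForm_neg_rpow (hρ.contDiffAt (hUV hz.1)) (hneg z hz)] at h1
    have h2 : 0 < (-ρ z) ^ η := Real.rpow_pos_of_pos (by linarith [hneg z hz]) η
    have h3 := nonneg_of_mul_nonneg_right h1 (by positivity)
    linarith
  set Φ : ℝ → Cn n → ℝ := fun t y => -Real.log (-ρ (inward Ω t y)) + ε * ‖y‖ ^ 2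
  have hev1 : ∀ᶠ t in 𝓝[>] (0 : ℝ), ∀ p ∈ frontier Ω, inward Ω t p ∈ U ∩ Ω := by
    refine hcpt.eventually_nhdsGT_forall fun p₀ hp₀ => ?_
    have f : InwardFamily Ω p₀ ((𝓝[>] (0 : ℝ) ×ˢ 𝓝 p₀) ⊓ 𝓟 {q | q.2 ∈ frontier Ω})
        (fun q => q.1) (fun q => q.2) :=
      ⟨hp₀, tendsto_fst.mono_left inf_le_left, tendsto_snd.mono_left inf_le_left,
        mem_inf_of_right (mem_principal_self _)⟩
    exact (f.eventually_mem_nhd h hk hU).and (f.eventually_mem h hk)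
  have hev2 : ∀ᶠ t in 𝓝[>] (0 : ℝ), ∀ q ∈ unitTangent Ω,
      StrictBoundaryIneq Ω (s / (1 - s)) (Φ t) q.1 q.2 := by
    refine (h.isCompact_unitTangent hk hb).eventually_nhdsGT_forall fun q₀ hq₀ => ?_
    set l : Filter (ℝ × (Cn n × Cn n)) := (𝓝[>] (0 : ℝ) ×ˢ 𝓝 q₀) ⊓ 𝓟 {q | q.2 ∈ unitTangent Ω}
    rcases l.eq_or_neBot with hl | hl
    · rw [hl]
      exact eventually_bot
    have hl2 : Tendsto (fun q : ℝ × (Cn n × Cn n) => q.2) l (𝓝 q₀) :=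
      tendsto_snd.mono_left inf_le_left
    have hmem : ∀ᶠ q in l, q.2 ∈ unitTangent Ω := mem_inf_of_right (mem_principal_self _)
    have f : InwardFamily Ω q₀.1 l (fun q => q.1) (fun q => q.2.1) :=
      ⟨hq₀.1, tendsto_fst.mono_left inf_le_left, (continuous_fst.tendsto q₀).comp hl2,
        hmem.mono fun q hq => hq.1⟩
    have hq0 : q₀.2 ≠ 0 := norm_ne_zero_iff.1 (by rw [hq₀.2.1]; exact one_ne_zero)
    exact f.eventually_strictBoundaryIneq h hk hρ hU hη1 hpsh'
      ((continuous_snd.tendsto q₀).comp hl2) (hmem.mono fun q hq => hq.2.2.1)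
      (hmem.mono fun q hq => hq.2.2.2) hq0 hε (hR _ hq₀.1) hpert
  -- One depth t is fixed for all boundary points. The translate is then C² near the boundary and
  -- satisfies the strict inequality; only smoothness is missing.
  obtain ⟨t, ht1, ht2⟩ := (hev1.and hev2).exists
  have hcont : ContinuousOn (inward Ω t) W := fun x hx =>
    (h.contDiffAt_inward hk hx t).continuousAt.continuousWithinAt
  have hUo : IsOpen (W ∩ inward Ω t ⁻¹' (U ∩ Ω)) :=
    hcont.isOpen_inter_preimage h.isOpen (hU.1.inter hΩ)
  have hsub : frontier Ω ⊆ W ∩ inward Ω t ⁻¹' (U ∩ Ω) := fun p hp => ⟨h.subset hp, ht1 p hp⟩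
  have hΦ : ∀ x ∈ W ∩ inward Ω t ⁻¹' (U ∩ Ω), ContDiffAt ℝ 2 (Φ t) x := fun x hx =>
    (ContDiffAt.comp (g := fun w => -Real.log (-ρ w)) x (hlog _ hx.2)
      (h.contDiffAt_inward hk hx.1 t)).add (contDiff_const_mul_norm_sq ε).contDiffAt
  -- Stated for every real δ, with the zero function as a dummy for δ ≤ 0, so that the
  -- approximations form a family indexed by ℝ.
  have happ : ∀ δ : ℝ, ∃ G : Cn n → ℝ, 0 < δ → ContDiff ℝ ∞ G ∧ ∀ x ∈ frontier Ω,
      ‖fderiv ℝ G x - fderiv ℝ (Φ t) x‖ ≤ δ ∧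
        ‖fderiv ℝ (fderiv ℝ G) x - fderiv ℝ (fderiv ℝ (Φ t)) x‖ ≤ δ := by
    intro δ
    by_cases hδ : 0 < δ
    · obtain ⟨G, hG⟩ := exists_contDiff_approx hcpt hUo hsub
        (fun x hx => (hΦ x hx).contDiffWithinAt) hδ
      exact ⟨G, fun _ => hG⟩
    · exact ⟨0, fun h0 => absurd h0 hδ⟩
  choose G hG using happ
  obtain ⟨δ, hδ, hδ0⟩ := ((h.eventually_strictBoundaryIneq_of_approx hk hb
    (fun p hp => hΦ p (hsub hp)) ht2 fun δ hδ => (hG δ hδ).2).and self_mem_nhdsWithin).exists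
  have hGs := (hG δ hδ0).1
  refine ⟨G δ, hGs, fun z hz τ hτ hτ0 => ?_⟩
  have hzW := h.subset hz
  have hn : 0 < ‖τ‖ := norm_pos_iff.2 hτ0
  obtain ⟨hτ1, hτ2⟩ := (h.isComplexTangent_iff hk hzW τ).1 hτ
  have hmem : (z, ‖τ‖⁻¹ • τ) ∈ unitTangent Ω := by
    refine ⟨hz, ?_, ?_, ?_⟩
    · simp [norm_smul, hn.ne']
    · simp only [inner_smul_right_eq_smul, hτ1, smul_zero]
    · simp only [smul_comm Complex.I, inner_smul_right_eq_smul, hτ2, smul_zero]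
  -- Both sides are homogeneous of degree two in τ, so unit vectors suffice.
  have hfin := (hδ _ hmem).smul hn
  simp only [smul_smul, mul_inv_cancel₀ hn.ne', one_smul, StrictBoundaryIneq] at hfin
  have hG2 : ContDiff ℝ 2 (G δ) := hGs.of_le (WithTop.coe_le_coe.2 le_top)
  rw [h.gradientSide_eq hk hzW s (hG2.differentiable (by norm_num)).differentiableAt,
    h.hessianSide_eq hk hzW hG2.contDiffAt]
  linarith

end

end DFIndex

theorem mainTheorem4 {n : ℕ} (Ω : Set (DFIndex.Cn n)) (hΩ_open : IsOpen Ω)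
    (hΩ_conn : IsConnected Ω) (hΩ_bdd : Bornology.IsBounded Ω)
    (hΩ_psc : DFIndex.IsPseudoconvex Ω)
    (k : ℕ∞) (hk : 3 ≤ k) (hΩ_bdry : DFIndex.HasCkBoundary k Ω) :
    (∀ η : ℝ, 0 < η → η < 1 →
      ∀ (V : Set (DFIndex.Cn n)) (ρ : DFIndex.Cn n → ℝ), DFIndex.IsDefiningFunctionOn 2 Ω V ρ →
      ∀ Uη : Set (DFIndex.Cn n), DFIndex.IsBoundaryNhd Ω Uη → Uη ⊆ V →
        DFIndex.IsC2PshOn (fun z => -(-ρ z) ^ η) (Uη ∩ Ω) →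
      ∀ s : ℝ, 0 < s → s < η →
        ∃ (Us : Set (DFIndex.Cn n)) (φ : DFIndex.Cn n → ℝ),
          DFIndex.IsBoundaryNhd Ω Us ∧ Us ⊆ Uη ∧ ContDiffOn ℝ ∞ φ Us ∧
          ∀ z ∈ frontier Ω, ∀ τ : DFIndex.Cn n, DFIndex.IsComplexTangent Ω z τ → τ ≠ 0 →
            DFIndex.gradientSide Ω s φ z τ < DFIndex.hessianSide Ω φ z τ) ∧
    (∀ s : ℝ, 0 < s → s < 1 →
      ∀ (Us : Set (DFIndex.Cn n)) (φ : DFIndex.Cn n → ℝ),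
        DFIndex.IsBoundaryNhd Ω Us → ContDiffOn ℝ k φ Us →
        (∀ z ∈ frontier Ω, ∀ τ : DFIndex.Cn n, DFIndex.IsComplexTangent Ω z τ →
          DFIndex.gradientSide Ω s φ z τ ≤ DFIndex.hessianSide Ω φ z τ) →
      ∀ η : ℝ, 0 < η → η < s →
        ∃ (V : Set (DFIndex.Cn n)) (ρ : DFIndex.Cn n → ℝ),
          DFIndex.IsDefiningFunctionOn k Ω V ρ ∧
          ∃ Uη : Set (DFIndex.Cn n), DFIndex.IsBoundaryNhd Ω Uη ∧ Uη ⊆ V ∧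
            DFIndex.IsC2StrictlyPshOn (fun z => -(-ρ z) ^ η) (Uη ∩ Ω)) := by
  obtain ⟨W, hW⟩ := DFIndex.exists_isCollar hΩ_open hΩ_bdd hk hΩ_bdry
  refine ⟨fun η hη0 hη1 V ρ hρ Uη hUη hUV hpsh s hs0 hs => ?_,
    fun s _ hs1 Us φ hUs hφ hineq η hη0 hη =>
      DFIndex.exists_defining_function hΩ_open hΩ_bdd hΩ_psc hk hW hs1 hUs hφ hineq hη0 hη⟩
  obtain ⟨φ, hφ, hineq⟩ := DFIndex.exists_boundary_function hΩ_bdd hk hW hη0 hη1 hρ hUη hUV hpsh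
    hΩ_open hs0 hs
  -- φ is smooth on all of ℂⁿ, so the given neighbourhood needs no shrinking.
  exact ⟨Uη, φ, hUη, subset_rfl, hφ.contDiffOn, hineq⟩
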